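/- Let $k$ be a field of characteristic zero and let $m,n\ge 2$ be integers. For an integer $r\ge 1$ let $U_r(k)=\{\omega\in k:\omega^r=1\}$ and let $P_r(k)$ be the set of primitive $r$-th roots of unity in $k$. In a Hopf algebra, an element $g$ is called group-like if $\Delta(g)=g\otimes g$ and $\varepsilon(g)=1$; for a group-like $g$, an element $y$ is called $(g,1)$-primitive if $\Delta(y)=y\otimes g+1\otimes y$ (so $\varepsilon(y)=0$). For $q\in P_n(k)$ the Taft Hopf algebra $T_{n^2}(q)$ is the algebra generated by $h,x$ with relations $h^n=1$, $x^n=0$, $xh=q\,hx$, in which $h$ is group-like and $x$ is $(h,1)$-primitive (with antipode $S(h)=h^{-1}$, $S(x)=-xh^{-1}$). For $q\in P_m(k)$, $\overline q\in P_n(k)$ and $\sigma\in U_{\gcd(m,n)}(k)$, let $\mathrm T^{\sigma}_{n,m}(\overline q,q)$ be the Hopf algebra generated as an algebra by $h,x,H,X$ with relations $$h^m=H^n=1,\quad x^m=X^n=0,\quad xh=q\,hx,\quad XH=\overline q\,HX,$$ $$xH=\sigma Hx,\quad hX=\sigma Xh,\quad xX=\sigma Xx,\quad hH=Hh,$$ in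 which $h,H$ are group-like, $x$ is $(h,1)$-primitive and $X$ is $(H,1)$-primitive. For $q\in P_n(k)$ and $\alpha\in k^*$, let $\mathrm Q^{\alpha}_n(q)$ be the Hopf algebra generated as an algebra by $h,x,H,X$ with relations $$h^n=H^n=1,\quad x^n=X^n=0,\quad xh=q\,hx,\quad XH=q^{n-1}HX,$$ $$xH=q\,Hx,\quad hX=q\,Xh,\quad xX-q\,Xx=\alpha(1-Hh),\quad hH=Hh,$$ in which $h,H$ are group-like, $x$ is $(h,1)$-primitive and $X$ is $(H,1)$-primitive. For a finite dimensional Hopf algebra $A$ with (bijective) antipode $S$, the Drinfeld double $D(A)$ is the coalgebra $(A^*)^{\mathrm{cop}}\otimes A$ (tensor product of coalgebras) with unit $\varepsilon\otimes 1$ and product $$(f\otimes a)(g\otimes b)=f\,g\bigl(S^{-1}(a_{(3)})\,?\,a_{(1)}\bigr)\otimes a_{(2)}b ,$$ where $g(u\,?\,v)$ denotes the linear form $w\mapsto g(uwv)$ and the product of linear forms is the convolution product. **Theorem.** 1. Let $q\in P_m(k)$ and $\overline q\in P_n(k)$, and suppose that $n\ne m$, or that $m=n$ and $\overline q\ne q$.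 Then for all $\sigma,\sigma'\in U_{\gcd(m,n)}(k)$ there is an isomorphism of Hopf algebras $\mathrm T^{\sigma}_{n,m}(\overline q,q)\cong\mathrm T^{\sigma'}_{n,m}(\overline q,q)$ if and only if $\sigma=\sigma'$. 2. Let $q\in P_n(k)$. For all $\sigma,\sigma'\in U_n(k)$ there is an isomorphism of Hopf algebras $\mathrm T^{\sigma}_{n,n}(q,q)\cong\mathrm T^{\sigma'}_{n,n}(q,q)$ if and only if $\sigma'=\sigma$ or $\sigma'=\sigma^{-1}$. 3. Let $q\in P_n(k)$. For every $\alpha\in k^*$ there is an isomorphism of Hopf algebras $\mathrm Q^{\alpha}_n(q)\cong\mathrm Q^{1}_n(q)$. Moreover, $\mathrm Q^{1}_n(q)$ is isomorphic as a Hopf algebra to the Drinfeld double $D\bigl(T_{n^2}(q)\bigr)$. 4. Let $q\in P_n(k)$. For every $\sigma\in U_n(k)$, the Hopf algebras $\mathrm Q^{1}_n(q)$ and $\mathrm T^{\sigma}_{n,n}(q^{n-1},q)$ are not isomorphic. -/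

import Mathlib

open scoped TensorProduct

noncomputable section

namespace TaftDouble

universe u

section QBinomial

variable {k : Type u} [Field k]

/-- The Gaussian binomial coefficient `[i + j choose i]` at `q`. -/
def gaussCoeff (q : k) : ℕ → ℕ → k
  | 0, _ => 1
  | _ + 1, 0 => 1
  | i + 1, j + 1 => gaussCoeff q i (j + 1) + q ^ (i + 1) * gaussCoeff q (i + 1) j

theorem gaussCoeff_zero_left (q : k) (j : ℕ) : gaussCoeff q 0 j = 1 := by
  simp [gaussCoeff]

theorem gaussCoeff_zero_right (q : k) (i : ℕ) : gaussCoeff q i 0 = 1 := by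
  cases i <;> simp [gaussCoeff]

theorem gaussCoeff_succ (q : k) (i j : ℕ) : gaussCoeff q (i + 1) (j + 1) =
    gaussCoeff q i (j + 1) + q ^ (i + 1) * gaussCoeff q (i + 1) j := by
  simp [gaussCoeff]

theorem gaussCoeff_aux (q : k) (N : ℕ) : ∀ i j : ℕ, i + j = N →
    (1 - q ^ (i + 1)) * gaussCoeff q (i + 1) j = (1 - q ^ (i + j + 1)) * gaussCoeff q i j ∧
    (1 - q ^ (j + 1)) * gaussCoeff q i (j + 1) = (1 - q ^ (i + j + 1)) * gaussCoeff q i j := by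
  induction N with
  | zero =>
    intro i j h
    obtain ⟨rfl, rfl⟩ : i = 0 ∧ j = 0 := by omega
    simp [gaussCoeff]
  | succ N ih =>
    intro i j h
    constructor
    · cases j with
      | zero => simp [gaussCoeff_zero_right]
      | succ j =>
        have h2 := (ih i j (by omega)).2
        rw [gaussCoeff_succ]
        have h1 := (ih i j (by omega)).1
        linear_combination q ^ (i + 1) * h1 - q ^ (i + 1) * h2
    · cases i with
      | zero => simp [gaussCoeff_zero_left]
      | succ i =>
        have h2 := (ih i j (by omega)).2
        have h1 := (ih i j (by omega)).1
        rw [gaussCoeff_succ]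
        linear_combination h2 - h1

theorem pos_of_mem_primitiveRoots {m : ℕ} {q : k} (hq : q ∈ primitiveRoots m k) : 0 < m := by
  rcases Nat.eq_zero_or_pos m with rfl | h
  · simp at hq
  · exact h

variable {R : Type*} [Ring R] [Algebra k R]

theorem mul_pow_of_qcomm {q : k} {a b : R} (h : b * a = q • (a * b)) (j : ℕ) :
    b * a ^ j = q ^ j • (a ^ j * b) := by
  induction j with
  | zero => simp
  | succ j ih =>
    rw [pow_succ, ← mul_assoc, ih, smul_mul_assoc, mul_assoc, h, mul_smul_comm, smul_smul,
      ← pow_succ, mul_assoc]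

theorem mul_pow_eq_zero_of_qcomm {q : k} {a b : R} (h : b * a = q • (a * b)) {m : ℕ}
    (ha : a ^ m = 0) : (a * b) ^ m = 0 := by
  have key : ∀ j : ℕ, ∃ c : R, (a * b) ^ j = a ^ j * c := by
    intro j
    induction j with
    | zero => exact ⟨1, by simp⟩
    | succ j ih =>
      obtain ⟨c, hc⟩ := ih
      refine ⟨q ^ j • (b * c), ?_⟩
      rw [pow_succ', hc, mul_assoc, ← mul_assoc b, mul_pow_of_qcomm h, pow_succ']
      simp only [smul_mul_assoc, mul_smul_comm, mul_assoc]
  obtain ⟨c, hc⟩ := key m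
  rw [hc, ha, zero_mul]

theorem add_pow_of_qcomm {q : k} {a b : R} (h : b * a = q • (a * b)) (N : ℕ) :
    (a + b) ^ N = ∑ p ∈ Finset.HasAntidiagonal.antidiagonal N, gaussCoeff q p.1 p.2 • (a ^ p.1 * b ^ p.2) := by
  induction N with
  | zero => simp [gaussCoeff]
  | succ N ih =>
    have e : ∀ p : ℕ × ℕ, (a + b) * gaussCoeff q p.1 p.2 • (a ^ p.1 * b ^ p.2) =
        gaussCoeff q p.1 p.2 • (a ^ (p.1 + 1) * b ^ p.2) +
        (q ^ p.1 * gaussCoeff q p.1 p.2) • (a ^ p.1 * b ^ (p.2 + 1)) := by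
      intro p
      rw [mul_smul_comm, add_mul, smul_add, ← mul_assoc, ← mul_assoc, mul_pow_of_qcomm h,
        pow_succ', smul_mul_assoc, smul_smul, mul_assoc (a ^ p.1), ← pow_succ' b,
        mul_comm (q ^ p.1)]
    rw [pow_succ', ih, Finset.mul_sum, Finset.sum_congr rfl (fun p _ => e p),
      Finset.sum_add_distrib]
    cases N with
    | zero => rw [Finset.Nat.sum_antidiagonal_succ]; simp [gaussCoeff, add_comm]
    | succ N =>
      conv_rhs => rw [Finset.Nat.sum_antidiagonal_succ, Finset.Nat.sum_antidiagonal_succ']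
      conv_lhs =>
        congr
        · rw [Finset.Nat.sum_antidiagonal_succ']
        · rw [Finset.Nat.sum_antidiagonal_succ]
      simp only [gaussCoeff_succ, add_smul, Finset.sum_add_distrib, gaussCoeff_zero_left,
        gaussCoeff_zero_right]
      simp only [pow_zero, one_smul, mul_one, one_mul]
      abel

/-- The `q`-binomial formula at a primitive `m`-th root of unity. -/
theorem add_pow_of_primitive {m : ℕ} {q : k} (hq : q ∈ primitiveRoots m k) {a b : R}
    (h : b * a = q • (a * b)) : (a + b) ^ m = a ^ m + b ^ m := by
  have hm : 0 < m := pos_of_mem_primitiveRoots hq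
  have hp : IsPrimitiveRoot q m := (mem_primitiveRoots hm).1 hq
  obtain ⟨N, rfl⟩ : ∃ N, m = N + 1 := ⟨m - 1, by omega⟩
  rw [add_pow_of_qcomm h, Finset.Nat.sum_antidiagonal_succ]
  cases N with
  | zero => simp [gaussCoeff, add_comm]
  | succ N =>
    rw [Finset.Nat.sum_antidiagonal_succ']
    have : ∀ p ∈ Finset.HasAntidiagonal.antidiagonal N,
        gaussCoeff q (p.1 + 1) (p.2 + 1) • (a ^ (p.1 + 1) * b ^ (p.2 + 1)) = 0 := by
      intro p hpN
      have hs : p.1 + p.2 = N := by simpa using hpN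
      have h1 := (gaussCoeff_aux q _ p.1 (p.2 + 1) rfl).1
      rw [show p.1 + (p.2 + 1) + 1 = N + 1 + 1 by omega, hp.pow_eq_one, sub_self, zero_mul] at h1
      have h2 : (1 : k) - q ^ (p.1 + 1) ≠ 0 := fun h0 =>
        hp.pow_ne_one_of_pos_of_lt (by omega) (by omega) (sub_eq_zero.1 h0).symm
      rw [(mul_eq_zero.1 h1).resolve_left h2, zero_smul]
    rw [Finset.sum_eq_zero this]
    simp [gaussCoeff_zero_left, gaussCoeff_zero_right, add_comm]

theorem pow_pred_mem_primitiveRoots {n : ℕ} {q : k} (hq : q ∈ primitiveRoots n k) :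
    q ^ (n - 1) ∈ primitiveRoots n k := by
  have hn : 0 < n := pos_of_mem_primitiveRoots hq
  have hp : IsPrimitiveRoot q n := (mem_primitiveRoots hn).1 hq
  rw [mem_primitiveRoots hn]
  refine hp.pow_of_coprime _ ?_
  exact (Nat.coprime_self_sub_left hn).2 (Nat.coprime_one_left n)

end QBinomial

section Generators

open Coalgebra LinearMap WithConv

variable {k : Type u} [CommRing k] {B : Type*} [Ring B] [Bialgebra k B]

theorem conv_antihom_mul_id (f : B →ₗ[k] B) (hf : ∀ x y, f (x * y) = f y * f x) {x y : B}
    (hx : (toConv f * toConv LinearMap.id : WithConv (B →ₗ[k] B)) x = algebraMap k B (counit x))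
    (hy : (toConv f * toConv LinearMap.id : WithConv (B →ₗ[k] B)) y = algebraMap k B (counit y)) :
    (toConv f * toConv LinearMap.id : WithConv (B →ₗ[k] B)) (x * y) =
      algebraMap k B (counit (x * y)) := by
  rw [(ℛ k x).convMul_apply] at hx
  rw [(ℛ k y).convMul_apply] at hy
  rw [((ℛ k x).mul (ℛ k y)).convMul_apply]
  simp only [Coalgebra.Repr.mul_index, Coalgebra.Repr.mul_left, Coalgebra.Repr.mul_right,
    LinearMap.id_apply, hf] at hx hy ⊢
  rw [Finset.sum_product_right]
  have : ∀ j : B × B, ∑ i ∈ (ℛ k x).index, f ((ℛ k y).left j) * f ((ℛ k x).left i) *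
      ((ℛ k x).right i * (ℛ k y).right j) =
      (algebraMap k B (counit x)) * (f ((ℛ k y).left j) * (ℛ k y).right j) := by
    intro j
    rw [← mul_assoc, Algebra.commutes, ← hx, Finset.mul_sum, Finset.sum_mul]
    simp only [mul_assoc]
  rw [Finset.sum_congr rfl (fun j _ => this j), ← Finset.mul_sum, hy, Bialgebra.counit_mul, map_mul]

theorem conv_id_mul_antihom (f : B →ₗ[k] B) (hf : ∀ x y, f (x * y) = f y * f x) {x y : B}
    (hx : (toConv LinearMap.id * toConv f : WithConv (B →ₗ[k] B)) x = algebraMap k B (counit x))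
    (hy : (toConv LinearMap.id * toConv f : WithConv (B →ₗ[k] B)) y = algebraMap k B (counit y)) :
    (toConv LinearMap.id * toConv f : WithConv (B →ₗ[k] B)) (x * y) =
      algebraMap k B (counit (x * y)) := by
  rw [(ℛ k x).convMul_apply] at hx
  rw [(ℛ k y).convMul_apply] at hy
  rw [((ℛ k x).mul (ℛ k y)).convMul_apply]
  simp only [Coalgebra.Repr.mul_index, Coalgebra.Repr.mul_left, Coalgebra.Repr.mul_right,
    LinearMap.id_apply, hf] at hx hy ⊢
  rw [Finset.sum_product]
  have : ∀ i : B × B, ∑ j ∈ (ℛ k y).index, (ℛ k x).left i * (ℛ k y).left j *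
      (f ((ℛ k y).right j) * f ((ℛ k x).right i)) =
      (ℛ k x).left i * f ((ℛ k x).right i) * (algebraMap k B (counit y)) := by
    intro i
    rw [mul_assoc, ← Algebra.commutes, ← hy, Finset.sum_mul, Finset.mul_sum]
    simp only [mul_assoc]
  rw [Finset.sum_congr rfl (fun j _ => this j), ← Finset.sum_mul, hx, Bialgebra.counit_mul, map_mul]

theorem conv_mul_algebraMap (f g : B →ₗ[k] B) (hf : f 1 = 1) (hg : g 1 = 1) (r : k) :
    (toConv f * toConv g : WithConv (B →ₗ[k] B)) (algebraMap k B r) =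
      algebraMap k B (counit (algebraMap k B r)) := by
  rw [Algebra.algebraMap_eq_smul_one, map_smul, map_smul, convMul_apply]
  simp [Algebra.TensorProduct.one_def, hf, hg, Algebra.algebraMap_eq_smul_one]

/-- An anti-homomorphism which satisfies the antipode identities on algebra generators of a
bialgebra is an antipode. -/
abbrev hopfAlgebraOfGenerators (S : B →ₐ[k] Bᵐᵒᵖ) (s : Set B) (hs : Algebra.adjoin k s = ⊤)
    (hl : ∀ b ∈ s, (toConv ((MulOpposite.opLinearEquiv k).symm.toLinearMap ∘ₗ S.toLinearMap) *
      toConv LinearMap.id : WithConv (B →ₗ[k] B)) b = algebraMap k B (counit b))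
    (hr : ∀ b ∈ s, (toConv LinearMap.id * toConv ((MulOpposite.opLinearEquiv k).symm.toLinearMap ∘ₗ
      S.toLinearMap) : WithConv (B →ₗ[k] B)) b = algebraMap k B (counit b)) :
    HopfAlgebra k B := by
  refine .ofConvInverse ((MulOpposite.opLinearEquiv k).symm.toLinearMap ∘ₗ S.toLinearMap) ?_ ?_
  · apply WithConv.ext
    ext b
    have hb : b ∈ Algebra.adjoin k s := hs ▸ Algebra.mem_top
    change (_ * _ : WithConv (B →ₗ[k] B)) _ = algebraMap k B (counit _)
    induction hb using Algebra.adjoin_induction with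
    | mem x hx => exact hl x hx
    | algebraMap r => exact conv_mul_algebraMap _ _ (by simp) (by simp) r
    | add x y _ _ hx hy => rw [map_add, map_add, hx, hy, map_add]
    | mul x y _ _ hx hy => exact conv_antihom_mul_id _ (fun x y => by simp) hx hy
  · apply WithConv.ext
    ext b
    have hb : b ∈ Algebra.adjoin k s := hs ▸ Algebra.mem_top
    change (_ * _ : WithConv (B →ₗ[k] B)) _ = algebraMap k B (counit _)
    induction hb using Algebra.adjoin_induction with
    | mem x hx => exact hr x hx
    | algebraMap r => exact conv_mul_algebraMap _ _ (by simp) (by simp) r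
    | add x y _ _ hx hy => rw [map_add, map_add, hx, hy, map_add]
    | mul x y _ _ hx hy => exact conv_id_mul_antihom _ (fun x y => by simp) hx hy

end Generators

section TensorRelations

variable {k : Type u} [Field k] {A : Type*} [Ring A] [Algebra k A]

theorem groupLike_pow_tmul {g : A} {m : ℕ} (h : g ^ m = 1) : (g ⊗ₜ[k] g) ^ m = 1 := by
  rw [Algebra.TensorProduct.tmul_pow, h, Algebra.TensorProduct.one_def]

theorem skew_mul_groupLike {c : k} {x g G : A} (h : x * G = c • (G * x)) (hg : g * G = G * g) :
    (x ⊗ₜ[k] g + 1 ⊗ₜ x) * (G ⊗ₜ G) = c • ((G ⊗ₜ G) * (x ⊗ₜ g + 1 ⊗ₜ x)) := by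
  simp only [add_mul, mul_add, Algebra.TensorProduct.tmul_mul_tmul, h, hg, one_mul, mul_one,
    smul_add, TensorProduct.smul_tmul', TensorProduct.tmul_smul]

theorem groupLike_mul_skew {c : k} {x g G : A} (h : G * x = c • (x * G)) (hg : g * G = G * g) :
    (G ⊗ₜ[k] G) * (x ⊗ₜ g + 1 ⊗ₜ x) = c • ((x ⊗ₜ g + 1 ⊗ₜ x) * (G ⊗ₜ G)) := by
  simp only [add_mul, mul_add, Algebra.TensorProduct.tmul_mul_tmul, h, hg, one_mul, mul_one,
    smul_add, TensorProduct.smul_tmul', TensorProduct.tmul_smul]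

theorem skew_pow {m : ℕ} {q : k} (hq : q ∈ primitiveRoots m k) {x g : A}
    (h : x * g = q • (g * x)) (hx : x ^ m = 0) : (x ⊗ₜ[k] g + 1 ⊗ₜ x) ^ m = 0 := by
  rw [add_pow_of_primitive hq]
  · rw [Algebra.TensorProduct.tmul_pow, Algebra.TensorProduct.tmul_pow, hx, TensorProduct.zero_tmul,
      TensorProduct.tmul_zero, add_zero]
  · simp only [Algebra.TensorProduct.tmul_mul_tmul, h, one_mul, mul_one, TensorProduct.tmul_smul]

theorem skew_mul_skew {c a : k} {x g X G : A} (h1 : x * G = c • (G * x))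
    (h2 : g * X = c • (X * g)) (hg : g * G = G * g)
    (h3 : x * X = c • (X * x) + a • (1 - G * g)) :
    (x ⊗ₜ[k] g + 1 ⊗ₜ x) * (X ⊗ₜ G + 1 ⊗ₜ X) =
      c • ((X ⊗ₜ G + 1 ⊗ₜ X) * (x ⊗ₜ g + 1 ⊗ₜ x)) + a • (1 - (G ⊗ₜ G) * (g ⊗ₜ g)) := by
  simp only [add_mul, mul_add, Algebra.TensorProduct.tmul_mul_tmul, h1, h2, h3, hg, one_mul,
    mul_one, smul_add, TensorProduct.smul_tmul', TensorProduct.tmul_smul, TensorProduct.add_tmul,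
    TensorProduct.tmul_add, smul_sub, TensorProduct.sub_tmul, TensorProduct.tmul_sub,
    Algebra.TensorProduct.one_def]
  abel

theorem groupLike_inv {g : A} {m : ℕ} (hm : 0 < m) (h : g ^ m = 1) :
    g * g ^ (m - 1) = 1 ∧ g ^ (m - 1) * g = 1 := by
  rw [← pow_succ', ← pow_succ, Nat.sub_add_cancel hm]
  exact ⟨h, h⟩

theorem inv_mul_skew {c : k} {x G G' : A} (h1 : G * G' = 1) (h2 : G' * G = 1)
    (h : x * G = c • (G * x)) : G' * x = c • (x * G') := by
  calc G' * x = G' * (x * G) * G' := by rw [mul_assoc, mul_assoc, h1, mul_one]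
    _ = c • (x * G') := by rw [h, mul_smul_comm, smul_mul_assoc, ← mul_assoc G', h2, one_mul]

theorem skew_mul_inv {c : k} {x G G' : A} (h1 : G * G' = 1) (h2 : G' * G = 1)
    (h : G * x = c • (x * G)) : x * G' = c • (G' * x) := by
  calc x * G' = G' * (G * x) * G' := by rw [← mul_assoc, h2, one_mul]
    _ = c • (G' * x) := by
      rw [h, mul_smul_comm, smul_mul_assoc, mul_assoc, mul_assoc, h1, mul_one]

end TensorRelations

section Taft

variable {k : Type u} [Field k] {m : ℕ} {q : k}

/-- Names of the generators `h`, `x` of the Taft algebra. -/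
inductive TaftGen : Type
  | h | x

open FreeAlgebra in
/-- The defining relations `h ^ m = 1`, `x ^ m = 0`, `x h = q h x` of the Taft algebra. -/
inductive TaftRel (m : ℕ) (q : k) : FreeAlgebra k TaftGen → FreeAlgebra k TaftGen → Prop
  | h_pow : TaftRel m q (ι k .h ^ m) 1
  | x_pow : TaftRel m q (ι k .x ^ m) 0
  | x_h : TaftRel m q (ι k .x * ι k .h) (q • (ι k .h * ι k .x))

/-- The Taft algebra `T_{m²}(q)`, for a primitive `m`-th root of unity `q`: the algebra generated by
`h` and `x` subject to `h ^ m = 1`, `x ^ m = 0` and `x h = q h x`. -/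
def TaftAlgebra (_hq : q ∈ primitiveRoots m k) : Type u := RingQuot (TaftRel m q)

namespace TaftAlgebra

variable (hq : q ∈ primitiveRoots m k)

instance : Ring (TaftAlgebra hq) := inferInstanceAs (Ring (RingQuot _))

instance : Algebra k (TaftAlgebra hq) := inferInstanceAs (Algebra k (RingQuot _))

/-- The canonical projection from the free algebra. -/
def mk : FreeAlgebra k TaftGen →ₐ[k] TaftAlgebra hq := RingQuot.mkAlgHom k (TaftRel m q)

/-- The generator `h`. -/
def h : TaftAlgebra hq := mk hq (FreeAlgebra.ι k .h)

/-- The generator `x`. -/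
def x : TaftAlgebra hq := mk hq (FreeAlgebra.ι k .x)

theorem mk_rel {a b : FreeAlgebra k TaftGen} (hab : TaftRel m q a b) : mk hq a = mk hq b :=
  RingQuot.mkAlgHom_rel k hab

theorem h_pow : h hq ^ m = 1 := by
  simpa [h, x] using mk_rel hq .h_pow

theorem x_pow : x hq ^ m = 0 := by
  simpa [h, x] using mk_rel hq .x_pow

theorem x_mul_h : x hq * h hq = q • (h hq * x hq) := by
  simpa [h, x] using mk_rel hq .x_h

variable {A : Type*} [Ring A] [Algebra k A]

/-- The images of the generators prescribed by `a` and `b`. -/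
def genMap (a b : A) : TaftGen → A
  | .h => a
  | .x => b

/-- The universal property of the Taft algebra. -/
def lift (a b : A) (h1 : a ^ m = 1) (h2 : b ^ m = 0) (h3 : b * a = q • (a * b)) :
    TaftAlgebra hq →ₐ[k] A :=
  RingQuot.liftAlgHom k ⟨FreeAlgebra.lift k (genMap a b), by
    intro y z hyz
    cases hyz <;> simp [genMap, h1, h2, h3]⟩

@[simp]
theorem lift_h (a b : A) (h1 : a ^ m = 1) (h2 : b ^ m = 0) (h3 : b * a = q • (a * b)) :
    lift hq a b h1 h2 h3 (h hq) = a :=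
  (RingQuot.liftAlgHom_mkAlgHom_apply ..).trans (by simp [genMap])

@[simp]
theorem lift_x (a b : A) (h1 : a ^ m = 1) (h2 : b ^ m = 0) (h3 : b * a = q • (a * b)) :
    lift hq a b h1 h2 h3 (x hq) = b :=
  (RingQuot.liftAlgHom_mkAlgHom_apply ..).trans (by simp [genMap])

variable {hq} in
theorem algHom_ext {f g : TaftAlgebra hq →ₐ[k] A} (h1 : f (h hq) = g (h hq))
    (h2 : f (x hq) = g (x hq)) : f = g := by
  refine RingQuot.ringQuot_ext' (S := k) f g (FreeAlgebra.hom_ext ?_)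
  funext i
  cases i
  · exact h1
  · exact h2

theorem adjoin_eq_top : Algebra.adjoin k {h hq, x hq} = ⊤ := by
  have h0 := congrArg (Subalgebra.map (mk hq)) (FreeAlgebra.adjoin_range_ι k TaftGen)
  rw [AlgHom.map_adjoin, Algebra.map_top,
    (AlgHom.range_eq_top (mk hq)).2 (RingQuot.mkAlgHom_surjective k (TaftRel m q))] at h0
  rw [eq_top_iff, ← h0]
  refine Algebra.adjoin_mono ?_
  rintro _ ⟨_, ⟨i, rfl⟩, rfl⟩
  cases i
  · exact Or.inl rfl
  · exact Or.inr rfl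

/-- `h` is group-like and `x` is `(h, 1)`-primitive. -/
def comulHom : TaftAlgebra hq →ₐ[k] TaftAlgebra hq ⊗[k] TaftAlgebra hq :=
  lift hq (h hq ⊗ₜ h hq) (x hq ⊗ₜ h hq + 1 ⊗ₜ x hq) (groupLike_pow_tmul (h_pow hq))
    (skew_pow hq (x_mul_h hq) (x_pow hq)) (skew_mul_groupLike (x_mul_h hq) rfl)

/-- The counit: `ε(h) = 1` and `ε(x) = 0`. -/
def counitHom : TaftAlgebra hq →ₐ[k] k :=
  lift hq 1 0 (one_pow m) (zero_pow (pos_of_mem_primitiveRoots hq).ne') (by simp)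

/-- The antipode, as an anti-homomorphism: `S(h) = h⁻¹` and `S(x) = - x h⁻¹`. -/
def antipodeHom : TaftAlgebra hq →ₐ[k] (TaftAlgebra hq)ᵐᵒᵖ :=
  have hi := groupLike_inv (pos_of_mem_primitiveRoots hq) (h_pow hq)
  lift hq (.op (h hq ^ (m - 1))) (.op (-(x hq * h hq ^ (m - 1))))
    (by rw [← MulOpposite.op_pow, ← pow_mul, mul_comm, pow_mul, h_pow, one_pow,
      MulOpposite.op_one])
    (by rw [← MulOpposite.op_pow, neg_pow, mul_pow_eq_zero_of_qcomm
      (inv_mul_skew hi.1 hi.2 (x_mul_h hq)) (x_pow hq), mul_zero, MulOpposite.op_zero])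
    (by rw [← MulOpposite.op_mul, ← MulOpposite.op_mul, ← MulOpposite.op_smul, mul_neg, neg_mul,
      ← mul_assoc, inv_mul_skew hi.1 hi.2 (x_mul_h hq), smul_neg, smul_mul_assoc])

theorem antipodeHom_h : antipodeHom hq (h hq) = .op (h hq ^ (m - 1)) := by simp [antipodeHom]

theorem antipodeHom_x : antipodeHom hq (x hq) = .op (-(x hq * h hq ^ (m - 1))) := by
  simp [antipodeHom]

instance : Bialgebra k (TaftAlgebra hq) :=
  Bialgebra.ofAlgHom (comulHom hq) (counitHom hq)
    (algHom_ext (by simp [comulHom])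
      (by simp [comulHom, TensorProduct.add_tmul, TensorProduct.tmul_add,
        Algebra.TensorProduct.one_def, add_assoc]))
    (algHom_ext (by simp [comulHom, counitHom]) (by simp [comulHom, counitHom]))
    (algHom_ext (by simp [comulHom, counitHom]) (by simp [comulHom, counitHom]))

@[simp]
theorem comul_h : Coalgebra.comul (R := k) (h hq) = h hq ⊗ₜ h hq := lift_h ..

@[simp]
theorem comul_x : Coalgebra.comul (R := k) (x hq) = x hq ⊗ₜ h hq + 1 ⊗ₜ x hq := lift_x ..

@[simp]
theorem counit_h : Coalgebra.counit (R := k) (h hq) = 1 := lift_h ..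

@[simp]
theorem counit_x : Coalgebra.counit (R := k) (x hq) = 0 := lift_x ..

instance : HopfAlgebra k (TaftAlgebra hq) :=
  have hi := groupLike_inv (pos_of_mem_primitiveRoots hq) (h_pow hq)
  hopfAlgebraOfGenerators (antipodeHom hq) {h hq, x hq} (adjoin_eq_top hq)
    (by
      rintro b (rfl | rfl)
      · simp [antipodeHom, hi.2]
      · simp [antipodeHom, mul_assoc, hi.2])
    (by
      rintro b (rfl | rfl)
      · simp [antipodeHom, hi.1]
      · simp [antipodeHom])

theorem antipode_h : HopfAlgebra.antipode k (h hq) = h hq ^ (m - 1) :=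
  congrArg MulOpposite.unop (antipodeHom_h hq)

theorem antipode_x : HopfAlgebra.antipode k (x hq) = -(x hq * h hq ^ (m - 1)) :=
  congrArg MulOpposite.unop (antipodeHom_x hq)

end TaftAlgebra

end Taft

section Pair

variable {k : Type u} [Field k] {m n : ℕ} {q qb : k}

/-- Names of the generators `h`, `x`, `H`, `X` of the Hopf algebras which factor through two Taft
algebras. -/
inductive PairGen : Type
  | h | x | H | X

open FreeAlgebra in
/-- The relations
`h ^ m = H ^ n = 1`, `x ^ m = X ^ n = 0`, `x h = q h x`, `X H = qb H X`, `h H = H h`,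
`x H = σ H x`, `h X = σ X h`, `x X = σ X x + α (1 - H h)`. -/
inductive PairRel (m n : ℕ) (qb q σ α : k) : FreeAlgebra k PairGen → FreeAlgebra k PairGen → Prop
  | h_pow : PairRel m n qb q σ α (ι k .h ^ m) 1
  | x_pow : PairRel m n qb q σ α (ι k .x ^ m) 0
  | H_pow : PairRel m n qb q σ α (ι k .H ^ n) 1
  | X_pow : PairRel m n qb q σ α (ι k .X ^ n) 0
  | x_h : PairRel m n qb q σ α (ι k .x * ι k .h) (q • (ι k .h * ι k .x))
  | X_H : PairRel m n qb q σ α (ι k .X * ι k .H) (qb • (ι k .H * ι k .X))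
  | h_H : PairRel m n qb q σ α (ι k .h * ι k .H) (ι k .H * ι k .h)
  | x_H : PairRel m n qb q σ α (ι k .x * ι k .H) (σ • (ι k .H * ι k .x))
  | h_X : PairRel m n qb q σ α (ι k .h * ι k .X) (σ • (ι k .X * ι k .h))
  | x_X : PairRel m n qb q σ α (ι k .x * ι k .X)
      (σ • (ι k .X * ι k .x) + α • (1 - ι k .H * ι k .h))

/-- The algebra generated by `h`, `x`, `H`, `X` subject to the relations `PairRel`. -/
def PairAlgebra (_hqb : qb ∈ primitiveRoots n k) (_hq : q ∈ primitiveRoots m k) (σ α : k) :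
    Type u :=
  RingQuot (PairRel m n qb q σ α)

namespace PairAlgebra

variable (hqb : qb ∈ primitiveRoots n k) (hq : q ∈ primitiveRoots m k) (σ α : k)

instance : Ring (PairAlgebra hqb hq σ α) := inferInstanceAs (Ring (RingQuot _))

instance : Algebra k (PairAlgebra hqb hq σ α) := inferInstanceAs (Algebra k (RingQuot _))

/-- The canonical projection from the free algebra. -/
def mk : FreeAlgebra k PairGen →ₐ[k] PairAlgebra hqb hq σ α :=
  RingQuot.mkAlgHom k (PairRel m n qb q σ α)

/-- The generators. -/
def gen (i : PairGen) : PairAlgebra hqb hq σ α := mk hqb hq σ α (FreeAlgebra.ι k i)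

theorem mk_rel {a b : FreeAlgebra k PairGen} (hab : PairRel m n qb q σ α a b) :
    mk hqb hq σ α a = mk hqb hq σ α b :=
  RingQuot.mkAlgHom_rel k hab

/-- The defining relations, for elements `h x H X` of an arbitrary algebra. -/
structure IsPair {A : Type*} [Ring A] [Algebra k A] (m n : ℕ) (qb q σ α : k) (h x H X : A) :
    Prop where
  h_pow : h ^ m = 1
  x_pow : x ^ m = 0
  H_pow : H ^ n = 1
  X_pow : X ^ n = 0
  x_h : x * h = q • (h * x)
  X_H : X * H = qb • (H * X)
  h_H : h * H = H * h
  x_H : x * H = σ • (H * x)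
  h_X : h * X = σ • (X * h)
  x_X : x * X = σ • (X * x) + α • (1 - H * h)

theorem isPair : IsPair m n qb q σ α (gen hqb hq σ α .h) (gen hqb hq σ α .x) (gen hqb hq σ α .H)
    (gen hqb hq σ α .X) where
  h_pow := by simpa [gen] using mk_rel hqb hq σ α .h_pow
  x_pow := by simpa [gen] using mk_rel hqb hq σ α .x_pow
  H_pow := by simpa [gen] using mk_rel hqb hq σ α .H_pow
  X_pow := by simpa [gen] using mk_rel hqb hq σ α .X_pow
  x_h := by simpa [gen] using mk_rel hqb hq σ α .x_h
  X_H := by simpa [gen] using mk_rel hqb hq σ α .X_H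
  h_H := by simpa [gen] using mk_rel hqb hq σ α .h_H
  x_H := by simpa [gen] using mk_rel hqb hq σ α .x_H
  h_X := by simpa [gen] using mk_rel hqb hq σ α .h_X
  x_X := by simpa [gen] using mk_rel hqb hq σ α .x_X

variable {A : Type*} [Ring A] [Algebra k A] {σ α}

/-- The images of the generators prescribed by `a b c d`. -/
def genMap (a b c d : A) : PairGen → A
  | .h => a
  | .x => b
  | .H => c
  | .X => d

/-- The universal property of the presentation. -/
def lift {a b c d : A} (hr : IsPair m n qb q σ α a b c d) : PairAlgebra hqb hq σ α →ₐ[k] A :=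
  RingQuot.liftAlgHom k ⟨FreeAlgebra.lift k (genMap a b c d), by
    intro y z hyz
    cases hyz
    case h_pow => simpa [genMap] using hr.h_pow
    case x_pow => simpa [genMap] using hr.x_pow
    case H_pow => simpa [genMap] using hr.H_pow
    case X_pow => simpa [genMap] using hr.X_pow
    case x_h => simpa [genMap] using hr.x_h
    case X_H => simpa [genMap] using hr.X_H
    case h_H => simpa [genMap] using hr.h_H
    case x_H => simpa [genMap] using hr.x_H
    case h_X => simpa [genMap] using hr.h_X
    case x_X => simpa [genMap] using hr.x_X⟩

@[simp]
theorem lift_gen {a b c d : A} (hr : IsPair m n qb q σ α a b c d) (i : PairGen) :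
    lift hqb hq hr (gen hqb hq σ α i) = genMap a b c d i :=
  (RingQuot.liftAlgHom_mkAlgHom_apply ..).trans (by simp)

variable {hqb hq} in
theorem algHom_ext {f g : PairAlgebra hqb hq σ α →ₐ[k] A}
    (hfg : ∀ i, f (gen hqb hq σ α i) = g (gen hqb hq σ α i)) : f = g :=
  RingQuot.ringQuot_ext' (S := k) f g (FreeAlgebra.hom_ext (funext hfg))

variable (σ α)

theorem adjoin_eq_top : Algebra.adjoin k (Set.range (gen hqb hq σ α)) = ⊤ := by
  have h0 := congrArg (Subalgebra.map (mk hqb hq σ α)) (FreeAlgebra.adjoin_range_ι k PairGen)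
  rw [AlgHom.map_adjoin, Algebra.map_top, (AlgHom.range_eq_top (mk hqb hq σ α)).2
    (RingQuot.mkAlgHom_surjective k (PairRel m n qb q σ α)), ← Set.range_comp] at h0
  exact h0

theorem isPair_comul : IsPair m n qb q σ α
    (gen hqb hq σ α .h ⊗ₜ[k] gen hqb hq σ α .h)
    (gen hqb hq σ α .x ⊗ₜ[k] gen hqb hq σ α .h + 1 ⊗ₜ gen hqb hq σ α .x)
    (gen hqb hq σ α .H ⊗ₜ[k] gen hqb hq σ α .H)
    (gen hqb hq σ α .X ⊗ₜ[k] gen hqb hq σ α .H + 1 ⊗ₜ gen hqb hq σ α .X) :=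
  have r := isPair hqb hq σ α
  { h_pow := groupLike_pow_tmul r.h_pow
    x_pow := skew_pow hq r.x_h r.x_pow
    H_pow := groupLike_pow_tmul r.H_pow
    X_pow := skew_pow hqb r.X_H r.X_pow
    x_h := skew_mul_groupLike r.x_h rfl
    X_H := skew_mul_groupLike r.X_H rfl
    h_H := by rw [Algebra.TensorProduct.tmul_mul_tmul, Algebra.TensorProduct.tmul_mul_tmul, r.h_H]
    x_H := skew_mul_groupLike r.x_H r.h_H
    h_X := groupLike_mul_skew r.h_X r.h_H.symm
    x_X := skew_mul_skew r.x_H r.h_X r.h_H r.x_X }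

/-- `h`, `H` are group-like, `x` is `(h, 1)`-primitive and `X` is `(H, 1)`-primitive. -/
def comulHom : PairAlgebra hqb hq σ α →ₐ[k] PairAlgebra hqb hq σ α ⊗[k] PairAlgebra hqb hq σ α :=
  lift hqb hq (isPair_comul hqb hq σ α)

theorem isPair_counit (hm : m ≠ 0) (hn : n ≠ 0) : IsPair m n qb q σ α (1 : k) 0 1 0 where
  h_pow := one_pow m
  x_pow := zero_pow hm
  H_pow := one_pow n
  X_pow := zero_pow hn
  x_h := by simp
  X_H := by simp
  h_H := by simp
  x_H := by simp
  h_X := by simp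
  x_X := by simp

/-- The counit: `ε(h) = ε(H) = 1` and `ε(x) = ε(X) = 0`. -/
def counitHom : PairAlgebra hqb hq σ α →ₐ[k] k :=
  lift hqb hq (isPair_counit σ α (pos_of_mem_primitiveRoots hq).ne'
    (pos_of_mem_primitiveRoots hqb).ne')

theorem isPair_antipode : IsPair m n qb q σ α
    (MulOpposite.op (gen hqb hq σ α .h ^ (m - 1)))
    (MulOpposite.op (-(gen hqb hq σ α .x * gen hqb hq σ α .h ^ (m - 1))))
    (MulOpposite.op (gen hqb hq σ α .H ^ (n - 1)))
    (MulOpposite.op (-(gen hqb hq σ α .X * gen hqb hq σ α .H ^ (n - 1)))) := by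
  have r := isPair hqb hq σ α
  have hm := pos_of_mem_primitiveRoots hq
  have hn := pos_of_mem_primitiveRoots hqb
  have hi := groupLike_inv hm r.h_pow
  have Hi := groupLike_inv hn r.H_pow
  have hp : (gen hqb hq σ α .h ^ (m - 1)) ^ m = 1 := by
    rw [← pow_mul, mul_comm, pow_mul, r.h_pow, one_pow]
  have Hp : (gen hqb hq σ α .H ^ (n - 1)) ^ n = 1 := by
    rw [← pow_mul, mul_comm, pow_mul, r.H_pow, one_pow]
  have c : Commute (gen hqb hq σ α .h) (gen hqb hq σ α .H) := r.h_H
  have c1 := c.pow_left (m - 1)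
  have c2 := (c.pow_right (n - 1)).eq
  have c3 := (c1.pow_right (n - 1)).eq
  generalize gen hqb hq σ α .h ^ (m - 1) = h' at *
  generalize gen hqb hq σ α .H ^ (n - 1) = H' at *
  replace c1 := c1.eq
  generalize gen hqb hq σ α .h = h at *
  generalize gen hqb hq σ α .H = H at *
  generalize gen hqb hq σ α .x = x at *
  generalize gen hqb hq σ α .X = X at *
  have e1 : h' * x = q • (x * h') := inv_mul_skew hi.1 hi.2 r.x_h
  have e2 : H' * X = qb • (X * H') := inv_mul_skew Hi.1 Hi.2 r.X_H
  have e3 : H' * x = σ • (x * H') := inv_mul_skew Hi.1 Hi.2 r.x_H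
  have e4 : X * h' = σ • (h' * X) := skew_mul_inv hi.1 hi.2 r.h_X
  constructor
  · rw [← MulOpposite.op_pow, hp, MulOpposite.op_one]
  · rw [← MulOpposite.op_pow, neg_pow, mul_pow_eq_zero_of_qcomm e1 r.x_pow, mul_zero,
      MulOpposite.op_zero]
  · rw [← MulOpposite.op_pow, Hp, MulOpposite.op_one]
  · rw [← MulOpposite.op_pow, neg_pow, mul_pow_eq_zero_of_qcomm e2 r.X_pow, mul_zero,
      MulOpposite.op_zero]
  · rw [← MulOpposite.op_mul, ← MulOpposite.op_mul, ← MulOpposite.op_smul, mul_neg, neg_mul,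
      ← mul_assoc, e1, smul_neg, smul_mul_assoc]
  · rw [← MulOpposite.op_mul, ← MulOpposite.op_mul, ← MulOpposite.op_smul, mul_neg, neg_mul,
      ← mul_assoc, e2, smul_neg, smul_mul_assoc]
  · rw [← MulOpposite.op_mul, ← MulOpposite.op_mul, c3]
  · rw [← MulOpposite.op_mul, ← MulOpposite.op_mul, ← MulOpposite.op_smul, mul_neg, neg_mul,
      ← mul_assoc, e3, smul_neg, smul_mul_assoc, mul_assoc, mul_assoc, c3]
  · rw [← MulOpposite.op_mul, ← MulOpposite.op_mul, ← MulOpposite.op_smul, mul_neg, neg_mul,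
      mul_assoc, ← c3, ← mul_assoc, e4, smul_mul_assoc, smul_neg, mul_assoc]
  · rw [← MulOpposite.op_mul, ← MulOpposite.op_mul, ← MulOpposite.op_mul, ← MulOpposite.op_one,
      ← MulOpposite.op_sub, ← MulOpposite.op_smul, ← MulOpposite.op_smul, ← MulOpposite.op_add]
    congr 1
    rw [neg_mul_neg, neg_mul_neg]
    have f1 : X * H' * (x * h') = σ • (X * x * (h' * H')) := by
      rw [mul_assoc, ← mul_assoc H', e3, smul_mul_assoc, mul_smul_comm, c3]
      simp only [mul_assoc]
    have f2 : σ • (x * h' * (X * H')) = x * X * (h' * H') := by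
      calc σ • (x * h' * (X * H')) = x * (σ • (h' * X)) * H' := by
            simp only [mul_assoc, mul_smul_comm, smul_mul_assoc]
        _ = _ := by rw [← e4]; simp only [mul_assoc]
    have f3 : (1 - H * h) * (h' * H') = h' * H' - 1 := by
      rw [sub_mul, one_mul, mul_assoc, ← mul_assoc h, hi.1, one_mul, Hi.1]
    rw [f1, f2, r.x_X, add_mul, smul_mul_assoc, smul_mul_assoc, f3, add_assoc, ← smul_add]
    simp

/-- The antipode, as an anti-homomorphism: `S(h) = h⁻¹`, `S(x) = - x h⁻¹`, `S(H) = H⁻¹`,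
`S(X) = - X H⁻¹`. -/
def antipodeHom : PairAlgebra hqb hq σ α →ₐ[k] (PairAlgebra hqb hq σ α)ᵐᵒᵖ :=
  lift hqb hq (isPair_antipode hqb hq σ α)

instance : Bialgebra k (PairAlgebra hqb hq σ α) :=
  Bialgebra.ofAlgHom (comulHom hqb hq σ α) (counitHom hqb hq σ α)
    (algHom_ext (by
      rintro (_ | _ | _ | _) <;> simp [comulHom, genMap, TensorProduct.add_tmul,
        TensorProduct.tmul_add, Algebra.TensorProduct.one_def, add_assoc]))
    (algHom_ext (by rintro (_ | _ | _ | _) <;> simp [comulHom, counitHom, genMap]))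
    (algHom_ext (by rintro (_ | _ | _ | _) <;> simp [comulHom, counitHom, genMap]))

@[simp]
theorem comul_h : Coalgebra.comul (R := k) (gen hqb hq σ α .h) =
    gen hqb hq σ α .h ⊗ₜ gen hqb hq σ α .h :=
  lift_gen hqb hq (isPair_comul hqb hq σ α) .h

@[simp]
theorem comul_x : Coalgebra.comul (R := k) (gen hqb hq σ α .x) =
    gen hqb hq σ α .x ⊗ₜ gen hqb hq σ α .h + 1 ⊗ₜ gen hqb hq σ α .x :=
  lift_gen hqb hq (isPair_comul hqb hq σ α) .x

@[simp]
theorem comul_H : Coalgebra.comul (R := k) (gen hqb hq σ α .H) =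
    gen hqb hq σ α .H ⊗ₜ gen hqb hq σ α .H :=
  lift_gen hqb hq (isPair_comul hqb hq σ α) .H

@[simp]
theorem comul_X : Coalgebra.comul (R := k) (gen hqb hq σ α .X) =
    gen hqb hq σ α .X ⊗ₜ gen hqb hq σ α .H + 1 ⊗ₜ gen hqb hq σ α .X :=
  lift_gen hqb hq (isPair_comul hqb hq σ α) .X

@[simp]
theorem counit_h : Coalgebra.counit (R := k) (gen hqb hq σ α .h) = 1 :=
  lift_gen hqb hq (isPair_counit σ α (pos_of_mem_primitiveRoots hq).ne'
    (pos_of_mem_primitiveRoots hqb).ne') .h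

@[simp]
theorem counit_x : Coalgebra.counit (R := k) (gen hqb hq σ α .x) = 0 :=
  lift_gen hqb hq (isPair_counit σ α (pos_of_mem_primitiveRoots hq).ne'
    (pos_of_mem_primitiveRoots hqb).ne') .x

@[simp]
theorem counit_H : Coalgebra.counit (R := k) (gen hqb hq σ α .H) = 1 :=
  lift_gen hqb hq (isPair_counit σ α (pos_of_mem_primitiveRoots hq).ne'
    (pos_of_mem_primitiveRoots hqb).ne') .H

@[simp]
theorem counit_X : Coalgebra.counit (R := k) (gen hqb hq σ α .X) = 0 :=
  lift_gen hqb hq (isPair_counit σ α (pos_of_mem_primitiveRoots hq).ne'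
    (pos_of_mem_primitiveRoots hqb).ne') .X

instance : HopfAlgebra k (PairAlgebra hqb hq σ α) :=
  have r := isPair hqb hq σ α
  have hi := groupLike_inv (pos_of_mem_primitiveRoots hq) r.h_pow
  have Hi := groupLike_inv (pos_of_mem_primitiveRoots hqb) r.H_pow
  hopfAlgebraOfGenerators (antipodeHom hqb hq σ α) _ (adjoin_eq_top hqb hq σ α)
    (by
      rintro _ ⟨_ | _ | _ | _, rfl⟩
      · simp [antipodeHom, genMap, hi.2]
      · simp [antipodeHom, genMap, mul_assoc, hi.2]
      · simp [antipodeHom, genMap, Hi.2]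
      · simp [antipodeHom, genMap, mul_assoc, Hi.2])
    (by
      rintro _ ⟨_ | _ | _ | _, rfl⟩
      · simp [antipodeHom, genMap, hi.1]
      · simp [antipodeHom, genMap]
      · simp [antipodeHom, genMap, Hi.1]
      · simp [antipodeHom, genMap])

end PairAlgebra

/-- The Hopf algebra `T_{n,m}^σ(qb, q)`, generated by `h`, `x`, `H`, `X` subject to
`h ^ m = H ^ n = 1`, `x ^ m = X ^ n = 0`, `x h = q h x`, `X H = qb H X`, `x H = σ H x`,
`h X = σ X h`, `x X = σ X x`, `h H = H h`, where `h`, `H` are group-like, `x` is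
`(h, 1)`-primitive and `X` is `(H, 1)`-primitive. -/
abbrev TBicrossed (hqb : qb ∈ primitiveRoots n k) (hq : q ∈ primitiveRoots m k) (σ : k) : Type u :=
  PairAlgebra hqb hq σ 0

/-- The Hopf algebra `Q_n^α(q)`, generated by `h`, `x`, `H`, `X` subject to
`h ^ n = H ^ n = 1`, `x ^ n = X ^ n = 0`, `x h = q h x`, `X H = q ^ (n - 1) H X`, `x H = q H x`,
`h X = q X h`, `x X - q X x = α (1 - H h)`, `h H = H h`, where `h`, `H` are group-like, `x` is
`(h, 1)`-primitive and `X` is `(H, 1)`-primitive. -/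
abbrev QBicrossed (hq : q ∈ primitiveRoots n k) (α : k) : Type u :=
  PairAlgebra (pow_pred_mem_primitiveRoots hq) hq q α

end Pair

/-- The antipode is bijective. Every finite dimensional Hopf algebra over a field has this
property. -/
class HasBijectiveAntipode (k : Type*) (A : Type*) [CommRing k] [Ring A] [HopfAlgebra k A] :
    Prop where
  bijective : Function.Bijective (HopfAlgebra.antipode k (A := A))

namespace TaftAlgebra

variable {k : Type u} [Field k] {m : ℕ} {q : k} (hq : q ∈ primitiveRoots m k)

theorem span_eq_top :
    Submodule.span k (Set.range fun p : ℕ × ℕ => h hq ^ p.1 * x hq ^ p.2) = ⊤ := by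
  set W := Submodule.span k (Set.range fun p : ℕ × ℕ => h hq ^ p.1 * x hq ^ p.2) with hW
  have hh : ∀ w ∈ W, h hq * w ∈ W := by
    intro w hw
    induction hw using Submodule.span_induction with
    | mem w hw =>
      obtain ⟨p, rfl⟩ := hw
      exact Submodule.subset_span ⟨(p.1 + 1, p.2), by simp only [pow_succ', mul_assoc]⟩
    | zero => simp
    | add a b _ _ ha hb => rw [mul_add]; exact W.add_mem ha hb
    | smul c a _ ha => rw [mul_smul_comm]; exact W.smul_mem c ha
  have hx : ∀ w ∈ W, x hq * w ∈ W := by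
    intro w hw
    induction hw using Submodule.span_induction with
    | mem w hw =>
      obtain ⟨p, rfl⟩ := hw
      have e : x hq * (h hq ^ p.1 * x hq ^ p.2) = q ^ p.1 • (h hq ^ p.1 * x hq ^ (p.2 + 1)) := by
        rw [← mul_assoc, mul_pow_of_qcomm (x_mul_h hq), smul_mul_assoc, mul_assoc, ← pow_succ']
      change x hq * (h hq ^ p.1 * x hq ^ p.2) ∈ W
      rw [e]
      exact W.smul_mem _ (Submodule.subset_span ⟨(p.1, p.2 + 1), rfl⟩)
    | zero => simp
    | add a b _ _ ha hb => rw [mul_add]; exact W.add_mem ha hb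
    | smul c a _ ha => rw [mul_smul_comm]; exact W.smul_mem c ha
  have h1 : (1 : TaftAlgebra hq) ∈ W := Submodule.subset_span ⟨(0, 0), by simp⟩
  rw [eq_top_iff]
  intro a _
  have ha : a ∈ Algebra.adjoin k {h hq, x hq} := adjoin_eq_top hq ▸ Algebra.mem_top
  have key : ∀ w ∈ W, a * w ∈ W := by
    induction ha using Algebra.adjoin_induction with
    | mem y hy =>
      rcases hy with rfl | rfl
      · exact hh
      · exact hx
    | algebraMap r =>
      intro w hw
      rw [← Algebra.smul_def]
      exact W.smul_mem r hw
    | add y z _ _ hy hz =>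
      intro w hw
      rw [add_mul]
      exact W.add_mem (hy trivial w hw) (hz trivial w hw)
    | mul y z _ _ hy hz =>
      intro w hw
      rw [mul_assoc]
      exact hy trivial _ (hz trivial w hw)
  simpa using key 1 h1

instance : Module.Finite k (TaftAlgebra hq) := by
  classical
  refine ⟨⟨(Finset.range m ×ˢ Finset.range m).image
    (fun p : ℕ × ℕ => h hq ^ p.1 * x hq ^ p.2), ?_⟩⟩
  rw [eq_top_iff, ← span_eq_top hq, Submodule.span_le]
  rintro _ ⟨p, rfl⟩
  change h hq ^ p.1 * x hq ^ p.2 ∈ _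
  have hm := pos_of_mem_primitiveRoots hq
  by_cases hp : p.2 < m
  · have e : h hq ^ p.1 = h hq ^ (p.1 % m) := by
      conv_lhs => rw [← Nat.mod_add_div p.1 m, pow_add, pow_mul, h_pow, one_pow, mul_one]
    rw [e]
    refine Submodule.subset_span ?_
    simp only [Finset.coe_image, Set.mem_image, Finset.mem_coe, Finset.mem_product,
      Finset.mem_range]
    exact ⟨(p.1 % m, p.2), ⟨Nat.mod_lt _ hm, hp⟩, rfl⟩
  · rw [← Nat.sub_add_cancel (not_lt.1 hp), pow_add (x hq), x_pow, mul_zero, mul_zero]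
    exact Submodule.zero_mem _

/-- The inverse of the antipode, as an anti-homomorphism. -/
def antipodeInvHom : TaftAlgebra hq →ₐ[k] (TaftAlgebra hq)ᵐᵒᵖ :=
  have hi := groupLike_inv (pos_of_mem_primitiveRoots hq) (h_pow hq)
  have e := inv_mul_skew hi.1 hi.2 (x_mul_h hq)
  lift hq (.op (h hq ^ (m - 1))) (.op (-(h hq ^ (m - 1) * x hq)))
    (by rw [← MulOpposite.op_pow, ← pow_mul, mul_comm, pow_mul, h_pow, one_pow,
      MulOpposite.op_one])
    (by rw [← MulOpposite.op_pow, e, ← smul_neg, smul_pow, neg_pow,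
      mul_pow_eq_zero_of_qcomm e (x_pow hq), mul_zero, smul_zero, MulOpposite.op_zero])
    (by rw [← MulOpposite.op_mul, ← MulOpposite.op_mul, ← MulOpposite.op_smul, mul_neg, neg_mul,
      mul_assoc, smul_neg, ← mul_smul_comm, ← e])

theorem antipodeInvHom_h : antipodeInvHom hq (h hq) = .op (h hq ^ (m - 1)) := by
  simp [antipodeInvHom]

theorem antipodeInvHom_x : antipodeInvHom hq (x hq) = .op (-(h hq ^ (m - 1) * x hq)) := by
  simp [antipodeInvHom]

theorem antipode_antipodeInv (a : TaftAlgebra hq) :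
    HopfAlgebra.antipode k (antipodeInvHom hq a).unop = a := by
  have hi := groupLike_inv (pos_of_mem_primitiveRoots hq) (h_pow hq)
  have hh : HopfAlgebra.antipode k (h hq ^ (m - 1)) = h hq := by
    have e : HopfAlgebra.antipode k (h hq ^ (m - 1)) * h hq ^ (m - 1) = 1 := by
      rw [← antipode_h, ← HopfAlgebra.antipode_mul_antidistrib, antipode_h, hi.1,
        HopfAlgebra.antipode_one]
    calc HopfAlgebra.antipode k (h hq ^ (m - 1))
        = HopfAlgebra.antipode k (h hq ^ (m - 1)) * h hq ^ (m - 1) * h hq := by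
          rw [mul_assoc, hi.2, mul_one]
      _ = h hq := by rw [e, one_mul]
  have ha : a ∈ Algebra.adjoin k {h hq, x hq} := adjoin_eq_top hq ▸ Algebra.mem_top
  induction ha using Algebra.adjoin_induction with
  | mem y hy =>
    rcases hy with rfl | rfl
    · rw [antipodeInvHom_h, MulOpposite.unop_op, hh]
    · rw [antipodeInvHom_x, MulOpposite.unop_op, map_neg, HopfAlgebra.antipode_mul_antidistrib, hh,
        antipode_x, neg_mul, neg_neg, mul_assoc, hi.2, mul_one]
  | algebraMap r =>
    rw [AlgHom.commutes, MulOpposite.algebraMap_apply, MulOpposite.unop_op,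
      Algebra.algebraMap_eq_smul_one, map_smul, HopfAlgebra.antipode_one]
  | add y z _ _ hy hz => rw [map_add, MulOpposite.unop_add, map_add, hy, hz]
  | mul y z _ _ hy hz =>
    rw [map_mul, MulOpposite.unop_mul, HopfAlgebra.antipode_mul_antidistrib, hy, hz]

instance : HasBijectiveAntipode k (TaftAlgebra hq) where
  bijective := by
    have hs : Function.Surjective (HopfAlgebra.antipode k (A := TaftAlgebra hq)) :=
      fun a => ⟨_, antipode_antipodeInv hq a⟩
    exact ⟨LinearMap.injective_iff_surjective.2 hs, hs⟩

end TaftAlgebra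

section DualCop

open Coalgebra

variable (k : Type*) (A : Type*) [Field k] [Ring A]

/-- The dual `(A^*)^cop` of a finite dimensional bialgebra `A`: its product is the convolution
product `⟨f g, a⟩ = ⟨f, a₍₁₎⟩ ⟨g, a₍₂₎⟩`, its coproduct is opposite to the transpose of the product
of `A`. -/
def DualCop [Bialgebra k A] : Type _ := WithConv (A →ₗ[k] k)

namespace DualCop

variable [Bialgebra k A]

instance : Ring (DualCop k A) := inferInstanceAs (Ring (WithConv (A →ₗ[k] k)))

instance : Algebra k (DualCop k A) := inferInstanceAs (Algebra k (WithConv (A →ₗ[k] k)))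

/-- The elements of `(A^*)^cop` are the linear forms on `A`. -/
def toDual : DualCop k A ≃ₗ[k] Module.Dual k A := WithConv.linearEquiv k (A →ₗ[k] k)

variable {k A}

instance : CoeFun (DualCop k A) (fun _ => A → k) where
  coe f := toDual k A f

@[ext]
theorem ext {f g : DualCop k A} (h : ∀ a, f a = g a) : f = g :=
  (toDual k A).injective (LinearMap.ext h)

@[simp]
theorem symm_apply (φ : Module.Dual k A) (a : A) : ((toDual k A).symm φ) a = φ a := rfl

theorem mul_apply (f g : DualCop k A) {a : A} {ι : Type*} (r : Repr k a ι) :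
    (f * g) a = ∑ i ∈ r.index, f (r.left i) * g (r.right i) :=
  Coalgebra.Repr.convMul_apply r f g

@[simp]
theorem one_apply (a : A) : (1 : DualCop k A) a = counit (R := k) a := rfl

variable [Module.Finite k A]

variable (k A) in
/-- The pairing of `A^* ⊗ A^*` with `A ⊗ A`, `⟨f ⊗ g, a ⊗ b⟩ = ⟨f, a⟩ ⟨g, b⟩`, is perfect. -/
def pairing : DualCop k A ⊗[k] DualCop k A ≃ₗ[k] Module.Dual k (A ⊗[k] A) :=
  (TensorProduct.congr (toDual k A) (toDual k A)).trans (TensorProduct.dualDistribEquiv k A A)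

@[simp]
theorem pairing_tmul (f g : DualCop k A) (a b : A) :
    pairing k A (f ⊗ₜ g) (a ⊗ₜ b) = f a * g b := rfl

variable (k A) in
/-- The coproduct of `(A^*)^cop`, characterized by `⟨Δ f, a ⊗ b⟩ = ⟨f, b a⟩`. -/
def comulMap : DualCop k A →ₗ[k] DualCop k A ⊗[k] DualCop k A :=
  (pairing k A).symm.toLinearMap ∘ₗ
    (LinearMap.mul' k A ∘ₗ (TensorProduct.comm k A A).toLinearMap).dualMap ∘ₗ
      (toDual k A).toLinearMap

@[simp]
theorem pairing_comulMap (f : DualCop k A) (a b : A) :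
    pairing k A (comulMap k A f) (a ⊗ₜ b) = f (b * a) := by
  simp [comulMap]

variable (k A) in
/-- The counit of `(A^*)^cop` is the evaluation at `1`. -/
def counitMap : DualCop k A →ₗ[k] k where
  toFun f := f 1
  map_add' f g := by simp
  map_smul' c f := by simp

theorem pairing_ext {s t : DualCop k A ⊗[k] DualCop k A}
    (h : ∀ a b, pairing k A s (a ⊗ₜ b) = pairing k A t (a ⊗ₜ b)) : s = t :=
  (pairing k A).injective (TensorProduct.ext' h)

variable (k A) in
/-- The pairing of triple tensor products. -/
def pairing₃ : DualCop k A ⊗[k] (DualCop k A ⊗[k] DualCop k A) ≃ₗ[k]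
    Module.Dual k (A ⊗[k] (A ⊗[k] A)) :=
  (TensorProduct.congr (toDual k A) (pairing k A)).trans
    (TensorProduct.dualDistribEquiv k A (A ⊗[k] A))

theorem pairing₃_tmul (f : DualCop k A) (t : DualCop k A ⊗[k] DualCop k A) (a : A)
    (b : A ⊗[k] A) : pairing₃ k A (f ⊗ₜ t) (a ⊗ₜ b) = f a * pairing k A t b := rfl

theorem pairing₃_lTensor (t : DualCop k A ⊗[k] DualCop k A) (a b c : A) :
    pairing₃ k A ((comulMap k A).lTensor _ t) (a ⊗ₜ (b ⊗ₜ c)) =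
      pairing k A t (a ⊗ₜ (c * b)) := by
  induction t with
  | zero => simp
  | tmul f g => simp [pairing₃_tmul]
  | add s t hs ht => simp only [map_add, LinearMap.add_apply, hs, ht]

theorem pairing₃_assoc (t : DualCop k A ⊗[k] DualCop k A) (f : DualCop k A) (a b c : A) :
    pairing₃ k A (TensorProduct.assoc k _ _ _ (t ⊗ₜ f)) (a ⊗ₜ (b ⊗ₜ c)) =
      pairing k A t (a ⊗ₜ b) * f c := by
  induction t with
  | zero => simp
  | tmul f g => simp [pairing₃_tmul, mul_assoc]
  | add s t hs ht => simp only [TensorProduct.add_tmul, map_add, LinearMap.add_apply, hs, ht,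
      add_mul]

theorem pairing₃_rTensor (t : DualCop k A ⊗[k] DualCop k A) (a b c : A) :
    pairing₃ k A (TensorProduct.assoc k _ _ _ ((comulMap k A).rTensor _ t)) (a ⊗ₜ (b ⊗ₜ c)) =
      pairing k A t ((b * a) ⊗ₜ c) := by
  induction t with
  | zero => simp
  | tmul f g => simp [pairing₃_assoc]
  | add s t hs ht => simp only [map_add, LinearMap.add_apply, hs, ht]

theorem rTensor_counitMap (t : DualCop k A ⊗[k] DualCop k A) :
    ∃ f : DualCop k A, (counitMap k A).rTensor _ t = 1 ⊗ₜ f ∧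
      ∀ a, f a = pairing k A t (1 ⊗ₜ a) := by
  induction t with
  | zero => exact ⟨0, by simp, by simp⟩
  | tmul f g =>
    refine ⟨f 1 • g, ?_, by simp⟩
    rw [LinearMap.rTensor_tmul, TensorProduct.tmul_smul, TensorProduct.smul_tmul', smul_eq_mul,
      mul_one]
    rfl
  | add s t hs ht =>
    obtain ⟨f, hf, hf'⟩ := hs
    obtain ⟨g, hg, hg'⟩ := ht
    exact ⟨f + g, by rw [map_add, hf, hg, TensorProduct.tmul_add], by simp [hf', hg']⟩

theorem lTensor_counitMap (t : DualCop k A ⊗[k] DualCop k A) :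
    ∃ f : DualCop k A, (counitMap k A).lTensor _ t = f ⊗ₜ 1 ∧
      ∀ a, f a = pairing k A t (a ⊗ₜ 1) := by
  induction t with
  | zero => exact ⟨0, by simp, by simp⟩
  | tmul f g =>
    refine ⟨g 1 • f, ?_, by simp [mul_comm]⟩
    rw [LinearMap.lTensor_tmul, TensorProduct.smul_tmul, smul_eq_mul, mul_one]
    rfl
  | add s t hs ht =>
    obtain ⟨f, hf, hf'⟩ := hs
    obtain ⟨g, hg, hg'⟩ := ht
    exact ⟨f + g, by rw [map_add, hf, hg, TensorProduct.add_tmul], by simp [hf', hg']⟩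

instance : Coalgebra k (DualCop k A) where
  comul := comulMap k A
  counit := counitMap k A
  coassoc := by
    refine LinearMap.ext fun f => (pairing₃ k A).injective ?_
    refine TensorProduct.ext_threefold' ?_
    intro a b c
    simp only [LinearMap.comp_apply, LinearEquiv.coe_coe, pairing₃_rTensor, pairing₃_lTensor,
      pairing_comulMap, mul_assoc]
  rTensor_counit_comp_comul := by
    refine LinearMap.ext fun f => ?_
    obtain ⟨g, hg, hg'⟩ := rTensor_counitMap (comulMap k A f)
    have : g = f := by ext a; simp [hg']
    rw [LinearMap.comp_apply, hg, this]
    rfl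
  lTensor_counit_comp_comul := by
    refine LinearMap.ext fun f => ?_
    obtain ⟨g, hg, hg'⟩ := lTensor_counitMap (comulMap k A f)
    have : g = f := by ext a; simp [hg']
    rw [LinearMap.comp_apply, hg, this]
    rfl

theorem pairing_comul (f : DualCop k A) (a b : A) :
    pairing k A (comul f) (a ⊗ₜ b) = f (b * a) := pairing_comulMap f a b

theorem counit_apply (f : DualCop k A) : counit (R := k) f = f 1 := rfl

theorem pairing_mul (s t : DualCop k A ⊗[k] DualCop k A) {a b : A} {ι κ : Type*}
    (r : Repr k a ι) (r' : Repr k b κ) :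
    pairing k A (s * t) (a ⊗ₜ b) = ∑ i ∈ r.index, ∑ j ∈ r'.index,
      pairing k A s (r.left i ⊗ₜ r'.left j) * pairing k A t (r.right i ⊗ₜ r'.right j) := by
  induction s with
  | zero => simp
  | add s s' hs hs' => simp only [add_mul, map_add, LinearMap.add_apply, hs, hs',
      Finset.sum_add_distrib]
  | tmul f g =>
    induction t with
    | zero => simp
    | add t t' ht ht' => simp only [mul_add, map_add, LinearMap.add_apply, ht, ht',
        Finset.sum_add_distrib]
    | tmul f' g' =>
      rw [Algebra.TensorProduct.tmul_mul_tmul, pairing_tmul, mul_apply f f' r, mul_apply g g' r',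
        Finset.sum_mul_sum]
      refine Finset.sum_congr rfl fun i _ => Finset.sum_congr rfl fun j _ => ?_
      rw [pairing_tmul, pairing_tmul]
      ring

instance : Bialgebra k (DualCop k A) :=
  Bialgebra.mk' k (DualCop k A)
    (by rw [counit_apply]; simp)
    (by
      intro f g
      rw [counit_apply, counit_apply, counit_apply, mul_apply f g
        (⟨{()}, fun _ => 1, fun _ => 1, by simp [Algebra.TensorProduct.one_def]⟩ :
          Repr k (1 : A) Unit)]
      simp)
    (by
      refine pairing_ext fun a b => ?_
      rw [pairing_comul, Algebra.TensorProduct.one_def]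
      simp [mul_comm])
    (by
      intro f g
      refine pairing_ext fun a b => ?_
      rw [pairing_comul, pairing_mul _ _ (ℛ k a) (ℛ k b), mul_apply f g ((ℛ k b).mul (ℛ k a))]
      simp only [pairing_comul, Repr.mul_index, Repr.mul_left, Repr.mul_right]
      rw [Finset.sum_product_right])

end DualCop

end DualCop

section Antipode

open Coalgebra LinearMap WithConv HopfAlgebra

variable (k : Type*) {A : Type*} [Field k] [Ring A] [HopfAlgebra k A]

theorem comul_antipode (a : A) : comul (R := k) (antipode k a) =
    TensorProduct.map (antipode k) (antipode k) (TensorProduct.comm k A A (comul a)) := by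
  let i₁ : A →ₐ[k] A ⊗[k] A := Algebra.TensorProduct.includeLeft
  let i₂ : A →ₐ[k] A ⊗[k] A := Algebra.TensorProduct.includeRight
  have hδ : (toConv comul : WithConv (A →ₗ[k] A ⊗[k] A)) =
      toConv i₁.toLinearMap * toConv i₂.toLinearMap := by
    apply WithConv.ext
    ext a
    change comul a = (_ * _ : WithConv (A →ₗ[k] A ⊗[k] A)) a
    rw [(ℛ k a).convMul_apply]
    simp [i₁, i₂, (ℛ k a).eq]
  have hG : (toConv (i₂.toLinearMap ∘ₗ antipode k) * toConv (i₁.toLinearMap ∘ₗ antipode k) :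
      WithConv (A →ₗ[k] A ⊗[k] A)) = toConv (TensorProduct.map (antipode k) (antipode k) ∘ₗ
        (TensorProduct.comm k A A).toLinearMap ∘ₗ comul) := by
    apply WithConv.ext
    ext a
    change (_ * _ : WithConv (A →ₗ[k] A ⊗[k] A)) a = _
    rw [(ℛ k a).convMul_apply]
    simp [i₁, i₂, ← (ℛ k a).eq]
  have h1 : ∀ i : A →ₐ[k] A ⊗[k] A, (toConv (i.toLinearMap ∘ₗ antipode k) *
      toConv i.toLinearMap : WithConv (A →ₗ[k] A ⊗[k] A)) = 1 := by
    intro i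
    have := LinearMap.algHom_comp_convMul_distrib i (toConv (antipode k (A := A)))
      (toConv LinearMap.id)
    rw [LinearMap.antipode_mul_id] at this
    apply WithConv.ext
    refine this.symm.trans ?_
    ext a
    simp [LinearMap.convOne_def]
  have h2 : (toConv (TensorProduct.map (antipode k) (antipode k) ∘ₗ
        (TensorProduct.comm k A A).toLinearMap ∘ₗ comul) * toConv comul :
        WithConv (A →ₗ[k] A ⊗[k] A)) = 1 := by
    rw [← hG, hδ, mul_assoc, ← mul_assoc (toConv (i₁.toLinearMap ∘ₗ antipode k)), h1, one_mul, h1]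
  have h3 := left_inv_eq_right_inv h2 LinearMap.comul_right_inv
  exact (congrArg (fun φ : WithConv (A →ₗ[k] A ⊗[k] A) => φ a) h3).symm

variable [HasBijectiveAntipode k A]

variable (A) in
/-- The inverse `S⁻¹` of the antipode. -/
def antipodeInv : A →ₗ[k] A :=
  (LinearEquiv.ofBijective (antipode k (A := A)) HasBijectiveAntipode.bijective).symm.toLinearMap

@[simp]
theorem antipode_antipodeInv (a : A) : antipode k (antipodeInv k A a) = a :=
  (LinearEquiv.ofBijective (antipode k (A := A)) HasBijectiveAntipode.bijective).apply_symm_apply a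

@[simp]
theorem antipodeInv_antipode (a : A) : antipodeInv k A (antipode k a) = a :=
  (LinearEquiv.ofBijective (antipode k (A := A)) HasBijectiveAntipode.bijective).symm_apply_apply a

theorem antipode_injective : Function.Injective (antipode k (A := A)) :=
  HasBijectiveAntipode.bijective.1

@[simp]
theorem antipodeInv_one : antipodeInv k A 1 = 1 :=
  antipode_injective k (by simp)

theorem antipodeInv_mul (a b : A) :
    antipodeInv k A (a * b) = antipodeInv k A b * antipodeInv k A a :=
  antipode_injective k (by simp [antipode_mul_antidistrib])

@[simp]
theorem counit_antipodeInv (a : A) : counit (R := k) (antipodeInv k A a) = counit (R := k) a := by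
  conv_rhs => rw [← antipode_antipodeInv k a, counit_antipode]

theorem comul_antipodeInv (a : A) : comul (R := k) (antipodeInv k A a) =
    TensorProduct.map (antipodeInv k A) (antipodeInv k A) (TensorProduct.comm k A A (comul a)) := by
  have h := comul_antipode k (antipodeInv k A a)
  rw [antipode_antipodeInv] at h
  rw [h, ← TensorProduct.map_comm, TensorProduct.map_map,
    show antipodeInv k A ∘ₗ antipode k = LinearMap.id from LinearMap.ext (antipodeInv_antipode k)]
  generalize comul (R := k) (antipodeInv k A a) = t
  induction t with
  | zero => simp
  | tmul x y => simp
  | add s t hs ht => rw [map_add, map_add, map_add, ← hs, ← ht]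

theorem sum_right_mul_antipodeInv_left {a : A} {ι : Type*} (r : Repr k a ι) :
    ∑ i ∈ r.index, r.right i * antipodeInv k A (r.left i) = algebraMap k A (counit a) := by
  refine antipode_injective k ?_
  simp only [map_sum, antipode_mul_antidistrib, antipode_antipodeInv]
  rw [sum_mul_antipode_eq_algebraMap_counit r, Algebra.algebraMap_eq_smul_one, map_smul,
    antipode_one]

theorem sum_antipodeInv_right_mul_left {a : A} {ι : Type*} (r : Repr k a ι) :
    ∑ i ∈ r.index, antipodeInv k A (r.right i) * r.left i = algebraMap k A (counit a) := by
  refine antipode_injective k ?_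
  simp only [map_sum, antipode_mul_antidistrib, antipode_antipodeInv]
  rw [sum_antipode_mul_eq_algebraMap_counit r, Algebra.algebraMap_eq_smul_one, map_smul,
    antipode_one]

/-- The coproduct of `S⁻¹(a)` in terms of the one of `a`. -/
def reprAntipodeInv {a : A} {ι : Type*} (r : Repr k a ι) : Repr k (antipodeInv k A a) ι where
  index := r.index
  left i := antipodeInv k A (r.right i)
  right i := antipodeInv k A (r.left i)
  eq := by rw [comul_antipodeInv, ← r.eq]; simp

end Antipode

section Double

open Coalgebra LinearMap WithConv HopfAlgebra

variable (k : Type*) (A : Type*) [Field k] [Ring A] [HopfAlgebra k A]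

/-- Right translation: `⟨x · f, y⟩ = ⟨f, y x⟩`. -/
def rightTranslation : A →ₐ[k] Module.End k (DualCop k A) :=
  AlgHom.ofLinearMap
    { toFun x := (DualCop.toDual k A).symm.toLinearMap ∘ₗ (LinearMap.mulRight k x).dualMap ∘ₗ
        (DualCop.toDual k A).toLinearMap
      map_add' x x' := by ext f y; simp [mul_add]
      map_smul' c x := by ext f y; simp }
    (by ext f y; simp) (fun x x' => by ext f y; simp [mul_assoc])

@[simp]
theorem rightTranslation_apply (x : A) (f : DualCop k A) (y : A) :
    (rightTranslation k A x f) y = f (y * x) := rfl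

/-- Left multiplication by an element of `(A^*)^cop` on `(A^*)^cop ⊗ A`. -/
def dualMul : DualCop k A →ₐ[k] Module.End k (DualCop k A ⊗[k] A) :=
  (Module.End.rTensorAlgHom k (DualCop k A) A).comp (Algebra.lmul k (DualCop k A))

theorem dualMul_tmul (f g : DualCop k A) (b : A) : dualMul k A f (g ⊗ₜ b) = (f * g) ⊗ₜ b := rfl

variable [HasBijectiveAntipode k A]

/-- Left translation by `S⁻¹`: `⟨z · f, y⟩ = ⟨f, S⁻¹(z) y⟩`. -/
def leftTranslation : A →ₐ[k] Module.End k (DualCop k A) :=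
  AlgHom.ofLinearMap
    { toFun z := (DualCop.toDual k A).symm.toLinearMap ∘ₗ
        (LinearMap.mulLeft k (antipodeInv k A z)).dualMap ∘ₗ (DualCop.toDual k A).toLinearMap
      map_add' x x' := by ext f y; simp [add_mul]
      map_smul' c x := by ext f y; simp }
    (by ext f y; simp) (fun x x' => by ext f y; simp [antipodeInv_mul])

@[simp]
theorem leftTranslation_apply (z : A) (f : DualCop k A) (y : A) :
    (leftTranslation k A z f) y = f (antipodeInv k A z * y) := rfl

/-- The action of `A ⊗ A ⊗ A` on `(A^*)^cop ⊗ A` given by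
`(x ⊗ y ⊗ z) · (f ⊗ b) = f(S⁻¹(z) ? x) ⊗ y b`. -/
def action₃ : A ⊗[k] (A ⊗[k] A) →ₐ[k] Module.End k (DualCop k A ⊗[k] A) :=
  Algebra.TensorProduct.lift
    ((Module.End.rTensorAlgHom k (DualCop k A) A).comp (rightTranslation k A))
    (Algebra.TensorProduct.lift
      ((Module.End.lTensorAlgHom k A (DualCop k A)).comp (Algebra.lmul k A))
      ((Module.End.rTensorAlgHom k (DualCop k A) A).comp (leftTranslation k A))
      (fun y z => TensorProduct.ext' fun f b => rfl))
    (fun x t => by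
      induction t with
      | zero => simp
      | tmul y z =>
        have e : ∀ f : DualCop k A, rightTranslation k A x (leftTranslation k A z f) =
            leftTranslation k A z (rightTranslation k A x f) := by
          intro f
          ext w
          simp [mul_assoc]
        refine TensorProduct.ext' fun f b => ?_
        exact congrArg (fun u => u ⊗ₜ[k] (y * b)) (e f)
      | add s t hs ht => rw [map_add]; exact hs.add_right ht)

theorem action₃_tmul (x y z : A) (f : DualCop k A) (b : A) :
    action₃ k A (x ⊗ₜ (y ⊗ₜ z)) (f ⊗ₜ b) =
      rightTranslation k A x (leftTranslation k A z f) ⊗ₜ (y * b) := rfl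

/-- The action of `A` on `(A^*)^cop ⊗ A` given by
`a · (f ⊗ b) = f(S⁻¹(a₍₃₎) ? a₍₁₎) ⊗ a₍₂₎ b`. -/
def straighten : A →ₐ[k] Module.End k (DualCop k A ⊗[k] A) :=
  (action₃ k A).comp ((Algebra.TensorProduct.map (.id k A) (Bialgebra.comulAlgHom k A)).comp
    (Bialgebra.comulAlgHom k A))

theorem straighten_apply (a : A) :
    straighten k A a = action₃ k A ((comul (R := k)).lTensor A (comul a)) := rfl

/-- Left multiplication in the Drinfeld double:
`(f ⊗ a) (g ⊗ b) = f g(S⁻¹(a₍₃₎) ? a₍₁₎) ⊗ a₍₂₎ b`. -/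
def leftMul : DualCop k A ⊗[k] A →ₗ[k] Module.End k (DualCop k A ⊗[k] A) :=
  TensorProduct.lift ((LinearMap.mul k (Module.End k (DualCop k A ⊗[k] A))).compl₁₂
    (dualMul k A).toLinearMap (straighten k A).toLinearMap)

theorem leftMul_tmul (f : DualCop k A) (a : A) :
    leftMul k A (f ⊗ₜ a) = dualMul k A f * straighten k A a := rfl

end Double

section DoubleMul

open Coalgebra LinearMap WithConv HopfAlgebra

variable {k : Type*} {A : Type*} [Field k] [Ring A] [HopfAlgebra k A]

theorem rTensor_rightTranslation_mul (g : DualCop k A) {a : A} {ι : Type*} (r : Repr k a ι) :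
    (rightTranslation k A a).rTensor A * dualMul k A g = ∑ i ∈ r.index,
      dualMul k A (rightTranslation k A (r.left i) g) *
        (rightTranslation k A (r.right i)).rTensor A := by
  have e : ∀ f : DualCop k A, rightTranslation k A a (g * f) = ∑ i ∈ r.index,
      rightTranslation k A (r.left i) g * rightTranslation k A (r.right i) f := by
    intro f
    ext y
    rw [rightTranslation_apply, DualCop.mul_apply g f ((ℛ k y).mul r), map_sum,
      LinearMap.sum_apply]
    simp only [Repr.mul_index, Repr.mul_left, Repr.mul_right]
    rw [Finset.sum_product_right]
    refine Finset.sum_congr rfl fun i _ => ?_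
    rw [DualCop.mul_apply _ _ (ℛ k y)]
    rfl
  refine TensorProduct.ext' fun f b => ?_
  rw [LinearMap.sum_apply]
  change rightTranslation k A a (g * f) ⊗ₜ b = _
  rw [e, TensorProduct.sum_tmul]
  rfl

variable [HasBijectiveAntipode k A]

theorem rTensor_leftTranslation_mul (g : DualCop k A) {a : A} {ι : Type*} (r : Repr k a ι) :
    (leftTranslation k A a).rTensor A * dualMul k A g = ∑ i ∈ r.index,
      dualMul k A (leftTranslation k A (r.right i) g) *
        (leftTranslation k A (r.left i)).rTensor A := by
  have e : ∀ f : DualCop k A, leftTranslation k A a (g * f) = ∑ i ∈ r.index,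
      leftTranslation k A (r.right i) g * leftTranslation k A (r.left i) f := by
    intro f
    ext y
    rw [leftTranslation_apply, DualCop.mul_apply g f ((reprAntipodeInv k r).mul (ℛ k y)), map_sum,
      LinearMap.sum_apply]
    simp only [Repr.mul_index, Repr.mul_left, Repr.mul_right, reprAntipodeInv]
    rw [Finset.sum_product]
    refine Finset.sum_congr rfl fun i _ => ?_
    rw [DualCop.mul_apply _ _ (ℛ k y)]
    rfl
  refine TensorProduct.ext' fun f b => ?_
  rw [LinearMap.sum_apply]
  change leftTranslation k A a (g * f) ⊗ₜ b = _
  rw [e, TensorProduct.sum_tmul]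
  rfl

end DoubleMul

section Triple

open Coalgebra LinearMap WithConv

variable {k : Type*} {A E : Type*} [Field k] [Ring A] [Bialgebra k A] [Ring E] [Algebra k E]

theorem conv₃_apply (F G H : A →ₗ[k] E) (a : A) :
    (toConv F * (toConv G * toConv H) : WithConv (A →ₗ[k] E)) a =
      (LinearMap.mul' k E ∘ₗ TensorProduct.map F (LinearMap.mul' k E ∘ₗ TensorProduct.map G H))
        ((comul (R := k)).lTensor A (comul a)) := by
  rw [convMul_apply]
  generalize comul (R := k) a = t
  induction t with
  | zero => simp
  | tmul x y => simp [convMul_apply]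
  | add s t hs ht => simp only [map_add, hs, ht]

variable (k A) in
/-- The constant map, in the convolution algebra. -/
def convConst (e : E) : WithConv (A →ₗ[k] E) := toConv ((counit (R := k) (A := A)).smulRight e)

theorem mul_convConst_apply (F : WithConv (A →ₗ[k] E)) (e : E) (a : A) :
    (F * convConst k A e) a = F a * e := by
  have h : F * convConst k A e = toConv (LinearMap.mulRight k e ∘ₗ F.ofConv) := by
    conv_rhs => rw [← mul_one F]
    apply WithConv.ext
    ext a
    change (_ * _ : WithConv (A →ₗ[k] E)) a = (F * 1 : WithConv (A →ₗ[k] E)) a * e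
    rw [(ℛ k a).convMul_apply, (ℛ k a).convMul_apply, Finset.sum_mul]
    simp [convConst, Algebra.algebraMap_eq_smul_one]
  rw [h]
  rfl

theorem convConst_mul_apply (F : WithConv (A →ₗ[k] E)) (e : E) (a : A) :
    (convConst k A e * F) a = e * F a := by
  have h : convConst k A e * F = toConv (LinearMap.mulLeft k e ∘ₗ F.ofConv) := by
    conv_rhs => rw [← one_mul F]
    apply WithConv.ext
    ext a
    change (_ * _ : WithConv (A →ₗ[k] E)) a = e * (1 * F : WithConv (A →ₗ[k] E)) a
    rw [(ℛ k a).convMul_apply, (ℛ k a).convMul_apply, Finset.mul_sum]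
    simp [convConst, Algebra.algebraMap_eq_smul_one]
  rw [h]
  rfl

end Triple

section DoubleAssoc

open Coalgebra LinearMap WithConv HopfAlgebra

variable {k : Type*} {A : Type*} [Field k] [Ring A] [HopfAlgebra k A] [HasBijectiveAntipode k A]

theorem straighten_eq_conv (a : A) : straighten k A a =
    (toConv (((rTensorHom A).comp (rightTranslation k A).toLinearMap)) *
      (toConv ((lTensorHom (DualCop k A)).comp (LinearMap.mul k A)) *
        toConv ((rTensorHom A).comp (leftTranslation k A).toLinearMap)) :
      WithConv (A →ₗ[k] Module.End k (DualCop k A ⊗[k] A))) a := by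
  rw [conv₃_apply, straighten_apply]
  generalize (comul (R := k)).lTensor A (comul a) = t
  refine LinearMap.congr_fun (f := (action₃ k A).toLinearMap) ?_ t
  refine TensorProduct.ext_threefold' fun x y z => ?_
  exact TensorProduct.ext' fun f b => rfl

theorem leftMul_dualMul (f : DualCop k A) (w : DualCop k A ⊗[k] A) :
    leftMul k A (dualMul k A f w) = dualMul k A f * leftMul k A w := by
  induction w with
  | zero => simp
  | add s t hs ht => simp only [map_add, hs, ht, mul_add]
  | tmul g b => rw [dualMul_tmul, leftMul_tmul, leftMul_tmul, map_mul, mul_assoc]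

theorem straighten_one_tmul (a b : A) : straighten k A a (1 ⊗ₜ b) = 1 ⊗ₜ (a * b) := by
  have e : ∀ x, rightTranslation k A x (1 : DualCop k A) = counit (R := k) x • 1 := by
    intro x
    ext y
    simp [mul_comm]
  have e' : ∀ x, leftTranslation k A x (1 : DualCop k A) = counit (R := k) x • 1 := by
    intro x
    ext y
    simp
  have h : ∀ t : A ⊗[k] (A ⊗[k] A), action₃ k A t (1 ⊗ₜ b) = 1 ⊗ₜ ((TensorProduct.lid k A
      ((counit (R := k) (A := A)).rTensor A ((TensorProduct.rid k A).toLinearMap.lTensor A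
        (((counit (R := k) (A := A)).lTensor A).lTensor A t)))) * b) := by
    intro t
    induction t with
    | zero => simp
    | add s t hs ht => simp only [map_add, LinearMap.add_apply, hs, ht, add_mul,
        TensorProduct.tmul_add]
    | tmul x s =>
      induction s with
      | zero => simp
      | add s t hs ht => simp only [TensorProduct.tmul_add, map_add, LinearMap.add_apply, hs, ht,
          add_mul]
      | tmul y z =>
        rw [action₃_tmul, e', map_smul, e, smul_smul, ← TensorProduct.smul_tmul', LinearMap.lTensor_tmul,
          LinearMap.lTensor_tmul, LinearMap.lTensor_tmul, LinearMap.rTensor_tmul,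
          TensorProduct.lid_tmul, LinearEquiv.coe_coe, TensorProduct.rid_tmul, smul_smul,
          smul_mul_assoc, TensorProduct.tmul_smul, mul_comm]
  rw [straighten_apply, h]
  have e2 : ((counit (R := k) (A := A)).lTensor A).lTensor A
      ((comul (R := k)).lTensor A (comul (R := k) a)) =
      ((TensorProduct.mk k A k).flip 1).lTensor A (comul (R := k) a) := by
    rw [← LinearMap.comp_apply, ← LinearMap.lTensor_comp, Coalgebra.lTensor_counit_comp_comul]
  have e3 : (TensorProduct.rid k A).toLinearMap.lTensor A
      (((TensorProduct.mk k A k).flip 1).lTensor A (comul (R := k) a)) = comul (R := k) a := by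
    rw [← LinearMap.comp_apply, ← LinearMap.lTensor_comp]
    convert LinearMap.lTensor_id_apply A A (comul (R := k) a)
    ext
    simp
  rw [e2, e3, Coalgebra.rTensor_counit_comul, TensorProduct.lid_tmul, one_smul]

variable [Module.Finite k A]

theorem leftMul_straighten_one (a : A) (g : DualCop k A) :
    leftMul k A (straighten k A a (g ⊗ₜ 1)) = straighten k A a * dualMul k A g := by
  let E := Module.End k (DualCop k A ⊗[k] A)
  let rr : WithConv (A →ₗ[k] E) := toConv ((rTensorHom A).comp (rightTranslation k A).toLinearMap)
  let mm : WithConv (A →ₗ[k] E) := toConv ((lTensorHom (DualCop k A)).comp (LinearMap.mul k A))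
  let nn : WithConv (A →ₗ[k] E) := toConv ((rTensorHom A).comp (leftTranslation k A).toLinearMap)
  let F : DualCop k A → WithConv (A →ₗ[k] E) := fun f =>
    toConv ((dualMul k A).toLinearMap ∘ₗ (rightTranslation k A).toLinearMap.flip f)
  let sc : DualCop k A → WithConv (A →ₗ[k] E) := fun c =>
    toConv ((DualCop.toDual k A c ∘ₗ antipodeInv k A).smulRight 1)
  let r := ℛ k g
  have hL : ∀ z, leftTranslation k A z g =
      ∑ i ∈ r.index, (r.right i) (antipodeInv k A z) • r.left i := by
    intro z
    ext y
    rw [leftTranslation_apply, ← DualCop.pairing_comul, ← r.eq, map_sum, map_sum,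
      LinearMap.sum_apply, LinearMap.sum_apply]
    simp [mul_comm]
  have hrr : ∀ f, rr * convConst k A (dualMul k A f) = F f * rr := by
    intro f
    apply WithConv.ext
    ext1 a
    change (_ * _ : WithConv (A →ₗ[k] E)) a = (_ * _ : WithConv (A →ₗ[k] E)) a
    rw [mul_convConst_apply, (ℛ k a).convMul_apply]
    exact rTensor_rightTranslation_mul f (ℛ k a)
  have hmm : ∀ f, mm * convConst k A (dualMul k A f) = convConst k A (dualMul k A f) * mm := by
    intro f
    apply WithConv.ext
    ext1 a
    change (_ * _ : WithConv (A →ₗ[k] E)) a = (_ * _ : WithConv (A →ₗ[k] E)) a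
    rw [mul_convConst_apply, convConst_mul_apply]
    exact TensorProduct.ext' fun f b => rfl
  have hnn : nn * convConst k A (dualMul k A g) =
      ∑ i ∈ r.index, convConst k A (dualMul k A (r.left i)) * (nn * sc (r.right i)) := by
    apply WithConv.ext
    ext1 a
    change (_ * _ : WithConv (A →ₗ[k] E)) a = WithConv.linearEquiv k (A →ₗ[k] E) (∑ i ∈ r.index, _) a
    rw [mul_convConst_apply, map_sum, LinearMap.sum_apply]
    refine (rTensor_leftTranslation_mul g (ℛ k a)).trans ?_
    simp only [hL, map_sum, map_smul, Finset.sum_mul, smul_mul_assoc]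
    rw [Finset.sum_comm]
    refine Finset.sum_congr rfl fun i _ => ?_
    change _ = (_ * _ : WithConv (A →ₗ[k] E)) a
    rw [convConst_mul_apply, (ℛ k a).convMul_apply, Finset.mul_sum]
    refine Finset.sum_congr rfl fun j _ => ?_
    simp [sc, nn]
  have hΛ : toConv (straighten k A).toLinearMap = rr * (mm * nn) :=
    WithConv.ext (LinearMap.ext fun a => straighten_eq_conv a)
  have key : toConv (straighten k A).toLinearMap * convConst k A (dualMul k A g) =
      ∑ i ∈ r.index, F (r.left i) * (toConv (straighten k A).toLinearMap * sc (r.right i)) := by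
    rw [hΛ, mul_assoc, mul_assoc, hnn, Finset.mul_sum, Finset.mul_sum]
    refine Finset.sum_congr rfl fun i _ => ?_
    rw [← mul_assoc mm, hmm, mul_assoc, ← mul_assoc rr, hrr]
    simp only [mul_assoc]
  have e := congrArg (fun φ : WithConv (A →ₗ[k] E) => φ a) key
  change (_ * _ : WithConv (A →ₗ[k] E)) a = WithConv.linearEquiv k (A →ₗ[k] E) (∑ i ∈ r.index, _) a at e
  rw [mul_convConst_apply, map_sum, LinearMap.sum_apply] at e
  refine Eq.trans ?_ e.symm
  have e2 : ∀ i, (WithConv.linearEquiv k (A →ₗ[k] E)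
      (F (r.left i) * (toConv (straighten k A).toLinearMap * sc (r.right i)))) a = _ :=
    fun i => conv₃_apply _ _ _ a
  simp only [e2]
  rw [straighten_apply, ← LinearMap.sum_apply]
  generalize (comul (R := k)).lTensor A (comul a) = t
  refine LinearMap.congr_fun (f := leftMul k A ∘ₗ
    (LinearMap.applyₗ (g ⊗ₜ[k] (1 : A))) ∘ₗ (action₃ k A).toLinearMap) ?_ t
  refine TensorProduct.ext_threefold' fun x y z => ?_
  rw [LinearMap.sum_apply]
  change leftMul k A (action₃ k A (x ⊗ₜ (y ⊗ₜ z)) (g ⊗ₜ 1)) = _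
  rw [action₃_tmul, hL, leftMul_tmul, mul_one]
  simp only [map_sum, map_smul, Finset.sum_mul, smul_mul_assoc]
  refine Finset.sum_congr rfl fun i _ => ?_
  simp

theorem leftMul_straighten (a : A) (w : DualCop k A ⊗[k] A) :
    leftMul k A (straighten k A a w) = straighten k A a * leftMul k A w := by
  have h1 : ∀ (t : A ⊗[k] (A ⊗[k] A)) (g : DualCop k A) (b : A),
      leftMul k A (action₃ k A t (g ⊗ₜ b)) =
        leftMul k A (action₃ k A t (g ⊗ₜ 1)) * straighten k A b := by
    intro t g b
    refine LinearMap.congr_fun (f := leftMul k A ∘ₗ (LinearMap.applyₗ (g ⊗ₜ[k] b)) ∘ₗ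
      (action₃ k A).toLinearMap) (g := LinearMap.mulRight k (straighten k A b) ∘ₗ leftMul k A ∘ₗ
      (LinearMap.applyₗ (g ⊗ₜ[k] (1 : A))) ∘ₗ (action₃ k A).toLinearMap) ?_ t
    refine TensorProduct.ext_threefold' fun x y z => ?_
    change leftMul k A (action₃ k A (x ⊗ₜ (y ⊗ₜ z)) (g ⊗ₜ b)) =
      leftMul k A (action₃ k A (x ⊗ₜ (y ⊗ₜ z)) (g ⊗ₜ 1)) * straighten k A b
    rw [action₃_tmul, action₃_tmul, leftMul_tmul, leftMul_tmul, map_mul, mul_one, mul_assoc]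
  induction w with
  | zero => simp
  | add s t hs ht => simp only [map_add, hs, ht, mul_add]
  | tmul g b =>
    rw [straighten_apply, h1, ← straighten_apply, leftMul_straighten_one, leftMul_tmul, mul_assoc]

theorem leftMul_leftMul (v w : DualCop k A ⊗[k] A) :
    leftMul k A (leftMul k A v w) = leftMul k A v * leftMul k A w := by
  induction v with
  | zero => simp
  | add s t hs ht => simp only [map_add, LinearMap.add_apply, hs, ht, add_mul]
  | tmul f a => rw [leftMul_tmul, Module.End.mul_apply, leftMul_dualMul, leftMul_straighten,
      mul_assoc]

end DoubleAssoc

section DrinfeldDouble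

open Coalgebra LinearMap WithConv HopfAlgebra

variable (k : Type*) (A : Type*) [Field k] [Ring A] [HopfAlgebra k A]

/-- The Drinfeld double `D(A) = (A^*)^cop ⋈ A` of a finite dimensional Hopf algebra: the coalgebra
`(A^*)^cop ⊗ A` with the product
`(f ⊗ a) (g ⊗ b) = f g(S⁻¹(a₍₃₎) ? a₍₁₎) ⊗ a₍₂₎ b`. -/
def DrinfeldDouble : Type _ := DualCop k A ⊗[k] A

namespace DrinfeldDouble

instance : AddCommGroup (DrinfeldDouble k A) := inferInstanceAs (AddCommGroup (DualCop k A ⊗[k] A))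

instance : Module k (DrinfeldDouble k A) := inferInstanceAs (Module k (DualCop k A ⊗[k] A))

/-- The coalgebra structure is the one of the tensor product of coalgebras. -/
instance [Module.Finite k A] : Coalgebra k (DrinfeldDouble k A) :=
  inferInstanceAs (Coalgebra k (DualCop k A ⊗[k] A))

instance : One (DrinfeldDouble k A) := ⟨(1 : DualCop k A) ⊗ₜ (1 : A)⟩

theorem one_def : (1 : DrinfeldDouble k A) = (1 : DualCop k A) ⊗ₜ[k] (1 : A) := rfl

variable [HasBijectiveAntipode k A]

instance : Mul (DrinfeldDouble k A) := ⟨fun v w => leftMul k A v w⟩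

theorem mul_def (v w : DrinfeldDouble k A) : v * w = leftMul k A v w := rfl

variable [Module.Finite k A]

instance : Ring (DrinfeldDouble k A) where
  __ := (inferInstance : AddCommGroup (DrinfeldDouble k A))
  left_distrib u v w := map_add (leftMul k A u) v w
  right_distrib u v w := LinearMap.congr_fun (map_add (leftMul k A) u v) w
  zero_mul w := LinearMap.congr_fun (map_zero (leftMul k A)) w
  mul_zero w := map_zero (leftMul k A w)
  mul_assoc u v w := LinearMap.congr_fun (leftMul_leftMul u v) w
  one_mul w := by
    rw [mul_def, one_def, leftMul_tmul, map_one, map_one]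
    rfl
  mul_one w := by
    rw [mul_def, one_def]
    refine LinearMap.congr_fun (f := (leftMul k A).flip ((1 : DualCop k A) ⊗ₜ (1 : A)))
      (g := LinearMap.id) (TensorProduct.ext' fun f a => ?_) w
    change leftMul k A (f ⊗ₜ a) (1 ⊗ₜ 1) = f ⊗ₜ a
    rw [leftMul_tmul, Module.End.mul_apply, straighten_one_tmul, dualMul_tmul, mul_one, mul_one]

instance : Algebra k (DrinfeldDouble k A) :=
  Algebra.ofModule (fun c v w => LinearMap.congr_fun (map_smul (leftMul k A) c v) w)
    (fun c v w => map_smul (leftMul k A v) c w)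

variable {k A}

/-- The element `f ⊗ a` of the Drinfeld double. -/
def tmul (f : DualCop k A) (a : A) : DrinfeldDouble k A := f ⊗ₜ[k] a

/-- The product of the Drinfeld double, in terms of an expression
`(id ⊗ Δ)(Δ(a)) = ∑ i, x i ⊗ y i ⊗ z i`. -/
theorem tmul_mul_tmul (f g : DualCop k A) (a b : A) {ι : Type*} (s : Finset ι) (x y z : ι → A)
    (h : (comul (R := k)).lTensor A (comul a) = ∑ i ∈ s, x i ⊗ₜ (y i ⊗ₜ z i)) :
    tmul f a * tmul g b = ∑ i ∈ s, tmul (f * (DualCop.toDual k A).symm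
      ((DualCop.toDual k A g) ∘ₗ LinearMap.mulLeft k (antipodeInv k A (z i)) ∘ₗ
        LinearMap.mulRight k (x i))) (y i * b) := by
  rw [mul_def, tmul, tmul, leftMul_tmul, Module.End.mul_apply, straighten_apply, h, map_sum,
    LinearMap.sum_apply, map_sum]
  rfl

end DrinfeldDouble

end DrinfeldDouble

namespace DrinfeldDouble

section DrinfeldBialgebra

open Coalgebra LinearMap WithConv HopfAlgebra

variable {k : Type*} {A : Type*} [Field k] [Ring A] [HopfAlgebra k A] [HasBijectiveAntipode k A]
variable [Module.Finite k A]


variable (k A) in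
/-- The inclusion of `(A^*)^cop` in the Drinfeld double. -/
def inclDual : DualCop k A →ₐ[k] DrinfeldDouble k A :=
  AlgHom.ofLinearMap ((TensorProduct.mk k (DualCop k A) A).flip 1) rfl (fun f g => by
    change (f * g) ⊗ₜ[k] (1 : A) = leftMul k A (f ⊗ₜ 1) (g ⊗ₜ 1)
    rw [leftMul_tmul, map_one, mul_one, dualMul_tmul])

variable (k A) in
/-- The inclusion of `A` in the Drinfeld double. -/
def incl : A →ₐ[k] DrinfeldDouble k A :=
  AlgHom.ofLinearMap (TensorProduct.mk k (DualCop k A) A 1) rfl (fun a b => by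
    change (1 : DualCop k A) ⊗ₜ[k] (a * b) = leftMul k A (1 ⊗ₜ a) (1 ⊗ₜ b)
    rw [leftMul_tmul, map_one, one_mul, straighten_one_tmul])

theorem tmul_eq_mul (f : DualCop k A) (a : A) : tmul f a = inclDual k A f * incl k A a := by
  change f ⊗ₜ a = leftMul k A (f ⊗ₜ 1) (1 ⊗ₜ a)
  rw [leftMul_tmul, map_one, mul_one, dualMul_tmul, mul_one]

theorem incl_mul_inclDual (a : A) (g : DualCop k A) :
    incl k A a * inclDual k A g = straighten k A a (g ⊗ₜ 1) := by
  change leftMul k A (1 ⊗ₜ a) (g ⊗ₜ 1) = _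
  rw [leftMul_tmul, map_one, one_mul]

variable (k A) in
/-- The exchange of the two middle factors. -/
def shuffle : (DualCop k A ⊗[k] DualCop k A) ⊗[k] (A ⊗[k] A) ≃ₗ[k]
    DrinfeldDouble k A ⊗[k] DrinfeldDouble k A :=
  TensorProduct.AlgebraTensorModule.tensorTensorTensorComm k k k k _ _ _ _

theorem comul_tmul_eq_shuffle (f : DualCop k A) (a : A) : comul (R := k) (tmul f a) =
    shuffle k A (comul (R := k) f ⊗ₜ[k] comul (R := k) a) := rfl

theorem comul_tmul (f : DualCop k A) (a : A) : comul (R := k) (tmul f a) =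
    Algebra.TensorProduct.map (inclDual k A) (inclDual k A) (comul (R := k) f) *
      Algebra.TensorProduct.map (incl k A) (incl k A) (comul (R := k) a) := by
  rw [comul_tmul_eq_shuffle]
  generalize comul (R := k) f = s
  generalize comul (R := k) a = t
  refine LinearMap.congr_fun₂ (f := (TensorProduct.mk k _ _).compr₂
    (shuffle k A).toLinearMap)
    (g := (LinearMap.mul k (DrinfeldDouble k A ⊗[k] DrinfeldDouble k A)).compl₁₂
      (Algebra.TensorProduct.map (inclDual k A) (inclDual k A)).toLinearMap
      (Algebra.TensorProduct.map (incl k A) (incl k A)).toLinearMap) ?_ s t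
  refine TensorProduct.ext' fun f f' => TensorProduct.ext' fun a a' => ?_
  change tmul f a ⊗ₜ[k] tmul f' a' = (inclDual k A f ⊗ₜ[k] inclDual k A f') *
    (incl k A a ⊗ₜ[k] incl k A a')
  rw [Algebra.TensorProduct.tmul_mul_tmul, tmul_eq_mul, tmul_eq_mul]

theorem comul_inclDual (f : DualCop k A) : comul (R := k) (inclDual k A f) =
    Algebra.TensorProduct.map (inclDual k A) (inclDual k A) (comul (R := k) f) := by
  have := comul_tmul f (1 : A)
  rwa [tmul_eq_mul, map_one, mul_one, Bialgebra.comul_one, map_one, mul_one] at this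

theorem comul_incl (a : A) : comul (R := k) (incl k A a) =
    Algebra.TensorProduct.map (incl k A) (incl k A) (comul (R := k) a) := by
  have := comul_tmul (1 : DualCop k A) a
  rwa [tmul_eq_mul, map_one, one_mul, Bialgebra.comul_one, map_one, one_mul] at this

/-- Evaluation of the first factor: `f ⊗ a ↦ f(y) a`. -/
def evalAt (y : A) : DrinfeldDouble k A →ₗ[k] A :=
  TensorProduct.lift ((LinearMap.lsmul k A).comp
    ((LinearMap.applyₗ y).comp (DualCop.toDual k A).toLinearMap))

theorem evalAt_tmul (y : A) (f : DualCop k A) (a : A) : evalAt y (tmul f a) = f y • a := rfl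

theorem map_evalAt_comm (y z : A) (s : DualCop k A ⊗[k] DualCop k A) (t : A ⊗[k] A) :
    TensorProduct.map (evalAt y) (evalAt z)
      (shuffle k A (s ⊗ₜ[k] t)) =
      DualCop.pairing k A s (y ⊗ₜ z) • t := by
  refine LinearMap.congr_fun₂ (f := (TensorProduct.mk k _ _).compr₂
    ((TensorProduct.map (evalAt y) (evalAt z)) ∘ₗ (shuffle k A).toLinearMap))
    (g := (LinearMap.lsmul k (A ⊗[k] A)).comp ((LinearMap.applyₗ (y ⊗ₜ[k] z)).comp
      (DualCop.pairing k A).toLinearMap)) ?_ s t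
  refine TensorProduct.ext' fun f f' => TensorProduct.ext' fun a a' => ?_
  change evalAt y (tmul f a) ⊗ₜ[k] evalAt z (tmul f' a') = (f y * f' z) • (a ⊗ₜ[k] a')
  rw [evalAt_tmul, evalAt_tmul, TensorProduct.smul_tmul_smul]

theorem map_evalAt_injective {s t : DrinfeldDouble k A ⊗[k] DrinfeldDouble k A}
    (h : ∀ y z, TensorProduct.map (evalAt y) (evalAt z) s =
      TensorProduct.map (evalAt y) (evalAt z) t) : s = t := by
  let e := shuffle k A
  let Φ := (TensorProduct.congr (DualCop.pairing k A) (LinearEquiv.refl k (A ⊗[k] A))).trans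
    (dualTensorHomEquiv k (A ⊗[k] A) (A ⊗[k] A))
  obtain ⟨s, rfl⟩ := e.surjective s
  obtain ⟨t, rfl⟩ := e.surjective t
  refine congrArg e (Φ.injective (TensorProduct.ext' fun y z => ?_))
  have hΦ : ∀ u, Φ u (y ⊗ₜ z) = TensorProduct.map (evalAt y) (evalAt z) (e u) := by
    intro u
    refine LinearMap.congr_fun (f := (LinearMap.applyₗ (y ⊗ₜ[k] z)) ∘ₗ Φ.toLinearMap)
      (g := TensorProduct.map (evalAt y) (evalAt z) ∘ₗ e.toLinearMap)
      (TensorProduct.ext' fun s t => ?_) u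
    refine Eq.trans ?_ (map_evalAt_comm y z s t).symm
    simp [Φ]
  rw [hΦ, hΦ]
  exact h y z

theorem map_evalAt_comul (y z : A) (w : DrinfeldDouble k A) :
    TensorProduct.map (evalAt y) (evalAt z) (comul (R := k) w) =
      comul (R := k) (evalAt (z * y) w) := by
  refine LinearMap.congr_fun (f := TensorProduct.map (evalAt y) (evalAt z) ∘ₗ comul)
    (g := comul ∘ₗ evalAt (z * y)) (TensorProduct.ext' fun f a => ?_) w
  refine (map_evalAt_comm y z (comul (R := k) f) (comul (R := k) a)).trans ?_
  rw [DualCop.pairing_comul]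
  exact (map_smul (comul (R := k)) (f (z * y)) a).symm

end DrinfeldBialgebra

end DrinfeldDouble

namespace DrinfeldDouble

section DrinfeldComul

open Coalgebra LinearMap WithConv HopfAlgebra

variable {k : Type*} {A : Type*} [Field k] [Ring A] [HopfAlgebra k A]

variable (k A) in
/-- An algebra in which the iterated coproducts are computed. -/
abbrev Aux : Type _ := Aᵐᵒᵖ ⊗[k] (A ⊗[k] A)

variable (k A) in
/-- `a ↦ a ⊗ (1 ⊗ 1)`. -/
def auxLeft : A →ₗ[k] Aux k A :=
  (TensorProduct.mk k Aᵐᵒᵖ (A ⊗[k] A)).flip 1 ∘ₗ (MulOpposite.opLinearEquiv k).toLinearMap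

theorem auxLeft_apply (a : A) : auxLeft k A a = .op a ⊗ₜ 1 := rfl

variable (k A) in
/-- `t ↦ 1 ⊗ t`. -/
def auxRight : A ⊗[k] A →ₐ[k] Aux k A := Algebra.TensorProduct.includeRight

theorem auxRight_apply (t : A ⊗[k] A) : auxRight k A t = 1 ⊗ₜ t := rfl

theorem auxLeft_mul (a b : A) : auxLeft k A a * auxLeft k A b = auxLeft k A (b * a) := by
  simp [auxLeft_apply]

theorem auxLeft_mul_comm (a : A) (t : A ⊗[k] A) :
    auxRight k A t * auxLeft k A a = auxLeft k A a * auxRight k A t := by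
  simp [auxLeft_apply, auxRight_apply]

/-- Evaluation of `g` on the first factor. -/
def auxEval (g : DualCop k A) : Aux k A →ₗ[k] A ⊗[k] A :=
  TensorProduct.lift ((LinearMap.lsmul k (A ⊗[k] A)).comp
    (DualCop.toDual k A g ∘ₗ (MulOpposite.opLinearEquiv k).symm.toLinearMap))

theorem auxEval_apply (g : DualCop k A) (a : A) (t : A ⊗[k] A) :
    auxEval g (auxLeft k A a * auxRight k A t) = g a • t := by
  rw [auxLeft_apply, auxRight_apply, Algebra.TensorProduct.tmul_mul_tmul, one_mul, mul_one]
  rfl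

theorem aux_triple (a b c : A) (t : A ⊗[k] A) :
    auxLeft k A a * auxLeft k A b * (auxRight k A t * auxLeft k A c) =
      auxLeft k A (c * b * a) * auxRight k A t := by
  rw [auxLeft_mul_comm, auxLeft_mul, ← mul_assoc, auxLeft_mul, mul_assoc]

variable [HasBijectiveAntipode k A]

variable (k A) in
/-- `y ↦ ∑ S⁻¹(a₍₃₎) y a₍₁₎ ⊗ φ(a₍₂₎)`, in the convolution algebra. -/
def auxConj (φ : A →ₗ[k] A ⊗[k] A) (y : A) : WithConv (A →ₗ[k] Aux k A) :=
  toConv (LinearMap.mulRight k (auxLeft k A y) ∘ₗ auxLeft k A) *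
    (toConv ((auxRight k A).toLinearMap ∘ₗ φ) * toConv (auxLeft k A ∘ₗ antipodeInv k A))

theorem auxConj_eq (φ : A →ₗ[k] A ⊗[k] A) (y : A) : auxConj k A φ y =
    toConv (auxLeft k A) * (convConst k A (auxLeft k A y) *
      (toConv ((auxRight k A).toLinearMap ∘ₗ φ) * toConv (auxLeft k A ∘ₗ antipodeInv k A))) := by
  rw [auxConj, ← mul_assoc (toConv (auxLeft k A))]
  congr 1
  apply WithConv.ext
  ext1 a
  exact (mul_convConst_apply _ _ _).symm

theorem auxLeft_antipodeInv_mul :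
    (toConv (auxLeft k A ∘ₗ antipodeInv k A) * toConv (auxLeft k A) :
      WithConv (A →ₗ[k] Aux k A)) = 1 := by
  apply WithConv.ext
  ext1 a
  change (_ * _ : WithConv (A →ₗ[k] Aux k A)) a = _
  rw [(ℛ k a).convMul_apply]
  change ∑ i ∈ _, auxLeft k A (antipodeInv k A _) * auxLeft k A _ = algebraMap k _ (counit a)
  simp only [auxLeft_mul, ← map_sum]
  rw [sum_right_mul_antipodeInv_left, auxLeft_apply, Algebra.TensorProduct.algebraMap_apply]
  rfl

theorem mul_cancel_middle {M : Type*} [Monoid M] {i j j' s y z : M} (h : s * i = 1)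
    (hz : j * z = z * j) :
    i * (y * (j * s)) * (i * (z * (j' * s))) = i * (y * z * (j * j' * s)) := by
  simp only [mul_assoc]
  rw [← mul_assoc s, h, one_mul, ← mul_assoc j z, hz, mul_assoc]

theorem auxConj_mul_auxConj (y z : A) :
    auxConj k A (Algebra.TensorProduct.includeLeft : A →ₐ[k] A ⊗[k] A).toLinearMap y *
      auxConj k A (Algebra.TensorProduct.includeRight : A →ₐ[k] A ⊗[k] A).toLinearMap z =
      auxConj k A comul (z * y) := by
  let i₁ : A →ₐ[k] A ⊗[k] A := Algebra.TensorProduct.includeLeft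
  let i₂ : A →ₐ[k] A ⊗[k] A := Algebra.TensorProduct.includeRight
  have h1 : (toConv ((auxRight k A).toLinearMap ∘ₗ i₁.toLinearMap) : WithConv (A →ₗ[k] Aux k A)) *
      convConst k A (auxLeft k A z) = convConst k A (auxLeft k A z) *
        toConv ((auxRight k A).toLinearMap ∘ₗ i₁.toLinearMap) := by
    apply WithConv.ext
    ext1 a
    change (_ * _ : WithConv (A →ₗ[k] Aux k A)) a = (_ * _ : WithConv (A →ₗ[k] Aux k A)) a
    rw [mul_convConst_apply, convConst_mul_apply]
    exact auxLeft_mul_comm _ _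
  have h2 : convConst k A (auxLeft k A y) * convConst k A (auxLeft k A z) =
      convConst k A (auxLeft k A (z * y)) := by
    apply WithConv.ext
    ext1 a
    change (_ * _ : WithConv (A →ₗ[k] Aux k A)) a = _
    rw [mul_convConst_apply, ← auxLeft_mul]
    exact smul_mul_assoc ..
  have h3 : (toConv ((auxRight k A).toLinearMap ∘ₗ i₁.toLinearMap) : WithConv (A →ₗ[k] Aux k A)) *
      toConv ((auxRight k A).toLinearMap ∘ₗ i₂.toLinearMap) =
        toConv ((auxRight k A).toLinearMap ∘ₗ comul) := by
    apply WithConv.ext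
    ext1 a
    change (_ * _ : WithConv (A →ₗ[k] Aux k A)) a = auxRight k A (comul a)
    rw [(ℛ k a).convMul_apply, ← (ℛ k a).eq, map_sum]
    refine Finset.sum_congr rfl fun i _ => ?_
    change auxRight k A (i₁ _) * auxRight k A (i₂ _) = _
    rw [← map_mul]
    simp [i₁, i₂]
  rw [auxConj_eq, auxConj_eq, auxConj_eq, ← h2, ← h3]
  exact mul_cancel_middle (M := WithConv (A →ₗ[k] Aux k A)) auxLeft_antipodeInv_mul h1

variable (k A) in
/-- `auxConj` before the application of the coproduct. -/
def auxTriple (φ : A →ₗ[k] A ⊗[k] A) (y : A) : A ⊗[k] (A ⊗[k] A) →ₗ[k] Aux k A :=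
  LinearMap.mul' k (Aux k A) ∘ₗ TensorProduct.map
    (LinearMap.mulRight k (auxLeft k A y) ∘ₗ auxLeft k A)
    (LinearMap.mul' k (Aux k A) ∘ₗ TensorProduct.map ((auxRight k A).toLinearMap ∘ₗ φ)
      (auxLeft k A ∘ₗ antipodeInv k A))

theorem auxConj_apply (φ : A →ₗ[k] A ⊗[k] A) (y a : A) : auxConj k A φ y a =
    auxTriple k A φ y ((comul (R := k)).lTensor A (comul a)) := conv₃_apply _ _ _ _

theorem auxTriple_tmul (φ : A →ₗ[k] A ⊗[k] A) (y a b c : A) :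
    auxTriple k A φ y (a ⊗ₜ (b ⊗ₜ c)) =
      auxLeft k A (antipodeInv k A c * y * a) * auxRight k A (φ b) := by
  rw [← aux_triple]
  simp [auxTriple]

variable [Module.Finite k A]

variable (k A) in
/-- `(x ⊗ y ⊗ z, f) ↦ f(S⁻¹(z) ? x) ⊗ y`. -/
def twist : A ⊗[k] (A ⊗[k] A) →ₗ[k] DualCop k A →ₗ[k] DrinfeldDouble k A :=
  (LinearMap.lcomp k (DualCop k A ⊗[k] A) ((TensorProduct.mk k (DualCop k A) A).flip 1)).comp
    (action₃ k A).toLinearMap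

theorem incl_mul_inclDual' (a : A) (f : DualCop k A) : incl k A a * inclDual k A f =
    twist k A ((comul (R := k)).lTensor A (comul a)) f := incl_mul_inclDual a f

theorem evalAt_twist (y a b c : A) (f : DualCop k A) :
    evalAt y (twist k A (a ⊗ₜ (b ⊗ₜ c)) f) = f (antipodeInv k A c * y * a) • b := by
  change f (antipodeInv k A c * (y * a)) • (b * 1) = _
  rw [mul_assoc, mul_one]

theorem comul_evalAt_straighten (y a : A) (g : DualCop k A) :
    comul (R := k) (evalAt y (straighten k A a (g ⊗ₜ 1))) = auxEval g (auxConj k A comul y a) := by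
  rw [auxConj_apply, straighten_apply]
  refine LinearMap.congr_fun (f := comul ∘ₗ evalAt y ∘ₗ (LinearMap.applyₗ (g ⊗ₜ[k] (1 : A))) ∘ₗ
    (action₃ k A).toLinearMap) (g := auxEval g ∘ₗ auxTriple k A comul y) ?_ _
  refine TensorProduct.ext_threefold' fun b c d => ?_
  change comul (R := k) (evalAt y (action₃ k A (b ⊗ₜ (c ⊗ₜ d)) (g ⊗ₜ 1))) =
    auxEval g (auxTriple k A comul y (b ⊗ₜ (c ⊗ₜ d)))
  rw [auxTriple_tmul, auxEval_apply, action₃_tmul, mul_one]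
  refine (congrArg _ (evalAt_tmul ..)).trans ?_
  rw [map_smul, rightTranslation_apply, leftTranslation_apply, mul_assoc]

theorem evalAt_straighten_tmul (y z a b : A) (s : DualCop k A ⊗[k] DualCop k A)
    (g : DualCop k A) (hs : ∀ c d, DualCop.pairing k A s (c ⊗ₜ d) = g (d * c)) :
    TensorProduct.map (evalAt y) (evalAt z) ((incl k A a ⊗ₜ[k] incl k A b) *
      Algebra.TensorProduct.map (inclDual k A) (inclDual k A) s) = auxEval g
        (auxConj k A (Algebra.TensorProduct.includeLeft : A →ₐ[k] A ⊗[k] A).toLinearMap y a *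
        auxConj k A (Algebra.TensorProduct.includeRight : A →ₐ[k] A ⊗[k] A).toLinearMap z b) := by
  have h1 : (incl k A a ⊗ₜ[k] incl k A b) *
      Algebra.TensorProduct.map (inclDual k A) (inclDual k A) s =
      TensorProduct.map (twist k A ((comul (R := k)).lTensor A (comul a)))
        (twist k A ((comul (R := k)).lTensor A (comul b))) s := by
    refine LinearMap.congr_fun (f := LinearMap.mulLeft k (incl k A a ⊗ₜ[k] incl k A b) ∘ₗ
      (Algebra.TensorProduct.map (inclDual k A) (inclDual k A)).toLinearMap)
      (TensorProduct.ext' fun f f' => ?_) s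
    change (incl k A a ⊗ₜ[k] incl k A b) * (inclDual k A f ⊗ₜ[k] inclDual k A f') = _
    rw [Algebra.TensorProduct.tmul_mul_tmul, incl_mul_inclDual', incl_mul_inclDual',
      TensorProduct.map_tmul]
  have h2 : ∀ b c d b' c' d' : A, TensorProduct.map
      (evalAt y ∘ₗ twist k A (b ⊗ₜ (c ⊗ₜ d))) (evalAt z ∘ₗ twist k A (b' ⊗ₜ (c' ⊗ₜ d'))) s =
      DualCop.pairing k A s ((antipodeInv k A d * y * b) ⊗ₜ (antipodeInv k A d' * z * b')) •
        (c ⊗ₜ[k] c') := by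
    intro b c d b' c' d'
    refine LinearMap.congr_fun (g := (LinearMap.toSpanSingleton k _ (c ⊗ₜ[k] c')) ∘ₗ
      (LinearMap.applyₗ ((antipodeInv k A d * y * b) ⊗ₜ[k] (antipodeInv k A d' * z * b'))) ∘ₗ
        (DualCop.pairing k A).toLinearMap) (TensorProduct.ext' fun f f' => ?_) s
    rw [TensorProduct.map_tmul, LinearMap.comp_apply, LinearMap.comp_apply, evalAt_twist,
      evalAt_twist, TensorProduct.smul_tmul_smul]
    rfl
  have h3 : ∀ t u : A ⊗[k] (A ⊗[k] A), TensorProduct.map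
      (evalAt y ∘ₗ twist k A t) (evalAt z ∘ₗ twist k A u) s = auxEval g
        (auxTriple k A (Algebra.TensorProduct.includeLeft : A →ₐ[k] A ⊗[k] A).toLinearMap y t *
        auxTriple k A (Algebra.TensorProduct.includeRight : A →ₐ[k] A ⊗[k] A).toLinearMap z u) := by
    intro t u
    induction t with
    | zero => simp
    | add t t' ht ht' =>
      simp only [map_add, LinearMap.comp_add, TensorProduct.map_add_left,
        LinearMap.add_apply, add_mul, ht, ht']
    | tmul b t =>
      induction t with
      | zero => simp
      | add t t' ht ht' =>
        simp only [TensorProduct.tmul_add, map_add, LinearMap.comp_add,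
          TensorProduct.map_add_left, LinearMap.add_apply, add_mul, ht, ht']
      | tmul c d =>
        induction u with
        | zero => simp
        | add u u' hu hu' =>
          simp only [map_add, LinearMap.comp_add, TensorProduct.map_add_right,
            LinearMap.add_apply, mul_add, hu, hu']
        | tmul b' u =>
          induction u with
          | zero => simp
          | add u u' hu hu' =>
            simp only [TensorProduct.tmul_add, map_add, LinearMap.comp_add,
              TensorProduct.map_add_right, LinearMap.add_apply, mul_add, hu, hu']
          | tmul c' d' =>
            rw [h2, hs, auxTriple_tmul, auxTriple_tmul]
            have e : ∀ (v w : A) (p r : A ⊗[k] A), auxLeft k A v * auxRight k A p *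
                (auxLeft k A w * auxRight k A r) = auxLeft k A (w * v) * auxRight k A (p * r) := by
              intro v w p r
              rw [mul_assoc, ← mul_assoc (auxRight k A p), auxLeft_mul_comm,
                map_mul (auxRight k A), ← auxLeft_mul]
              simp only [mul_assoc]
            rw [e, auxEval_apply]
            simp
  rw [h1, auxConj_apply, auxConj_apply, ← h3, TensorProduct.map_comp]
  rfl

theorem comul_incl_mul_inclDual (a : A) (g : DualCop k A) :
    comul (R := k) (incl k A a * inclDual k A g) =
      comul (R := k) (incl k A a) * comul (R := k) (inclDual k A g) := by
  refine map_evalAt_injective fun y z => ?_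
  rw [map_evalAt_comul, incl_mul_inclDual, comul_evalAt_straighten, ← auxConj_mul_auxConj,
    (ℛ k a).convMul_apply, comul_incl, comul_inclDual, ← (ℛ k a).eq, map_sum, map_sum,
    Finset.sum_mul, map_sum]
  refine Finset.sum_congr rfl fun i _ => ?_
  exact (evalAt_straighten_tmul y z _ _ _ g (DualCop.pairing_comul g)).symm

theorem map_mul_of_incl {E : Type*} [Ring E] [Algebra k E] (φ : DrinfeldDouble k A →ₗ[k] E)
    (h1 : ∀ f a, φ (inclDual k A f * incl k A a) = φ (inclDual k A f) * φ (incl k A a))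
    (hU : ∀ f g, φ (inclDual k A (f * g)) = φ (inclDual k A f) * φ (inclDual k A g))
    (hA : ∀ a b, φ (incl k A (a * b)) = φ (incl k A a) * φ (incl k A b))
    (h2 : ∀ a f, φ (incl k A a * inclDual k A f) = φ (incl k A a) * φ (inclDual k A f))
    (v w : DrinfeldDouble k A) : φ (v * w) = φ v * φ w := by
  have h3 : ∀ f w, φ (inclDual k A f * w) = φ (inclDual k A f) * φ w := by
    intro f w
    refine LinearMap.congr_fun (f := φ ∘ₗ LinearMap.mulLeft k (inclDual k A f))
      (g := LinearMap.mulLeft k (φ (inclDual k A f)) ∘ₗ φ) (TensorProduct.ext' fun g b => ?_) w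
    change φ (inclDual k A f * tmul g b) = φ (inclDual k A f) * φ (tmul g b)
    rw [tmul_eq_mul, ← mul_assoc, ← map_mul, h1, h1, hU, mul_assoc]
  have h4 : ∀ w a, φ (w * incl k A a) = φ w * φ (incl k A a) := by
    intro w a
    refine LinearMap.congr_fun (f := φ ∘ₗ LinearMap.mulRight k (incl k A a))
      (g := LinearMap.mulRight k (φ (incl k A a)) ∘ₗ φ) (TensorProduct.ext' fun g b => ?_) w
    change φ (tmul g b * incl k A a) = φ (tmul g b) * φ (incl k A a)
    rw [tmul_eq_mul, mul_assoc, ← map_mul, h1, h1, hA, mul_assoc]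
  have h5 : ∀ (f : DualCop k A) (a : A) (g : DualCop k A) (b : A),
      φ (tmul f a * tmul g b) = φ (tmul f a) * φ (tmul g b) := by
    intro f a g b
    rw [tmul_eq_mul, tmul_eq_mul, mul_assoc, ← mul_assoc (incl k A a), h3, h4, h2, h1, h1]
    simp only [mul_assoc]
  refine LinearMap.congr_fun₂ (f := (LinearMap.mul k (DrinfeldDouble k A)).compr₂ φ)
    (g := (LinearMap.mul k E).compl₁₂ φ φ)
    (TensorProduct.ext' fun f a => TensorProduct.ext' fun g b => ?_) v w
  exact h5 f a g b

theorem comul_mul' (v w : DrinfeldDouble k A) :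
    comul (R := k) (v * w) = comul (R := k) v * comul (R := k) w := by
  have h1 : ∀ f a, comul (R := k) (inclDual k A f * incl k A a) =
      comul (R := k) (inclDual k A f) * comul (R := k) (incl k A a) := by
    intro f a
    rw [← tmul_eq_mul, comul_tmul, comul_inclDual, comul_incl]
  have hU : ∀ f g, comul (R := k) (inclDual k A (f * g)) =
      comul (R := k) (inclDual k A f) * comul (R := k) (inclDual k A g) := by
    intro f g
    rw [comul_inclDual, Bialgebra.comul_mul, map_mul, comul_inclDual, comul_inclDual]
  have hA : ∀ a b, comul (R := k) (incl k A (a * b)) =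
      comul (R := k) (incl k A a) * comul (R := k) (incl k A b) := by
    intro a b
    rw [comul_incl, Bialgebra.comul_mul, map_mul, comul_incl, comul_incl]
  exact map_mul_of_incl comul h1 hU hA comul_incl_mul_inclDual v w

theorem counit_tmul (f : DualCop k A) (a : A) :
    counit (R := k) (tmul f a) = f 1 * counit (R := k) a := by
  change counit (R := k) (f ⊗ₜ[k] a) = _
  rw [TensorProduct.counit_tmul, DualCop.counit_apply, smul_eq_mul, mul_comm]

theorem counit_inclDual (f : DualCop k A) : counit (R := k) (inclDual k A f) = f 1 :=
  (counit_tmul f 1).trans (by rw [Bialgebra.counit_one, mul_one])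

theorem counit_incl (a : A) : counit (R := k) (incl k A a) = counit (R := k) a :=
  (counit_tmul 1 a).trans (by rw [DualCop.one_apply, Bialgebra.counit_one, one_mul])

theorem counit_incl_mul_inclDual (a : A) (g : DualCop k A) :
    counit (R := k) (incl k A a * inclDual k A g) =
      counit (R := k) (incl k A a) * counit (R := k) (inclDual k A g) := by
  let p : A ⊗[k] A →ₗ[k] A := (TensorProduct.lid k A).toLinearMap ∘ₗ counit.rTensor A
  let μ : A ⊗[k] A →ₗ[k] A := LinearMap.mul' k A ∘ₗ (TensorProduct.comm k A A).toLinearMap ∘ₗ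
    (antipodeInv k A).lTensor A
  have h1 : ∀ t, counit (R := k) (twist k A t g) = g (μ (p.lTensor A t)) := by
    intro t
    refine LinearMap.congr_fun (f := counit ∘ₗ (twist k A).flip g)
      (g := DualCop.toDual k A g ∘ₗ μ ∘ₗ p.lTensor A) ?_ t
    refine TensorProduct.ext_threefold' fun b c d => ?_
    refine (counit_tmul _ _).trans ?_
    change g (antipodeInv k A d * (1 * b)) * counit (R := k) (c * 1) =
      g (antipodeInv k A (counit (R := k) c • d) * b)
    rw [mul_one, one_mul, map_smul, smul_mul_assoc, map_smul, smul_eq_mul, mul_comm]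
  have h2 : p.lTensor A ((comul (R := k)).lTensor A (comul (R := k) a)) = comul (R := k) a := by
    rw [← LinearMap.comp_apply, ← LinearMap.lTensor_comp]
    convert LinearMap.lTensor_id_apply A A (comul (R := k) a)
    ext b
    simp [p]
  have h3 : μ (comul (R := k) a) = algebraMap k A (counit (R := k) a) := by
    rw [← sum_antipodeInv_right_mul_left k (ℛ k a)]
    conv_lhs => rw [← (ℛ k a).eq]
    simp [μ]
  rw [incl_mul_inclDual', h1, h2, h3, Algebra.algebraMap_eq_smul_one, map_smul, smul_eq_mul,
    counit_incl, counit_inclDual]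

theorem counit_mul' (v w : DrinfeldDouble k A) :
    counit (R := k) (v * w) = counit (R := k) v * counit (R := k) w := by
  have h1 : ∀ f a, counit (R := k) (inclDual k A f * incl k A a) =
      counit (R := k) (inclDual k A f) * counit (R := k) (incl k A a) := by
    intro f a
    rw [← tmul_eq_mul, counit_tmul, counit_inclDual, counit_incl]
  have hU : ∀ f g, counit (R := k) (inclDual k A (f * g)) =
      counit (R := k) (inclDual k A f) * counit (R := k) (inclDual k A g) := by
    intro f g
    rw [counit_inclDual, ← DualCop.counit_apply, Bialgebra.counit_mul, counit_inclDual,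
      counit_inclDual, DualCop.counit_apply, DualCop.counit_apply]
  have hA : ∀ a b, counit (R := k) (incl k A (a * b)) =
      counit (R := k) (incl k A a) * counit (R := k) (incl k A b) := by
    intro a b
    rw [counit_incl, counit_incl, counit_incl, Bialgebra.counit_mul]
  exact map_mul_of_incl counit h1 hU hA counit_incl_mul_inclDual v w

instance : Bialgebra k (DrinfeldDouble k A) :=
  Bialgebra.mk' k (DrinfeldDouble k A)
    ((counit_tmul 1 1).trans (by simp))
    (fun {v w} => counit_mul' v w)
    ((comul_inclDual 1).trans (by rw [Bialgebra.comul_one, map_one]))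
    (fun {v w} => comul_mul' v w)

end DrinfeldComul

end DrinfeldDouble

section DoubleHopf

open Coalgebra LinearMap HopfAlgebra

variable {k : Type*} {A : Type*} [Field k] [Ring A] [HopfAlgebra k A] [HasBijectiveAntipode k A]

namespace DualCop

variable (k A) in
/-- The antipode `f ↦ f ∘ S⁻¹` of `(A^*)^cop`. -/
def antipodeMap : DualCop k A →ₗ[k] DualCop k A :=
  (toDual k A).symm.toLinearMap ∘ₗ (antipodeInv k A).dualMap ∘ₗ (toDual k A).toLinearMap

theorem antipodeMap_apply (f : DualCop k A) (a : A) :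
    antipodeMap k A f a = f (antipodeInv k A a) := rfl

variable [Module.Finite k A]

instance : HopfAlgebra k (DualCop k A) where
  antipode := antipodeMap k A
  mul_antipode_rTensor_comul := by
    ext f a
    have h : ∀ s : DualCop k A ⊗[k] DualCop k A,
        (LinearMap.mul' k (DualCop k A) ((antipodeMap k A).rTensor _ s)) a =
        ∑ i ∈ (ℛ k a).index,
          pairing k A s (antipodeInv k A ((ℛ k a).left i) ⊗ₜ (ℛ k a).right i) := by
      intro s
      induction s with
      | zero => simp
      | add s t hs ht => simp only [map_add, LinearMap.add_apply, hs, ht, Finset.sum_add_distrib]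
      | tmul f g => simp [mul_apply (antipodeMap k A f) g (ℛ k a), antipodeMap_apply]
    refine (h (comul f)).trans ?_
    simp only [pairing_comul, ← map_sum]
    rw [sum_right_mul_antipodeInv_left]
    simp [Algebra.algebraMap_eq_smul_one, counit_apply, mul_comm]
  mul_antipode_lTensor_comul := by
    ext f a
    have h : ∀ s : DualCop k A ⊗[k] DualCop k A,
        (LinearMap.mul' k (DualCop k A) ((antipodeMap k A).lTensor _ s)) a =
        ∑ i ∈ (ℛ k a).index,
          pairing k A s ((ℛ k a).left i ⊗ₜ antipodeInv k A ((ℛ k a).right i)) := by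
      intro s
      induction s with
      | zero => simp
      | add s t hs ht => simp only [map_add, LinearMap.add_apply, hs, ht, Finset.sum_add_distrib]
      | tmul f g => simp [mul_apply f (antipodeMap k A g) (ℛ k a), antipodeMap_apply]
    refine (h (comul f)).trans ?_
    simp only [pairing_comul, ← map_sum]
    rw [sum_antipodeInv_right_mul_left]
    simp [Algebra.algebraMap_eq_smul_one, counit_apply, mul_comm]

end DualCop

namespace DrinfeldDouble

variable [Module.Finite k A]

variable (k A) in
/-- The antipode `f ⊗ a ↦ S(a) S(f)` of the Drinfeld double. -/
def antipodeMap : DrinfeldDouble k A →ₗ[k] DrinfeldDouble k A :=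
  TensorProduct.lift ((LinearMap.mul k (DrinfeldDouble k A)).flip.compl₁₂
    ((inclDual k A).toLinearMap ∘ₗ antipode k) ((incl k A).toLinearMap ∘ₗ antipode k))

theorem antipodeMap_tmul (f : DualCop k A) (a : A) : antipodeMap k A (tmul f a) =
    incl k A (antipode k a) * inclDual k A (antipode k f) := rfl

theorem comul_tmul_eq_sum (f : DualCop k A) (a : A) : comul (R := k) (tmul f a) =
    ∑ j ∈ (ℛ k a).index, ∑ i ∈ (ℛ k f).index, tmul ((ℛ k f).left i) ((ℛ k a).left j) ⊗ₜ
      tmul ((ℛ k f).right i) ((ℛ k a).right j) := by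
  rw [comul_tmul_eq_shuffle]
  conv_lhs => rw [← (ℛ k a).eq, ← (ℛ k f).eq]
  rw [TensorProduct.tmul_sum, map_sum]
  refine Finset.sum_congr rfl fun j _ => ?_
  rw [TensorProduct.sum_tmul, map_sum]
  rfl

instance : HopfAlgebra k (DrinfeldDouble k A) where
  antipode := antipodeMap k A
  mul_antipode_rTensor_comul := by
    refine TensorProduct.ext' fun f a => ?_
    change LinearMap.mul' k _ ((antipodeMap k A).rTensor _ (comul (R := k) (tmul f a))) =
      algebraMap k _ (counit (R := k) (tmul f a))
    have h : ∀ j, ∑ i ∈ (ℛ k f).index, antipodeMap k A (tmul ((ℛ k f).left i) ((ℛ k a).left j)) *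
        tmul ((ℛ k f).right i) ((ℛ k a).right j) = counit (R := k) f •
          incl k A (antipode k ((ℛ k a).left j) * (ℛ k a).right j) := by
      intro j
      have e : ∀ i, antipodeMap k A (tmul ((ℛ k f).left i) ((ℛ k a).left j)) *
          tmul ((ℛ k f).right i) ((ℛ k a).right j) = incl k A (antipode k ((ℛ k a).left j)) *
            inclDual k A (antipode k ((ℛ k f).left i) * (ℛ k f).right i) *
            incl k A ((ℛ k a).right j) := by
        intro i
        rw [antipodeMap_tmul, tmul_eq_mul, map_mul]
        simp only [mul_assoc]
      simp only [e]
      rw [← Finset.sum_mul, ← Finset.mul_sum, ← map_sum,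
        sum_antipode_mul_eq_algebraMap_counit (ℛ k f), AlgHom.commutes, ← Algebra.commutes,
        mul_assoc, ← map_mul, ← Algebra.smul_def]
    rw [comul_tmul_eq_sum, map_sum, map_sum]
    simp only [map_sum, LinearMap.rTensor_tmul, LinearMap.mul'_apply, h]
    rw [← Finset.smul_sum, ← map_sum, sum_antipode_mul_eq_algebraMap_counit (ℛ k a),
      AlgHom.commutes, counit_tmul, DualCop.counit_apply, map_mul, Algebra.smul_def]
  mul_antipode_lTensor_comul := by
    refine TensorProduct.ext' fun f a => ?_
    change LinearMap.mul' k _ ((antipodeMap k A).lTensor _ (comul (R := k) (tmul f a))) =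
      algebraMap k _ (counit (R := k) (tmul f a))
    have h : ∀ i, ∑ j ∈ (ℛ k a).index, tmul ((ℛ k f).left i) ((ℛ k a).left j) *
        antipodeMap k A (tmul ((ℛ k f).right i) ((ℛ k a).right j)) = counit (R := k) a •
          inclDual k A ((ℛ k f).left i * antipode k ((ℛ k f).right i)) := by
      intro i
      have e : ∀ j, tmul ((ℛ k f).left i) ((ℛ k a).left j) *
          antipodeMap k A (tmul ((ℛ k f).right i) ((ℛ k a).right j)) =
            inclDual k A ((ℛ k f).left i) * incl k A ((ℛ k a).left j *
              antipode k ((ℛ k a).right j)) * inclDual k A (antipode k ((ℛ k f).right i)) := by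
        intro j
        rw [antipodeMap_tmul, tmul_eq_mul, map_mul]
        simp only [mul_assoc]
      simp only [e]
      rw [← Finset.sum_mul, ← Finset.mul_sum, ← map_sum,
        sum_mul_antipode_eq_algebraMap_counit (ℛ k a), AlgHom.commutes, ← Algebra.commutes,
        mul_assoc, ← map_mul, ← Algebra.smul_def]
    rw [comul_tmul_eq_sum, Finset.sum_comm, map_sum, map_sum]
    simp only [map_sum, LinearMap.lTensor_tmul, LinearMap.mul'_apply, h]
    rw [← Finset.smul_sum, ← map_sum, sum_mul_antipode_eq_algebraMap_counit (ℛ k f),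
      AlgHom.commutes, counit_tmul, DualCop.counit_apply, map_mul, Algebra.smul_def,
      Algebra.commutes]

end DrinfeldDouble

end DoubleHopf

end TaftDouble

end

/-! The invariants are read off on the dual side. A character of a Hopf algebra `A` is a group-like
element of its dual, and a linear form with `D (a b) = γ a * D b + D a * ε b` is a skew-primitive
element of the dual attached to the character `γ`. Such a form is determined by its values on
generators, and it exists as soon as there is an upper triangular 2×2 representation with diagonal
`γ`, `ε`. Hence the classification of the algebras `T^σ` needs no basis of them.

For `T^σ` there are two basic forms `D₁` and `D₂`, dual to `x` and `X`. The relations force their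
characters to take the values `(q⁻¹, σ⁻¹)` and `(σ, qb⁻¹)` at `(h, H)`. Over a nontrivial character
`γ`, every form is a combination of `γ - ε` and of those among `D₁`, `D₂` whose character is `γ`. An
isomorphism sends `x` and `X` to skew-primitive elements on which the transported forms do not
vanish. Comparing left and right translation by characters shows that, as far as characters can see,
the pair `h, H` goes either to `h, H` or to `H, h` (`TBicrossed.groupLike_cases`). Evaluating the
transported character of `D₁` gives `σ = σ'` in the first case, and `qb = q`, `σ' = σ⁻¹` in the
second (`TBicrossed.eq_or_of_bialgEquiv`). When the two roots agree, the second case is realised by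
exchanging the two Taft algebras.

Rescaling `x` normalises the parameter `α` of `Q`. For the double, the character `h ↦ q⁻¹` of the
Taft algebra and the form `D` with `D h = 0`, `D x = 1` generate the dual, because their monomials
pair with the monomials in `h` and `x` through Vandermonde blocks
(`TaftAlgebra.eq_zero_of_pairing`). After a rescaling of `D` they satisfy, together with `h` and
`x`, the relations of `Q` with parameter 1 (`DrinfeldDouble.isPair`), so `Q` maps onto the double.
The bound `n⁴` on the dimension of `Q`, from `PairAlgebra.mulMap_surjective`, turns this surjection
into an isomorphism.

Finally `Q` and `T^σ` differ in their number of characters: the relation linking `x` and `X` forces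
`γ(H) γ(h) = 1`, which leaves at most `n` characters for `Q`, while `T^σ` with both orders equal to
`n` has at least `n²`. -/

noncomputable section

namespace TaftDouble

/-! ### Skew derivations, the skew-primitive elements of the dual -/

section SkewDerivations

variable {k A : Type*} [Field k] [Ring A] [Algebra k A]

/-- The linear form `D` satisfies `D(x y) = a(x) D(y) + D(x) b(y)`. -/
structure IsSkewDerivation (a b : A →ₐ[k] k) (D : A →ₗ[k] k) : Prop where
  map_mul : ∀ x y, D (x * y) = a x * D y + D x * b y

namespace IsSkewDerivation

variable {a b : A →ₐ[k] k} {D E : A →ₗ[k] k}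

theorem map_one (h : IsSkewDerivation a b D) : D 1 = 0 := by
  simpa using h.map_mul 1 1

theorem sub (h : IsSkewDerivation a b D) (h' : IsSkewDerivation a b E) :
    IsSkewDerivation a b (D - E) where
  map_mul x y := by simp only [LinearMap.sub_apply, h.map_mul, h'.map_mul]; ring

theorem smul (c : k) (h : IsSkewDerivation a b D) : IsSkewDerivation a b (c • D) where
  map_mul x y := by simp only [LinearMap.smul_apply, smul_eq_mul, h.map_mul]; ring

/-- The inner solution, available over every pair of characters; it plays the role of a coboundary.
-/
theorem sub_algHom (a b : A →ₐ[k] k) :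
    IsSkewDerivation a b (a.toLinearMap - b.toLinearMap) where
  map_mul x y := by simp; ring

theorem comp {B : Type*} [Ring B] [Algebra k B] (h : IsSkewDerivation a b D) (φ : B →ₐ[k] A) :
    IsSkewDerivation (a.comp φ) (b.comp φ) (D ∘ₗ φ.toLinearMap) where
  map_mul x y := by simp [h.map_mul]

/-- The Leibniz rule propagates vanishing through products, and `D 1 = 0` handles constants.
Identities between skew derivations are proved below by applying this to a difference. -/
theorem eq_zero (h : IsSkewDerivation a b D) {s : Set A} (hs : Algebra.adjoin k s = ⊤)
    (h0 : ∀ x ∈ s, D x = 0) : D = 0 := by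
  ext x
  have hx : x ∈ Algebra.adjoin k s := hs ▸ Algebra.mem_top
  induction hx using Algebra.adjoin_induction with
  | mem x hx => exact h0 x hx
  | algebraMap r => rw [Algebra.algebraMap_eq_smul_one, map_smul, h.map_one]; simp
  | add x y _ _ hx hy => rw [map_add, hx, hy]; simp
  | mul x y _ _ hx hy => rw [h.map_mul, hx, hy]; simp

/-- The corner of an upper triangular representation is a skew derivation. -/
theorem exists_of_matrix (ρ : A →ₐ[k] Matrix (Fin 2) (Fin 2) k) {s : Set A}
    (hs : Algebra.adjoin k s = ⊤) (h10 : ∀ x ∈ s, ρ x 1 0 = 0) (h00 : ∀ x ∈ s, ρ x 0 0 = a x)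
    (h11 : ∀ x ∈ s, ρ x 1 1 = b x) :
    ∃ D : A →ₗ[k] k, IsSkewDerivation a b D ∧ ∀ x, D x = ρ x 0 1 := by
  -- Upper triangular matrices are closed under products and their diagonals multiply entrywise, so
  -- generators suffice. The upper right entry of a product is then the skew Leibniz rule itself.
  have key : ∀ x, ρ x 1 0 = 0 ∧ ρ x 0 0 = a x ∧ ρ x 1 1 = b x := by
    intro x
    have hx : x ∈ Algebra.adjoin k s := hs ▸ Algebra.mem_top
    induction hx using Algebra.adjoin_induction with
    | mem x hx => exact ⟨h10 x hx, h00 x hx, h11 x hx⟩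
    | algebraMap r =>
      simp only [AlgHom.commutes, Matrix.algebraMap_matrix_apply]
      simp
    | add x y _ _ hx hy => simp [hx, hy]
    | mul x y _ _ hx hy => simp [Matrix.mul_apply, hx, hy]
  refine ⟨Matrix.entryLinearMap k k 0 1 ∘ₗ ρ.toLinearMap, ⟨fun x y => ?_⟩, fun x => rfl⟩
  simp [Matrix.mul_apply, key]

end IsSkewDerivation

end SkewDerivations

/-! ### Translations by characters -/

section Translations

open Coalgebra

variable {k A : Type*} [Field k] [Ring A] [Bialgebra k A] (γ : A →ₐ[k] k)

/-- Translation by a character: `a ↦ a₍₁₎ γ(a₍₂₎)`. -/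
def translateRight : A →ₐ[k] A :=
  (Algebra.TensorProduct.lift (AlgHom.id k _) ((Algebra.ofId k _).comp γ)
    (fun _ _ => (Algebra.commutes _ _).symm)).comp (Bialgebra.comulAlgHom k _)

/-- Translation by a character: `a ↦ γ(a₍₁₎) a₍₂₎`. -/
def translateLeft : A →ₐ[k] A :=
  (Algebra.TensorProduct.lift ((Algebra.ofId k _).comp γ) (AlgHom.id k _)
    (fun _ _ => Algebra.commutes _ _)).comp (Bialgebra.comulAlgHom k _)

theorem translateRight_apply {ι : Type*} {a : A}
    {s : Finset ι} {b c : ι → A} (h : comul (R := k) a = ∑ i ∈ s, b i ⊗ₜ c i) :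
    translateRight γ a = ∑ i ∈ s, γ (c i) • b i := by
  rw [translateRight, AlgHom.comp_apply, Bialgebra.comulAlgHom_apply, h, map_sum]
  refine Finset.sum_congr rfl fun i _ => ?_
  refine (Algebra.TensorProduct.lift_tmul ..).trans ?_
  rw [Algebra.smul_def, Algebra.commutes]
  rfl

theorem translateLeft_apply {ι : Type*} {a : A}
    {s : Finset ι} {b c : ι → A} (h : comul (R := k) a = ∑ i ∈ s, b i ⊗ₜ c i) :
    translateLeft γ a = ∑ i ∈ s, γ (b i) • c i := by
  rw [translateLeft, AlgHom.comp_apply, Bialgebra.comulAlgHom_apply, h, map_sum]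
  refine Finset.sum_congr rfl fun i _ => ?_
  refine (Algebra.TensorProduct.lift_tmul ..).trans ?_
  rw [Algebra.smul_def]
  rfl

/-- In `y ⊗ g + 1 ⊗ y` with `γ y = 0`, right translation sees the group-like `g` and left
translation does not. This asymmetry lets characters detect over which group-like a skew-primitive
element lives. -/
theorem translateRight_skew {y g : A}
    (hy : comul (R := k) y = y ⊗ₜ g + 1 ⊗ₜ y) (h0 : γ y = 0) : translateRight γ y = γ g • y := by
  rw [translateRight_apply γ (s := Finset.univ) (b := ![y, 1]) (c := ![g, y]) (by simpa using hy)]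
  simp [h0]

theorem translateLeft_skew {y g : A}
    (hy : comul (R := k) y = y ⊗ₜ g + 1 ⊗ₜ y) (h0 : γ y = 0) : translateLeft γ y = y := by
  rw [translateLeft_apply γ (s := Finset.univ) (b := ![y, 1]) (c := ![g, y]) (by simpa using hy)]
  simp [h0]

theorem translateRight_groupLike {g : A}
    (hg : comul (R := k) g = g ⊗ₜ g) : translateRight γ g = γ g • g := by
  rw [translateRight_apply γ (s := {()}) (b := fun _ => g) (c := fun _ => g) (by simpa using hg)]
  simp

theorem translateLeft_groupLike {g : A}
    (hg : comul (R := k) g = g ⊗ₜ g) : translateLeft γ g = γ g • g := by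
  rw [translateLeft_apply γ (s := {()}) (b := fun _ => g) (c := fun _ => g) (by simpa using hg)]
  simp

end Translations

/-! ### Characters and basic skew derivations of the four-generator algebras -/

section Characters

open PairAlgebra Coalgebra

variable {k : Type*} [Field k] {m n : ℕ} {q qb : k} (hqb : qb ∈ primitiveRoots n k)
  (hq : q ∈ primitiveRoots m k)

section General

variable {hqb hq} {σ α : k} (γ : PairAlgebra hqb hq σ α →ₐ[k] k)

theorem PairAlgebra.algHom_x : γ (gen hqb hq σ α .x) = 0 := by
  have h := congrArg γ (isPair hqb hq σ α).x_pow
  rw [map_pow, map_zero] at h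
  exact eq_zero_of_pow_eq_zero h

theorem PairAlgebra.algHom_X : γ (gen hqb hq σ α .X) = 0 := by
  have h := congrArg γ (isPair hqb hq σ α).X_pow
  rw [map_pow, map_zero] at h
  exact eq_zero_of_pow_eq_zero h

theorem PairAlgebra.algHom_h_pow : γ (gen hqb hq σ α .h) ^ m = 1 := by
  rw [← map_pow, (isPair hqb hq σ α).h_pow, map_one]

/-- A character kills the nilpotents `x` and `X`, so the linking relation collapses to `α (1 - γ(H)
γ(h)) = 0`. -/
theorem PairAlgebra.algHom_H_mul_h (hα : α ≠ 0) :
    γ (gen hqb hq σ α .H) * γ (gen hqb hq σ α .h) = 1 := by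
  have h := congrArg γ (isPair hqb hq σ α).x_X
  simp only [map_mul, map_add, map_smul, map_sub, map_one, algHom_x γ, algHom_X γ, mul_zero,
    zero_add, smul_eq_mul] at h
  exact (sub_eq_zero.1 ((mul_eq_zero.1 h.symm).resolve_left hα)).symm

/-- The two sides are the convolution products of `δ` and `γ` in opposite orders. Characters live on
the group-likes `h`, `H`, so these products commute. This puts the composites of a skew derivation
with left and with right translation over the same pair of characters. -/
theorem PairAlgebra.comp_translateLeft_eq (δ : PairAlgebra hqb hq σ α →ₐ[k] k) :
    δ.comp (translateLeft γ) = δ.comp (translateRight γ) := by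
  refine algHom_ext ?_
  rintro (_ | _ | _ | _) <;> simp only [AlgHom.comp_apply]
  · rw [translateLeft_groupLike γ (comul_h ..), translateRight_groupLike γ (comul_h ..)]
  · rw [translateLeft_skew γ (comul_x ..) (algHom_x γ),
      translateRight_skew γ (comul_x ..) (algHom_x γ), map_smul, algHom_x, smul_zero]
  · rw [translateLeft_groupLike γ (comul_H ..), translateRight_groupLike γ (comul_H ..)]
  · rw [translateLeft_skew γ (comul_X ..) (algHom_X γ),
      translateRight_skew γ (comul_X ..) (algHom_X γ), map_smul, algHom_X, smul_zero]

/-- A skew derivation which vanishes on the group-likes `h` and `H` and picks out one of the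
eigenspaces of right translation. -/
theorem PairAlgebra.comp_translate_eq {δ : PairAlgebra hqb hq σ α →ₐ[k] k}
    {D : PairAlgebra hqb hq σ α →ₗ[k] k}
    (hD : IsSkewDerivation δ (Bialgebra.counitAlgHom k _) D) (hh : D (gen hqb hq σ α .h) = 0)
    (hH : D (gen hqb hq σ α .H) = 0) {c : k}
    (hx : γ (gen hqb hq σ α .h) * D (gen hqb hq σ α .x) = c * D (gen hqb hq σ α .x))
    (hX : γ (gen hqb hq σ α .H) * D (gen hqb hq σ α .X) = c * D (gen hqb hq σ α .X))
    (y : PairAlgebra hqb hq σ α) : D (translateRight γ y) = c * D (translateLeft γ y) := by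
  -- Once both composites are skew derivations over the same characters, their difference can be
  -- tested on the four generators. The hypotheses on `c` are the tests at `x` and `X`; at `h` and
  -- `H` both terms vanish.
  have h1 := (hD.comp (translateLeft γ)).smul c
  have h2 := hD.comp (translateRight γ)
  have e : (Bialgebra.counitAlgHom k _).comp (translateLeft γ) =
      (Bialgebra.counitAlgHom k _).comp (translateRight γ) := comp_translateLeft_eq γ _
  rw [comp_translateLeft_eq, e] at h1
  have h3 := (h2.sub h1).eq_zero (adjoin_eq_top hqb hq σ α) (by
    rintro _ ⟨_ | _ | _ | _, rfl⟩ <;> simp only [LinearMap.sub_apply, LinearMap.smul_apply,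
      LinearMap.comp_apply, AlgHom.toLinearMap_apply, smul_eq_mul]
    · simp [translateLeft_groupLike γ (comul_h ..), translateRight_groupLike γ (comul_h ..), hh]
    · simp [translateLeft_skew γ (comul_x ..) (algHom_x γ),
        translateRight_skew γ (comul_x ..) (algHom_x γ), hx]
    · simp [translateLeft_groupLike γ (comul_H ..), translateRight_groupLike γ (comul_H ..), hH]
    · simp [translateLeft_skew γ (comul_X ..) (algHom_X γ),
        translateRight_skew γ (comul_X ..) (algHom_X γ), hX])
  have h4 := LinearMap.congr_fun h3 y
  simpa [sub_eq_zero] using h4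

end General

section TBicrossed

variable {σ : k}

/-- With `α = 0` no relation ties the value at `h` to the value at `H`, so the two roots of unity
are free. -/
theorem TBicrossed.isPair_character (hqb : qb ∈ primitiveRoots n k) (hq : q ∈ primitiveRoots m k)
    {u v : k} (hu : u ^ m = 1) (hv : v ^ n = 1) :
    IsPair m n qb q σ 0 u (0 : k) v 0 where
  h_pow := hu
  x_pow := zero_pow (pos_of_mem_primitiveRoots hq).ne'
  H_pow := hv
  X_pow := zero_pow (pos_of_mem_primitiveRoots hqb).ne'
  x_h := by simp
  X_H := by simp
  h_H := mul_comm _ _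
  x_H := by simp
  h_X := by simp
  x_X := by simp

/-- The character `h ↦ u`, `H ↦ v`, `x, X ↦ 0`. -/
def TBicrossed.character (σ : k) {u v : k} (hu : u ^ m = 1) (hv : v ^ n = 1) :
    TBicrossed hqb hq σ →ₐ[k] k :=
  lift hqb hq (TBicrossed.isPair_character hqb hq (σ := σ) hu hv)

@[simp]
theorem TBicrossed.character_h {u v : k} (hu : u ^ m = 1) (hv : v ^ n = 1) :
    TBicrossed.character hqb hq σ hu hv (gen hqb hq σ 0 .h) = u := lift_gen ..

@[simp]
theorem TBicrossed.character_H {u v : k} (hu : u ^ m = 1) (hv : v ^ n = 1) :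
    TBicrossed.character hqb hq σ hu hv (gen hqb hq σ 0 .H) = v := lift_gen ..

theorem inv_pow_eq_one_of_mem_primitiveRoots {r : ℕ} {ζ : k} (h : ζ ∈ primitiveRoots r k) :
    ζ⁻¹ ^ r = 1 := by
  rw [inv_pow, (isPrimitiveRoot_of_mem_primitiveRoots h).pow_eq_one, inv_one]

theorem ne_zero_of_mem_primitiveRoots {r : ℕ} {ζ : k} (h : ζ ∈ primitiveRoots r k) : ζ ≠ 0 :=
  (isPrimitiveRoot_of_mem_primitiveRoots h).ne_zero (pos_of_mem_primitiveRoots h).ne'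

theorem ne_one_of_mem_primitiveRoots {r : ℕ} (hr : 2 ≤ r) {ζ : k} (h : ζ ∈ primitiveRoots r k) :
    ζ ≠ 1 :=
  (isPrimitiveRoot_of_mem_primitiveRoots h).ne_one hr

variable {hqb hq}

/-- The form dual to `x`: the corner of the representation that sends `x` to a matrix unit, `X` to
zero and `h`, `H` to diagonal matrices. The diagonal entries are dictated by `x h = q h x` and `x H
= σ H x`. -/
theorem TBicrossed.exists_skewDerivation_x (hm : 2 ≤ m) (hσ : σ ^ Nat.gcd m n = 1) :
    ∃ γ D, IsSkewDerivation γ (Bialgebra.counitAlgHom k (TBicrossed hqb hq σ)) D ∧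
      γ (gen hqb hq σ 0 .h) = q⁻¹ ∧ γ (gen hqb hq σ 0 .H) = σ⁻¹ ∧
      D (gen hqb hq σ 0 .h) = 0 ∧ D (gen hqb hq σ 0 .x) = 1 ∧
      D (gen hqb hq σ 0 .H) = 0 ∧ D (gen hqb hq σ 0 .X) = 0 := by
  have hq0 := ne_zero_of_mem_primitiveRoots hq
  have hσn : σ ^ n = 1 := by
    obtain ⟨d, hd⟩ := Nat.gcd_dvd_right m n
    rw [hd, pow_mul, hσ, one_pow]
  have hn := pos_of_mem_primitiveRoots hqb
  have hσ0 : σ ≠ 0 := by rintro rfl; simp [hn.ne'] at hσn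
  have hv : σ⁻¹ ^ n = 1 := by rw [inv_pow, hσn, inv_one]
  have hu := inv_pow_eq_one_of_mem_primitiveRoots hq
  -- The matrix unit has square zero, so two-dimensional matrices suffice for every nilpotency order
  -- `m ≥ 2`.
  have sq : (Matrix.single 0 1 1 : Matrix (Fin 2) (Fin 2) k) ^ m = 0 := by
    rw [← Nat.sub_add_cancel hm, pow_add, pow_two]; simp
  have hr : IsPair m n qb q σ 0 (Matrix.diagonal ![q⁻¹, 1])
      (Matrix.single 0 1 1 : Matrix (Fin 2) (Fin 2) k) (Matrix.diagonal ![σ⁻¹, 1]) 0 :=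
    { h_pow := by
        rw [Matrix.diagonal_pow, ← Matrix.diagonal_one]
        congr 1; ext i; fin_cases i <;> simp [hu]
      x_pow := sq
      H_pow := by
        rw [Matrix.diagonal_pow, ← Matrix.diagonal_one]
        congr 1; ext i; fin_cases i <;> simp [hv]
      X_pow := zero_pow hn.ne'
      x_h := by ext i j; fin_cases i <;> fin_cases j <;> simp [hq0]
      X_H := by simp
      h_H := by simp [mul_comm]
      x_H := by ext i j; fin_cases i <;> fin_cases j <;> simp [hσ0]
      h_X := by simp
      x_X := by simp }
  obtain ⟨D, hD, hD'⟩ := IsSkewDerivation.exists_of_matrix (a := character hqb hq σ hu hv)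
    (b := Bialgebra.counitAlgHom k (TBicrossed hqb hq σ)) (lift hqb hq hr)
    (adjoin_eq_top hqb hq σ 0)
    (by rintro _ ⟨_ | _ | _ | _, rfl⟩ <;> simp [genMap])
    (by rintro _ ⟨_ | _ | _ | _, rfl⟩ <;> simp [genMap, algHom_x, algHom_X])
    (by rintro _ ⟨_ | _ | _ | _, rfl⟩ <;> simp [genMap])
  exact ⟨_, D, hD, character_h .., character_H .., by simp [hD', genMap], by simp [hD', genMap],
    by simp [hD', genMap], by simp [hD', genMap]⟩

/-- The mirror construction for `X`. In `h X = σ X h` the group-like stands on the left, so the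
character takes the value `σ` at `h` and not its inverse. -/
theorem TBicrossed.exists_skewDerivation_X (hn : 2 ≤ n) (hσ : σ ^ Nat.gcd m n = 1) :
    ∃ γ D, IsSkewDerivation γ (Bialgebra.counitAlgHom k (TBicrossed hqb hq σ)) D ∧
      γ (gen hqb hq σ 0 .h) = σ ∧ γ (gen hqb hq σ 0 .H) = qb⁻¹ ∧
      D (gen hqb hq σ 0 .h) = 0 ∧ D (gen hqb hq σ 0 .x) = 0 ∧
      D (gen hqb hq σ 0 .H) = 0 ∧ D (gen hqb hq σ 0 .X) = 1 := by
  have hq0 := ne_zero_of_mem_primitiveRoots hqb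
  have hu : σ ^ m = 1 := by
    obtain ⟨d, hd⟩ := Nat.gcd_dvd_left m n
    conv_lhs => rw [hd]
    rw [pow_mul, hσ, one_pow]
  have hm := pos_of_mem_primitiveRoots hq
  have hv := inv_pow_eq_one_of_mem_primitiveRoots hqb
  have sq : (Matrix.single 0 1 1 : Matrix (Fin 2) (Fin 2) k) ^ n = 0 := by
    rw [← Nat.sub_add_cancel hn, pow_add, pow_two]; simp
  have hr : IsPair m n qb q σ 0 (Matrix.diagonal ![σ, 1]) 0 (Matrix.diagonal ![qb⁻¹, 1])
      (Matrix.single 0 1 1 : Matrix (Fin 2) (Fin 2) k) :=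
    { h_pow := by
        rw [Matrix.diagonal_pow, ← Matrix.diagonal_one]
        congr 1; ext i; fin_cases i <;> simp [hu]
      X_pow := sq
      H_pow := by
        rw [Matrix.diagonal_pow, ← Matrix.diagonal_one]
        congr 1; ext i; fin_cases i <;> simp [hv]
      x_pow := zero_pow hm.ne'
      X_H := by ext i j; fin_cases i <;> fin_cases j <;> simp [hq0]
      x_h := by simp
      h_H := by simp [mul_comm]
      h_X := by ext i j; fin_cases i <;> fin_cases j <;> simp
      x_H := by simp
      x_X := by simp }
  obtain ⟨D, hD, hD'⟩ := IsSkewDerivation.exists_of_matrix (a := character hqb hq σ hu hv)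
    (b := Bialgebra.counitAlgHom k (TBicrossed hqb hq σ)) (lift hqb hq hr)
    (adjoin_eq_top hqb hq σ 0)
    (by rintro _ ⟨_ | _ | _ | _, rfl⟩ <;> simp [genMap])
    (by rintro _ ⟨_ | _ | _ | _, rfl⟩ <;> simp [genMap, algHom_x, algHom_X])
    (by rintro _ ⟨_ | _ | _ | _, rfl⟩ <;> simp [genMap])
  exact ⟨_, D, hD, character_h .., character_H .., by simp [hD', genMap], by simp [hD', genMap],
    by simp [hD', genMap], by simp [hD', genMap]⟩

end TBicrossed

end Characters

/-! ### Isomorphisms between the algebras `T^σ` -/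

section Classification

open PairAlgebra Coalgebra

variable {k : Type*} [Field k] {m n : ℕ} {q qb : k} {hqb : qb ∈ primitiveRoots n k}
  {hq : q ∈ primitiveRoots m k} {σ : k}

section Relations

variable {γ : TBicrossed hqb hq σ →ₐ[k] k} {D : TBicrossed hqb hq σ →ₗ[k] k}

/-- Apply `D` to `x h = q h x` and `x H = σ H x`: since `γ` and `ε` kill `x`, only multiples of `D
x` remain, and `D x` cancels. -/
theorem IsSkewDerivation.eq_inv_of_x
    (hD : IsSkewDerivation γ (Bialgebra.counitAlgHom k (TBicrossed hqb hq σ)) D)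
    (h0 : D (gen hqb hq σ 0 .x) ≠ 0) :
    γ (gen hqb hq σ 0 .h) = q⁻¹ ∧ γ (gen hqb hq σ 0 .H) = σ⁻¹ := by
  have r := isPair hqb hq σ 0
  have h1 := congrArg D r.x_h
  have h2 := congrArg D r.x_H
  simp only [hD.map_mul, map_smul, algHom_x, Bialgebra.counitAlgHom_apply, counit_h, counit_x,
    counit_H, smul_eq_mul, mul_one, mul_zero, zero_mul, zero_add, add_zero] at h1 h2
  rw [← mul_assoc] at h1 h2
  exact ⟨eq_inv_of_mul_eq_one_right (mul_eq_right₀ h0 |>.1 h1.symm),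
    eq_inv_of_mul_eq_one_right (mul_eq_right₀ h0 |>.1 h2.symm)⟩

theorem IsSkewDerivation.eq_inv_of_X
    (hD : IsSkewDerivation γ (Bialgebra.counitAlgHom k (TBicrossed hqb hq σ)) D)
    (h0 : D (gen hqb hq σ 0 .X) ≠ 0) :
    γ (gen hqb hq σ 0 .h) = σ ∧ γ (gen hqb hq σ 0 .H) = qb⁻¹ := by
  have r := isPair hqb hq σ 0
  have h1 := congrArg D r.h_X
  have h2 := congrArg D r.X_H
  simp only [hD.map_mul, map_smul, algHom_X, Bialgebra.counitAlgHom_apply, counit_h, counit_X,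
    counit_H, smul_eq_mul, mul_one, mul_zero, zero_mul, zero_add, add_zero] at h1 h2
  rw [← mul_assoc] at h2
  exact ⟨mul_right_cancel₀ h0 h1, eq_inv_of_mul_eq_one_right (mul_eq_right₀ h0 |>.1 h2.symm)⟩

/-- Commutation of `h` and `H` makes `(D h, D H)` proportional to `(γ h - 1, γ H - 1)`. As this
vector is nonzero, `D` agrees on `h` and `H` with a multiple of `γ - ε`. -/
theorem IsSkewDerivation.exists_sub_eq_zero
    (hD : IsSkewDerivation γ (Bialgebra.counitAlgHom k (TBicrossed hqb hq σ)) D)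
    (hγ : γ (gen hqb hq σ 0 .h) ≠ 1 ∨ γ (gen hqb hq σ 0 .H) ≠ 1) :
    ∃ c : k, D (gen hqb hq σ 0 .h) = c * (γ (gen hqb hq σ 0 .h) - 1) ∧
      D (gen hqb hq σ 0 .H) = c * (γ (gen hqb hq σ 0 .H) - 1) := by
  have h1 := congrArg D (isPair hqb hq σ 0).h_H
  simp only [hD.map_mul, Bialgebra.counitAlgHom_apply, counit_h, counit_H, mul_one] at h1
  rcases hγ with h | h
  · have h' := sub_ne_zero.2 h
    refine ⟨D (gen hqb hq σ 0 .h) / (γ (gen hqb hq σ 0 .h) - 1), by field_simp, ?_⟩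
    field_simp
    linear_combination h1
  · have h' := sub_ne_zero.2 h
    refine ⟨D (gen hqb hq σ 0 .H) / (γ (gen hqb hq σ 0 .H) - 1), ?_, by field_simp⟩
    field_simp
    linear_combination -h1

end Relations

/-- A skew-primitive element which is not killed by the skew derivations lives over `h` or over
`H`. -/
theorem TBicrossed.groupLike_cases (hm : 2 ≤ m) (hn : 2 ≤ n) (hσ : σ ^ Nat.gcd m n = 1)
    {γ : TBicrossed hqb hq σ →ₐ[k] k} {D : TBicrossed hqb hq σ →ₗ[k] k}
    (hD : IsSkewDerivation γ (Bialgebra.counitAlgHom k (TBicrossed hqb hq σ)) D)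
    (hγ : γ (gen hqb hq σ 0 .h) ≠ 1 ∨ γ (gen hqb hq σ 0 .H) ≠ 1)
    {y g : TBicrossed hqb hq σ} (hy : comul (R := k) y = y ⊗ₜ g + 1 ⊗ₜ y)
    (h0 : ∀ χ : TBicrossed hqb hq σ →ₐ[k] k, χ y = 0) (hDy : D y ≠ 0) :
    (γ (gen hqb hq σ 0 .h) = q⁻¹ ∧ γ (gen hqb hq σ 0 .H) = σ⁻¹ ∧
      ∀ χ : TBicrossed hqb hq σ →ₐ[k] k, χ g = χ (gen hqb hq σ 0 .h)) ∨
    (γ (gen hqb hq σ 0 .h) = σ ∧ γ (gen hqb hq σ 0 .H) = qb⁻¹ ∧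
      ∀ χ : TBicrossed hqb hq σ →ₐ[k] k, χ g = χ (gen hqb hq σ 0 .H)) := by
  obtain ⟨γ₁, D₁, hD₁, e1, e2, e3, e4, e5, e6⟩ :=
    TBicrossed.exists_skewDerivation_x (hqb := hqb) (hq := hq) hm hσ
  obtain ⟨γ₂, D₂, hD₂, f1, f2, f3, f4, f5, f6⟩ :=
    TBicrossed.exists_skewDerivation_X (hqb := hqb) (hq := hq) hn hσ
  -- Characters vanish on the nilpotent generators, so they are determined on `h` and `H`.
  have ext : ∀ δ δ' : TBicrossed hqb hq σ →ₐ[k] k, δ (gen hqb hq σ 0 .h) = δ' (gen hqb hq σ 0 .h) →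
      δ (gen hqb hq σ 0 .H) = δ' (gen hqb hq σ 0 .H) → δ = δ' := by
    intro δ δ' h1 h2
    refine algHom_ext ?_
    rintro (_ | _ | _ | _)
    exacts [h1, by rw [algHom_x, algHom_x], h2, by rw [algHom_X, algHom_X]]
  -- Either the coefficient `D x` is zero, and the zero form is a skew derivation over any
  -- character, or `D x ≠ 0` forces `γ = γ₁`.
  have g1 : IsSkewDerivation γ (Bialgebra.counitAlgHom k (TBicrossed hqb hq σ))
      (D (gen hqb hq σ 0 .x) • D₁) := by
    by_cases h : D (gen hqb hq σ 0 .x) = 0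
    · rw [h, zero_smul]; exact ⟨by simp⟩
    · obtain ⟨h1, h2⟩ := hD.eq_inv_of_x h
      rw [ext γ γ₁ (h1.trans e1.symm) (h2.trans e2.symm)]
      exact hD₁.smul _
  have g2 : IsSkewDerivation γ (Bialgebra.counitAlgHom k (TBicrossed hqb hq σ))
      (D (gen hqb hq σ 0 .X) • D₂) := by
    by_cases h : D (gen hqb hq σ 0 .X) = 0
    · rw [h, zero_smul]; exact ⟨by simp⟩
    · obtain ⟨h1, h2⟩ := hD.eq_inv_of_X h
      rw [ext γ γ₂ (h1.trans f1.symm) (h2.trans f2.symm)]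
      exact hD₂.smul _
  obtain ⟨c, hc, hC⟩ := hD.exists_sub_eq_zero hγ
  -- The decomposition `D = c (γ - ε) + D(x) D₁ + D(X) D₂`, checked on generators. At `y` the first
  -- term drops out because every character kills `y`, so one of the other two is nonzero there.
  have key := (((hD.sub ((IsSkewDerivation.sub_algHom γ _).smul c)).sub g1).sub g2).eq_zero
    (adjoin_eq_top hqb hq σ 0) (by
      rintro _ ⟨_ | _ | _ | _, rfl⟩
      · simp [e3, f3, hc]
      · simp [e4, f4, algHom_x]
      · simp [e5, f5, hC]
      · simp [e6, f6, algHom_X])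
  have key' := LinearMap.congr_fun key y
  simp only [LinearMap.sub_apply, LinearMap.smul_apply, AlgHom.toLinearMap_apply, h0,
    smul_eq_mul, LinearMap.zero_apply, sub_self, mul_zero,
    sub_zero] at key'
  by_cases h1 : D (gen hqb hq σ 0 .x) * D₁ y = 0
  · have h2 : D (gen hqb hq σ 0 .X) * D₂ y ≠ 0 := by
      intro h2
      rw [h1, h2] at key'
      exact hDy (by simpa using key')
    obtain ⟨h3, h4⟩ := hD.eq_inv_of_X (left_ne_zero_of_mul h2)
    refine Or.inr ⟨h3, h4, fun χ => ?_⟩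
    -- `D₂` vanishes on `x`, so the condition at `x` is void and the constant is dictated by `X`.
    -- The two translates of `y` are `χ(g) y` and `y`, whence `χ(g) D₂ y = χ(H) D₂ y`, and `D₂ y`
    -- cancels.
    have h5 := comp_translate_eq χ hD₂ f3 f5 (c := χ (gen hqb hq σ 0 .H)) (by simp [f4]) rfl y
    rw [translateRight_skew χ hy (h0 χ), translateLeft_skew χ hy (h0 χ), map_smul,
      smul_eq_mul] at h5
    exact mul_right_cancel₀ (right_ne_zero_of_mul h2) h5
  · obtain ⟨h3, h4⟩ := hD.eq_inv_of_x (left_ne_zero_of_mul h1)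
    refine Or.inl ⟨h3, h4, fun χ => ?_⟩
    have h5 := comp_translate_eq χ hD₁ e3 e5 (c := χ (gen hqb hq σ 0 .h)) rfl (by simp [e6]) y
    rw [translateRight_skew χ hy (h0 χ), translateLeft_skew χ hy (h0 χ), map_smul,
      smul_eq_mul] at h5
    exact mul_right_cancel₀ (right_ne_zero_of_mul h1) h5

theorem comul_bialgEquiv {A B : Type*} [Ring A] [Ring B] [Bialgebra k A] [Bialgebra k B]
    (φ : A ≃ₐc[k] B) (a : A) : comul (R := k) (φ a) = TensorProduct.map (φ : A →ₗ[k] B)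
      (φ : A →ₗ[k] B) (comul (R := k) a) :=
  (CoalgHomClass.map_comp_comul_apply φ a).symm

/-- Transport `D₁` and `D₂` along the isomorphism and test them on the images of `x` and `X`. Each
image lives over `h` or over `H` in the target, at least for characters, and the values of the
transported character of `D₁` compare the parameters. -/
theorem TBicrossed.eq_or_of_bialgEquiv (hm : 2 ≤ m) (hn : 2 ≤ n) {σ' : k}
    (hσ : σ ^ Nat.gcd m n = 1) (hσ' : σ' ^ Nat.gcd m n = 1)
    (φ : TBicrossed hqb hq σ ≃ₐc[k] TBicrossed hqb hq σ') :
    σ = σ' ∨ (qb = q ∧ σ' = σ⁻¹) := by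
  obtain ⟨γ₁, D₁, hD₁, e1, e2, e3, e4, e5, e6⟩ :=
    TBicrossed.exists_skewDerivation_x (hqb := hqb) (hq := hq) hm hσ
  obtain ⟨γ₂, D₂, hD₂, f1, f2, f3, f4, f5, f6⟩ :=
    TBicrossed.exists_skewDerivation_X (hqb := hqb) (hq := hq) hn hσ
  let f : TBicrossed hqb hq σ →ₐ[k] TBicrossed hqb hq σ' := AlgHomClass.toAlgHom φ
  let g : TBicrossed hqb hq σ' →ₐ[k] TBicrossed hqb hq σ := AlgHomClass.toAlgHom φ.symm
  have hgf : ∀ a, g (f a) = a := φ.symm_apply_apply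
  have hfg : ∀ a, f (g a) = a := φ.apply_symm_apply
  have hε : (Bialgebra.counitAlgHom k _).comp g = Bialgebra.counitAlgHom k _ :=
    AlgHom.ext fun a => CoalgHomClass.counit_comp_apply φ.symm a
  have hx : comul (R := k) (f (gen hqb hq σ 0 .x)) =
      f (gen hqb hq σ 0 .x) ⊗ₜ f (gen hqb hq σ 0 .h) + 1 ⊗ₜ f (gen hqb hq σ 0 .x) := by
    refine (comul_bialgEquiv φ _).trans ?_
    rw [comul_x, map_add, TensorProduct.map_tmul, TensorProduct.map_tmul, ← map_one f]
    rfl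
  have hX : comul (R := k) (f (gen hqb hq σ 0 .X)) =
      f (gen hqb hq σ 0 .X) ⊗ₜ f (gen hqb hq σ 0 .H) + 1 ⊗ₜ f (gen hqb hq σ 0 .X) := by
    refine (comul_bialgEquiv φ _).trans ?_
    rw [comul_X, map_add, TensorProduct.map_tmul, TensorProduct.map_tmul, ← map_one f]
    rfl
  -- A transported character trivial at the target's `h` and `H` would be the counit; pulling it
  -- back, `γ` would be the counit as well.
  have nontriv : ∀ γ : TBicrossed hqb hq σ →ₐ[k] k,
      γ (gen hqb hq σ 0 .h) ≠ 1 ∨ γ (gen hqb hq σ 0 .H) ≠ 1 →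
      γ.comp g (gen hqb hq σ' 0 .h) ≠ 1 ∨ γ.comp g (gen hqb hq σ' 0 .H) ≠ 1 := by
    intro γ hγ
    by_contra! h
    have e : γ.comp g = Bialgebra.counitAlgHom k _ := by
      refine algHom_ext ?_
      rintro (_ | _ | _ | _)
      · simpa using h.1
      · rw [algHom_x, algHom_x]
      · simpa using h.2
      · rw [algHom_X, algHom_X]
    have e' : ∀ a, γ a = counit (R := k) a := by
      intro a
      have := DFunLike.congr_fun e (f a)
      rw [AlgHom.comp_apply, hgf] at this
      exact this.trans (CoalgHomClass.counit_comp_apply φ a)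
    simp [e'] at hγ
  have c1 := TBicrossed.groupLike_cases hm hn hσ' (hε ▸ hD₁.comp g)
    (nontriv γ₁ (Or.inl (by
      rw [e1]; exact inv_ne_one.2 (ne_one_of_mem_primitiveRoots hm hq))))
    hx (fun χ => algHom_x (χ.comp f)) (by
      rw [LinearMap.comp_apply, AlgHom.toLinearMap_apply, hgf, e4]; exact one_ne_zero)
  have c2 := TBicrossed.groupLike_cases hm hn hσ' (hε ▸ hD₂.comp g)
    (nontriv γ₂ (Or.inr (by
      rw [f2]; exact inv_ne_one.2 (ne_one_of_mem_primitiveRoots hn hqb))))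
    hX (fun χ => algHom_X (χ.comp f)) (by
      rw [LinearMap.comp_apply, AlgHom.toLinearMap_apply, hgf, f6]; exact one_ne_zero)
  -- The character `h ↦ q`, `H ↦ 1` separates `h` from `H`, so their images cannot lie over the same
  -- group-like of the target.
  have contra : ¬ ∀ χ : TBicrossed hqb hq σ' →ₐ[k] k,
      χ (f (gen hqb hq σ 0 .h)) = χ (f (gen hqb hq σ 0 .H)) := by
    intro h
    have := h ((TBicrossed.character hqb hq σ
      (isPrimitiveRoot_of_mem_primitiveRoots hq).pow_eq_one (one_pow n)).comp g)
    rw [AlgHom.comp_apply, AlgHom.comp_apply, hgf, hgf, TBicrossed.character_h,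
      TBicrossed.character_H] at this
    exact ne_one_of_mem_primitiveRoots hm hq this
  rcases c1 with ⟨a1, a2, a3⟩ | ⟨a1, a2, a3⟩ <;> rcases c2 with ⟨b1, b2, b3⟩ | ⟨b1, b2, b3⟩
  · exact absurd (fun χ => (a3 χ).trans (b3 χ).symm) contra
  · left
    -- Here `H` corresponds to `H`; the value of `γ₁` there is `σ⁻¹` in the source and `σ'⁻¹` in the
    -- target.
    have := b3 (γ₁.comp g)
    rw [a2, AlgHom.comp_apply, hgf, e2] at this
    exact inv_injective this
  · right
    -- Here the group-likes are exchanged: evaluation at the source's `h` compares `q⁻¹` with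
    -- `qb⁻¹`, and at the source's `H` it compares `σ⁻¹` with `σ'`.
    have h1 := a3 (γ₁.comp g)
    have h2 := b3 (γ₁.comp g)
    rw [a2, AlgHom.comp_apply, hgf, e1] at h1
    rw [a1, AlgHom.comp_apply, hgf, e2] at h2
    exact ⟨inv_injective h1.symm, h2.symm⟩
  · exact absurd (fun χ => (a3 χ).trans (b3 χ).symm) contra

/-! ### Explicit isomorphisms, and the separation of `Q` from `T^σ` -/

/-- The exchange of the two Taft algebras. -/
theorem TBicrossed.isPair_swap (hq : q ∈ primitiveRoots n k) {σ σ' : k} (h : σ * σ' = 1) :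
    IsPair n n q q σ 0 (gen hq hq σ' 0 .H) (gen hq hq σ' 0 .X) (gen hq hq σ' 0 .h)
      (gen hq hq σ' 0 .x) := by
  have r := isPair hq hq σ' 0
  exact
  { h_pow := r.H_pow
    x_pow := r.X_pow
    H_pow := r.h_pow
    X_pow := r.x_pow
    x_h := r.X_H
    X_H := r.x_h
    h_H := r.h_H.symm
    x_H := by rw [r.h_X, smul_smul, h, one_smul]
    h_X := by rw [r.x_H, smul_smul, h, one_smul]
    x_X := by rw [r.x_X, zero_smul, zero_smul, add_zero, add_zero, smul_smul, h, one_smul] }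

/-- The exchange of the two Taft algebras. -/
def TBicrossed.swap (hq : q ∈ primitiveRoots n k) {σ σ' : k} (h : σ * σ' = 1) :
    TBicrossed hq hq σ →ₐc[k] TBicrossed hq hq σ' :=
  .ofAlgHom (lift hq hq (TBicrossed.isPair_swap hq h))
    (algHom_ext (by rintro (_ | _ | _ | _) <;> simp [genMap]))
    (algHom_ext (by rintro (_ | _ | _ | _) <;> simp [genMap]))

theorem TBicrossed.swap_comp_swap (hq : q ∈ primitiveRoots n k) {σ σ' : k} (h : σ * σ' = 1)
    (h' : σ' * σ = 1) : (swap hq h).comp (swap hq h') = BialgHom.id k _ := by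
  apply BialgHom.coe_toAlgHom_injective
  refine algHom_ext ?_
  rintro (_ | _ | _ | _) <;> simp [swap, genMap]

theorem TBicrossed.nonempty_swap (hq : q ∈ primitiveRoots n k) {σ σ' : k} (h : σ * σ' = 1) :
    Nonempty (TBicrossed hq hq σ ≃ₐc[k] TBicrossed hq hq σ') :=
  ⟨.ofBialgHom (swap hq h) (swap hq (mul_comm σ σ' ▸ h)) (swap_comp_swap ..) (swap_comp_swap ..)⟩

/-- Every relation is homogeneous in `x` except the linking one, whose parameter is multiplied by
`c`. -/
theorem QBicrossed.isPair_scale (hq : q ∈ primitiveRoots n k) {α β c : k} (h : c * β = α) :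
    IsPair n n (q ^ (n - 1)) q q α (gen (pow_pred_mem_primitiveRoots hq) hq q β .h)
      (c • gen (pow_pred_mem_primitiveRoots hq) hq q β .x)
      (gen (pow_pred_mem_primitiveRoots hq) hq q β .H)
      (gen (pow_pred_mem_primitiveRoots hq) hq q β .X) := by
  have r := isPair (pow_pred_mem_primitiveRoots hq) hq q β
  exact
  { r with
    x_pow := by rw [smul_pow, r.x_pow, smul_zero]
    x_h := by rw [smul_mul_assoc, r.x_h, mul_smul_comm, smul_comm]
    x_H := by rw [smul_mul_assoc, r.x_H, mul_smul_comm, smul_comm]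
    x_X := by rw [smul_mul_assoc, r.x_X, mul_smul_comm, smul_add, smul_comm, smul_smul c β, h] }

/-- The rescaling of `x`. -/
def QBicrossed.scale (hq : q ∈ primitiveRoots n k) {α β c : k} (h : c * β = α) :
    QBicrossed hq α →ₐc[k] QBicrossed hq β :=
  .ofAlgHom (lift _ hq (QBicrossed.isPair_scale hq h))
    (algHom_ext (by rintro (_ | _ | _ | _) <;> simp [genMap]))
    (algHom_ext (by
      rintro (_ | _ | _ | _) <;> simp [genMap, TensorProduct.smul_tmul', TensorProduct.tmul_smul]))

theorem QBicrossed.scale_comp_scale (hq : q ∈ primitiveRoots n k) {α β c d : k} (h : c * β = α)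
    (h' : d * α = β) (hcd : c * d = 1) : (scale hq h).comp (scale hq h') = BialgHom.id k _ := by
  apply BialgHom.coe_toAlgHom_injective
  refine algHom_ext ?_
  rintro (_ | _ | _ | _) <;> simp [scale, genMap, smul_smul, mul_comm d, hcd]

theorem QBicrossed.nonempty_scale (hq : q ∈ primitiveRoots n k) {α : k} (h : α ≠ 0) :
    Nonempty (QBicrossed hq α ≃ₐc[k] QBicrossed hq 1) :=
  ⟨.ofBialgHom (scale hq (mul_one α)) (scale hq (inv_mul_cancel₀ h))
    (scale_comp_scale _ _ _ (mul_inv_cancel₀ h)) (scale_comp_scale _ _ _ (inv_mul_cancel₀ h))⟩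

/-- A count of characters. The isomorphism is used only as a surjective algebra map, through which
distinct characters of `T^σ` pull back to distinct characters of `Q`. -/
theorem QBicrossed.isEmpty_bialgEquiv (hn : 2 ≤ n) (hq : q ∈ primitiveRoots n k) {α : k}
    (hα : α ≠ 0) (σ : k) : IsEmpty (QBicrossed hq α ≃ₐc[k]
      TBicrossed (pow_pred_mem_primitiveRoots hq) hq σ) := by
  refine ⟨fun φ => ?_⟩
  let f : QBicrossed hq α →ₐ[k] TBicrossed (pow_pred_mem_primitiveRoots hq) hq σ :=
    AlgHomClass.toAlgHom φ
  have hf : Function.Surjective f := φ.surjective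
  have hp := isPrimitiveRoot_of_mem_primitiveRoots hq
  have hpow : ∀ i, (q ^ i) ^ n = 1 := fun i => by
    rw [← pow_mul, mul_comm, pow_mul, hp.pow_eq_one, one_pow]
  let χ : Fin n × Fin n → (TBicrossed (pow_pred_mem_primitiveRoots hq) hq σ →ₐ[k] k) :=
    fun p => TBicrossed.character _ hq σ (hpow p.1) (hpow p.2)
  have hχ : Function.Injective χ := by
    rintro ⟨i, j⟩ ⟨i', j'⟩ h
    have h1 := DFunLike.congr_fun h (gen _ hq σ 0 .h)
    have h2 := DFunLike.congr_fun h (gen _ hq σ 0 .H)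
    simp only [χ, TBicrossed.character_h, TBicrossed.character_H] at h1 h2
    rw [Fin.ext (hp.pow_inj i.2 i'.2 h1), Fin.ext (hp.pow_inj j.2 j'.2 h2)]
  -- The linking relation makes the value at `H` the inverse of the value at `h`, so a character of
  -- `Q` is known from its value at `h`.
  have hinj : Function.Injective fun p => χ p (f (gen _ hq q α .h)) := by
    intro p p' h
    refine hχ ((AlgHom.cancel_right hf).1 (algHom_ext ?_))
    have e1 := algHom_H_mul_h ((χ p).comp f) hα
    have e2 := algHom_H_mul_h ((χ p').comp f) hα
    change (χ p).comp f (gen _ hq q α .h) = (χ p').comp f (gen _ hq q α .h) at h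
    rintro (_ | _ | _ | _)
    · exact h
    · rw [algHom_x, algHom_x]
    · rw [h] at e1
      exact mul_right_cancel₀ (right_ne_zero_of_mul (e2.symm ▸ one_ne_zero)) (e1.trans e2.symm)
    · rw [algHom_X, algHom_X]
  -- This would embed `n²` characters into the `n` roots of unity, impossible for `n ≥ 2`.
  have hmem : ∀ p ∈ Finset.univ, χ p (f (gen _ hq q α .h)) ∈ Polynomial.nthRootsFinset n (1 : k) := by
    intro p _
    rw [Polynomial.mem_nthRootsFinset (by omega)]
    exact algHom_h_pow ((χ p).comp f)
  have hcard := Finset.card_le_card_of_injOn _ hmem hinj.injOn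
  rw [hp.card_nthRootsFinset, Finset.card_univ, Fintype.card_prod, Fintype.card_fin] at hcard
  nlinarith

end Classification

/-! ### Linear forms acting on the algebra by contraction of the coproduct -/

section Contraction

open Coalgebra

variable {k A : Type*} [Field k] [Ring A] [Bialgebra k A]

/-- Contraction of the second tensor factor: `a ⊗ b ↦ f(b) a`. -/
def contractRight (f : A →ₗ[k] k) : A ⊗[k] A →ₗ[k] A :=
  (TensorProduct.rid k A).toLinearMap ∘ₗ f.lTensor A

@[simp]
theorem contractRight_tmul (f : A →ₗ[k] k) (a b : A) : contractRight f (a ⊗ₜ b) = f b • a := by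
  simp [contractRight]

theorem contractRight_mul {a b : A →ₐ[k] k} {D : A →ₗ[k] k} (hD : IsSkewDerivation a b D)
    (s t : A ⊗[k] A) : contractRight D (s * t) =
      contractRight a.toLinearMap s * contractRight D t +
        contractRight D s * contractRight b.toLinearMap t := by
  induction s with
  | zero => simp
  | add s s' hs hs' => simp only [add_mul, map_add, hs, hs']; abel
  | tmul u v =>
    induction t with
    | zero => simp
    | add t t' ht ht' => simp only [mul_add, map_add, ht, ht']; abel
    | tmul u' v' => simp [hD.map_mul, smul_smul, add_smul, mul_comm]

/-- The action of linear forms: `a ↦ a₍₁₎ f(a₍₂₎)`. -/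
def hit (f : A →ₗ[k] k) : A →ₗ[k] A := contractRight f ∘ₗ comul

theorem hit_algHom (γ : A →ₐ[k] k) (a : A) : hit γ.toLinearMap a = translateRight γ a := by
  rw [translateRight_apply γ (ℛ k a).eq.symm, hit, LinearMap.comp_apply]
  conv_lhs => rw [← (ℛ k a).eq]
  simp

theorem hit_counit (a : A) : hit (Bialgebra.counitAlgHom k A).toLinearMap a = a := by
  change TensorProduct.rid k A ((counit (R := k) (A := A)).lTensor A (comul (R := k) a)) = a
  simp

/-- Contraction by `γ` is right translation and contraction by the counit is the identity, so the
Leibniz rule of the form `D` becomes that of a twisted derivation of the algebra. -/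
theorem hit_mul {γ : A →ₐ[k] k} {D : A →ₗ[k] k}
    (hD : IsSkewDerivation γ (Bialgebra.counitAlgHom k A) D) (a b : A) :
    hit D (a * b) = translateRight γ a * hit D b + hit D a * b := by
  have h := contractRight_mul hD (comul a) (comul b)
  rw [← Bialgebra.comul_mul] at h
  rw [← hit_algHom]
  refine h.trans (congrArg₂ _ rfl (congrArg₂ _ rfl (hit_counit b)))

/-- Right convolution by `g` is the transpose of the operator `hit`, so powers in the dual can be
computed by iterating an operator on monomials. -/
theorem DualCop.mul_apply_hit (f g : DualCop k A) (a : A) :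
    (f * g) a = f (hit (DualCop.toDual k A g) a) := by
  rw [DualCop.mul_apply f g (ℛ k a), hit, LinearMap.comp_apply]
  conv_rhs => rw [← (ℛ k a).eq]
  simp [mul_comm]

theorem DualCop.mul_apply_translateRight (f : DualCop k A) (γ : A →ₐ[k] k) (a : A) :
    (f * (DualCop.toDual k A).symm γ.toLinearMap) a = f (translateRight γ a) := by
  rw [DualCop.mul_apply_hit, LinearEquiv.apply_symm_apply, hit_algHom]

theorem DualCop.mul_apply_translateLeft (f : DualCop k A) (γ : A →ₐ[k] k) (a : A) :
    ((DualCop.toDual k A).symm γ.toLinearMap * f) a = f (translateLeft γ a) := by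
  rw [DualCop.mul_apply _ _ (ℛ k a), translateLeft_apply γ (ℛ k a).eq.symm]
  simp

end Contraction

/-! ### The dual of the Taft algebra -/

section TaftDual

open Coalgebra TaftAlgebra

variable {k : Type*} [Field k] {n : ℕ} {q : k} (hq : q ∈ primitiveRoots n k)

/-- The character `h ↦ q⁻¹`, `x ↦ 0`. -/
def TaftAlgebra.character : TaftAlgebra hq →ₐ[k] k :=
  lift hq q⁻¹ 0 (inv_pow_eq_one_of_mem_primitiveRoots hq)
    (zero_pow (pos_of_mem_primitiveRoots hq).ne') (by simp)

@[simp]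
theorem TaftAlgebra.character_h : character hq (h hq) = q⁻¹ := lift_h ..

@[simp]
theorem TaftAlgebra.character_x : character hq (x hq) = 0 := lift_x ..

/-- Again the corner of a two-dimensional representation, so that existence precedes any knowledge
of a basis. -/
theorem TaftAlgebra.exists_skewDerivation (hn : 2 ≤ n) :
    ∃ D, IsSkewDerivation (character hq) (Bialgebra.counitAlgHom k (TaftAlgebra hq)) D ∧
      D (h hq) = 0 ∧ D (x hq) = 1 := by
  have hq0 := ne_zero_of_mem_primitiveRoots hq
  have hu := inv_pow_eq_one_of_mem_primitiveRoots hq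
  have sq : (Matrix.single 0 1 1 : Matrix (Fin 2) (Fin 2) k) ^ n = 0 := by
    rw [← Nat.sub_add_cancel hn, pow_add, pow_two]; simp
  obtain ⟨D, hD, hD'⟩ := IsSkewDerivation.exists_of_matrix (a := character hq)
    (b := Bialgebra.counitAlgHom k (TaftAlgebra hq))
    (lift hq (Matrix.diagonal ![q⁻¹, 1]) (Matrix.single 0 1 1)
      (by
        rw [Matrix.diagonal_pow, ← Matrix.diagonal_one]
        congr 1; ext i; fin_cases i <;> simp [hu])
      sq
      (by ext i j; fin_cases i <;> fin_cases j <;> simp [hq0]))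
    (adjoin_eq_top hq) (by rintro _ (rfl | rfl) <;> simp) (by rintro _ (rfl | rfl) <;> simp)
    (by rintro _ (rfl | rfl) <;> simp)
  exact ⟨D, hD, by simp [hD'], by simp [hD']⟩

/-- The group-like element of the dual of the Taft algebra. -/
def TaftAlgebra.dualH : DualCop k (TaftAlgebra hq) :=
  (DualCop.toDual k _).symm (character hq).toLinearMap

variable {hq}

theorem TaftAlgebra.translateRight_monomial (i b : ℕ) :
    translateRight (character hq) (h hq ^ i * x hq ^ b) = q⁻¹ ^ (i + b) • (h hq ^ i * x hq ^ b) := by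
  rw [map_mul, map_pow, map_pow, translateRight_groupLike _ (comul_h hq),
    translateRight_skew _ (comul_x hq) (character_x hq), character_h, smul_pow, smul_pow,
    smul_mul_smul_comm, pow_add]

theorem TaftAlgebra.translateLeft_monomial (i b : ℕ) :
    translateLeft (character hq) (h hq ^ i * x hq ^ b) = q⁻¹ ^ i • (h hq ^ i * x hq ^ b) := by
  rw [map_mul, map_pow, map_pow, translateLeft_groupLike _ (comul_h hq),
    translateLeft_skew _ (comul_x hq) (character_x hq), character_h, smul_pow, smul_mul_assoc]

theorem TaftAlgebra.dualH_mul_apply (f : DualCop k (TaftAlgebra hq)) (i b : ℕ) :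
    (dualH hq * f) (h hq ^ i * x hq ^ b) = q⁻¹ ^ i * f (h hq ^ i * x hq ^ b) := by
  rw [dualH, DualCop.mul_apply_translateLeft, translateLeft_monomial, map_smul, smul_eq_mul]

theorem TaftAlgebra.mul_dualH_apply (f : DualCop k (TaftAlgebra hq)) (i b : ℕ) :
    (f * dualH hq) (h hq ^ i * x hq ^ b) = q⁻¹ ^ (i + b) * f (h hq ^ i * x hq ^ b) := by
  rw [dualH, DualCop.mul_apply_translateRight, translateRight_monomial, map_smul, smul_eq_mul]

theorem TaftAlgebra.dualH_pow_mul_apply (f : DualCop k (TaftAlgebra hq)) (l i b : ℕ) :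
    (dualH hq ^ l * f) (h hq ^ i * x hq ^ b) = (q⁻¹ ^ i) ^ l * f (h hq ^ i * x hq ^ b) := by
  induction l with
  | zero => simp
  | succ l ih => rw [pow_succ', mul_assoc, dualH_mul_apply, ih, pow_succ', mul_assoc]

theorem TaftAlgebra.dual_ext {f g : DualCop k (TaftAlgebra hq)}
    (hfg : ∀ i b, f (h hq ^ i * x hq ^ b) = g (h hq ^ i * x hq ^ b)) : f = g := by
  refine (DualCop.toDual k _).injective (LinearMap.ext_on_range (span_eq_top hq) ?_)
  exact fun p => hfg p.1 p.2

theorem TaftAlgebra.one_apply_monomial (i b : ℕ) :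
    (1 : DualCop k (TaftAlgebra hq)) (h hq ^ i * x hq ^ b) = if b = 0 then 1 else 0 := by
  rw [DualCop.one_apply, Bialgebra.counit_mul, Bialgebra.counit_pow, Bialgebra.counit_pow,
    counit_h, counit_x, one_pow, one_mul]
  split_ifs with hb
  · rw [hb, pow_zero]
  · exact zero_pow hb

theorem TaftAlgebra.dualH_pow : dualH hq ^ n = 1 := by
  refine dual_ext fun i b => ?_
  rw [← mul_one (dualH hq ^ n), dualH_pow_mul_apply, ← pow_mul, mul_comm i, pow_mul,
    inv_pow_eq_one_of_mem_primitiveRoots hq, one_pow, one_mul]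

section SkewDerivation

variable {D : TaftAlgebra hq →ₗ[k] k}

/-- The operator is a `q⁻¹`-derivative: moving past each `x` costs a factor `q⁻¹`, which builds up
the quantum integer. At `b = 0` the truncated exponent is harmless, since the empty sum is zero. -/
theorem TaftAlgebra.hit_x_pow
    (hD : IsSkewDerivation (character hq) (Bialgebra.counitAlgHom k (TaftAlgebra hq)) D)
    (hDh : D (h hq) = 0) (hDx : D (x hq) = 1) (b : ℕ) :
    hit D (x hq ^ b) = (∑ s ∈ Finset.range b, q⁻¹ ^ s) • x hq ^ (b - 1) := by
  have h1 : hit D (x hq) = 1 := by simp [hit, hDh, hDx]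
  have h0 : hit D (1 : TaftAlgebra hq) = 0 := by
    simp [hit, hD.map_one, Algebra.TensorProduct.one_def]
  induction b with
  | zero => simp [h0]
  | succ b ih =>
    rw [pow_succ', hit_mul hD, ih, h1, translateRight_skew _ (comul_x hq) (character_x hq),
      character_h, smul_mul_smul_comm, one_mul, Nat.add_sub_cancel, Finset.sum_range_succ']
    cases b with
    | zero => simp
    | succ b =>
      rw [Nat.add_sub_cancel, ← pow_succ', add_smul, pow_zero, one_smul, Finset.mul_sum]
      simp only [pow_succ']

theorem TaftAlgebra.hit_monomial
    (hD : IsSkewDerivation (character hq) (Bialgebra.counitAlgHom k (TaftAlgebra hq)) D)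
    (hDh : D (h hq) = 0) (hDx : D (x hq) = 1) (i b : ℕ) : hit D (h hq ^ i * x hq ^ b) =
    (q⁻¹ ^ i * ∑ s ∈ Finset.range b, q⁻¹ ^ s) • (h hq ^ i * x hq ^ (b - 1)) := by
  have h1 : hit D (h hq) = 0 := by simp [hit, hDh]
  have h0 : hit D (1 : TaftAlgebra hq) = 0 := by
    simp [hit, hD.map_one, Algebra.TensorProduct.one_def]
  have h2 : hit D (h hq ^ i) = 0 := by
    induction i with
    | zero => simp [h0]
    | succ i ih => rw [pow_succ, hit_mul hD, h1, ih, mul_zero, zero_mul, add_zero]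
  rw [hit_mul hD, h2, hit_x_pow hD hDh hDx, map_pow, translateRight_groupLike _ (comul_h hq),
    character_h, smul_pow, smul_mul_smul_comm, zero_mul, add_zero]

/-- Differentiate `j` times and apply the counit: only `b = j` survives, leaving the `q⁻¹`-factorial
of `j`, and `h ^ i` contributes `q⁻¹ ^ i` at each differentiation. -/
theorem TaftAlgebra.dualX_pow_apply
    (hD : IsSkewDerivation (character hq) (Bialgebra.counitAlgHom k (TaftAlgebra hq)) D)
    (hDh : D (h hq) = 0) (hDx : D (x hq) = 1) (j i b : ℕ) :
    ((DualCop.toDual k _).symm D ^ j) (h hq ^ i * x hq ^ b) = if b = j then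
      (q⁻¹ ^ i) ^ j * ∏ r ∈ Finset.range j, ∑ s ∈ Finset.range (r + 1), q⁻¹ ^ s else 0 := by
  induction j generalizing b with
  | zero => rw [pow_zero, one_apply_monomial]; simp
  | succ j ih =>
    rw [pow_succ, DualCop.mul_apply_hit, LinearEquiv.apply_symm_apply, hit_monomial hD hDh hDx,
      map_smul, ih]
    cases b with
    | zero => simp
    | succ b =>
      by_cases hb : b = j
      · subst hb
        simp only [Nat.add_sub_cancel, if_true, Finset.prod_range_succ, smul_eq_mul]
        ring
      · simp [hb]

theorem TaftAlgebra.dualX_pow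
    (hD : IsSkewDerivation (character hq) (Bialgebra.counitAlgHom k (TaftAlgebra hq)) D)
    (hDh : D (h hq) = 0) (hDx : D (x hq) = 1) : (DualCop.toDual k _).symm D ^ n = 0 := by
  refine dual_ext fun i b => ?_
  -- At `b = n` the general formula leaves a factorial, so the vanishing is taken from `x ^ n = 0`;
  -- for other `b` the formula is already zero.
  by_cases hb : b = n
  · rw [hb, x_pow, mul_zero, map_zero, map_zero]
  · rw [dualX_pow_apply hD hDh hDx, if_neg hb]
    rfl

/-- Only monomials with a single `x` contribute, and there right translation by the character gives
one more factor `q⁻¹` than left translation. -/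
theorem TaftAlgebra.dualX_mul_dualH
    (hD : IsSkewDerivation (character hq) (Bialgebra.counitAlgHom k (TaftAlgebra hq)) D)
    (hDh : D (h hq) = 0) (hDx : D (x hq) = 1) : (DualCop.toDual k _).symm D * dualH hq =
    q⁻¹ • (dualH hq * (DualCop.toDual k _).symm D) := by
  refine dual_ext fun i b => ?_
  rw [mul_dualH_apply, map_smul, LinearMap.smul_apply, dualH_mul_apply,
    ← pow_one ((DualCop.toDual k _).symm D), dualX_pow_apply hD hDh hDx]
  split_ifs with hb
  · rw [hb, smul_eq_mul]
    ring
  · simp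

/-- The pairing of the two families of `n²` monomials is block diagonal in the degree `j`. Each
block is a Vandermonde matrix in the nodes `q⁻¹ ^ i`, up to nonzero scalars. The nondegeneracy gives
both the dimension of the Taft algebra and the generation of its dual. -/
theorem TaftAlgebra.eq_zero_of_pairing
    (hD : IsSkewDerivation (character hq) (Bialgebra.counitAlgHom k (TaftAlgebra hq)) D)
    (hDh : D (h hq) = 0) (hDx : D (x hq) = 1) {c : Fin n × Fin n → k}
    (hc : ∀ l j : Fin n, (dualH hq ^ (l : ℕ) * (DualCop.toDual k _).symm D ^ (j : ℕ))
      (∑ p, c p • (h hq ^ (p.1 : ℕ) * x hq ^ (p.2 : ℕ))) = 0) : c = 0 := by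
  have hp : IsPrimitiveRoot q⁻¹ n := (isPrimitiveRoot_of_mem_primitiveRoots hq).inv
  have hinj : Function.Injective fun i : Fin n => q⁻¹ ^ (i : ℕ) :=
    fun i j h => Fin.ext (hp.pow_inj i.2 j.2 h)
  -- The quantum integers below `n` do not vanish: times `q⁻¹ - 1` they give `q⁻¹ ^ (r + 1) - 1`
  -- with `0 < r + 1 < n`, nonzero by primitivity.
  have hfac : ∀ j : Fin n, ∏ r ∈ Finset.range j, ∑ s ∈ Finset.range (r + 1), q⁻¹ ^ s ≠ 0 := by
    intro j
    refine Finset.prod_ne_zero_iff.2 fun r hr h0 => ?_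
    have h1 := mul_geom_sum q⁻¹ (r + 1)
    rw [h0, mul_zero] at h1
    exact hp.pow_ne_one_of_pos_of_lt (by omega)
      (by have := Finset.mem_range.1 hr; have := j.2; omega) (sub_eq_zero.1 h1.symm)
  have key : ∀ j : Fin n, (fun i : Fin n => c (i, j) * ((q⁻¹ ^ (i : ℕ)) ^ (j : ℕ) *
      ∏ r ∈ Finset.range j, ∑ s ∈ Finset.range (r + 1), q⁻¹ ^ s)) = 0 := by
    intro j
    -- For fixed `j`, the power `l` of the dual group-like supplies the row of the Vandermonde
    -- system, with distinct nodes indexed by `i`.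
    refine Matrix.eq_zero_of_forall_pow_sum_mul_pow_eq_zero hinj fun l => ?_
    rw [← hc l j, map_sum, Fintype.sum_prod_type]
    refine Finset.sum_congr rfl fun i _ => ?_
    rw [Finset.sum_eq_single j]
    · rw [map_smul, dualH_pow_mul_apply, dualX_pow_apply hD hDh hDx, if_pos rfl, smul_eq_mul]
      ring
    · intro b _ hb
      rw [map_smul, dualH_pow_mul_apply, dualX_pow_apply hD hDh hDx,
        if_neg (fun h => hb (Fin.ext h)), mul_zero, smul_zero]
    · simp
  funext ⟨i, j⟩
  have h0 : (q⁻¹ ^ (i : ℕ)) ^ (j : ℕ) ≠ 0 :=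
    pow_ne_zero _ (pow_ne_zero _ (inv_ne_zero (ne_zero_of_mem_primitiveRoots hq)))
  exact (mul_eq_zero.1 (congrFun (key j) i)).resolve_right (mul_ne_zero h0 (hfac j))

end SkewDerivation

theorem TaftAlgebra.span_monomials :
    Submodule.span k (Set.range fun p : Fin n × Fin n => h hq ^ (p.1 : ℕ) * x hq ^ (p.2 : ℕ)) =
      ⊤ := by
  rw [eq_top_iff, ← span_eq_top hq, Submodule.span_le]
  rintro _ ⟨p, rfl⟩
  change h hq ^ p.1 * x hq ^ p.2 ∈ _
  have hn := pos_of_mem_primitiveRoots hq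
  by_cases hp : p.2 < n
  · have e : h hq ^ p.1 = h hq ^ (p.1 % n) := by
      conv_lhs => rw [← Nat.mod_add_div p.1 n, pow_add, pow_mul, h_pow, one_pow, mul_one]
    rw [e]
    exact Submodule.subset_span ⟨(⟨p.1 % n, Nat.mod_lt _ hn⟩, ⟨p.2, hp⟩), rfl⟩
  · rw [← Nat.sub_add_cancel (not_lt.1 hp), pow_add (x hq), x_pow, mul_zero, mul_zero]
    exact Submodule.zero_mem _

theorem TaftAlgebra.finrank_eq (hn : 2 ≤ n) : Module.finrank k (TaftAlgebra hq) = n * n := by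
  obtain ⟨D, hD, hDh, hDx⟩ := exists_skewDerivation hq hn
  have hli : LinearIndependent k
      fun p : Fin n × Fin n => h hq ^ (p.1 : ℕ) * x hq ^ (p.2 : ℕ) := by
    refine Fintype.linearIndependent_iff.2 fun c hc p => ?_
    have := eq_zero_of_pairing hD hDh hDx (c := c) fun l j => by rw [hc, map_zero]
    rw [this]
    rfl
  rw [Module.finrank_eq_card_basis (Module.Basis.mk hli span_monomials.ge), Fintype.card_prod,
    Fintype.card_fin]

/-- By nondegeneracy of the pairing no nonzero element of the Taft algebra is killed by all
monomials in the two forms. In finite dimension a subspace of the dual with zero coannihilator is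
the whole dual. -/
theorem TaftAlgebra.adjoin_dual {D : TaftAlgebra hq →ₗ[k] k}
    (hD : IsSkewDerivation (character hq) (Bialgebra.counitAlgHom k (TaftAlgebra hq)) D)
    (hDh : D (h hq) = 0) (hDx : D (x hq) = 1) :
    Algebra.adjoin k {dualH hq, (DualCop.toDual k _).symm D} = ⊤ := by
  set B := Algebra.adjoin k {dualH hq, (DualCop.toDual k _).symm D} with hB
  let W : Submodule k (Module.Dual k (TaftAlgebra hq)) :=
    (Subalgebra.toSubmodule B).map (DualCop.toDual k _).toLinearMap
  have hW : W.dualCoannihilator = ⊥ := by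
    refine (Submodule.eq_bot_iff _).2 fun a ha => ?_
    have ha' : a ∈ Submodule.span k (Set.range fun p : Fin n × Fin n =>
        h hq ^ (p.1 : ℕ) * x hq ^ (p.2 : ℕ)) := by
      rw [span_monomials]; exact Submodule.mem_top
    obtain ⟨c, rfl⟩ := (Submodule.mem_span_range_iff_exists_fun k).1 ha'
    have h0 := eq_zero_of_pairing hD hDh hDx (c := c) fun l j => by
      refine (Submodule.mem_dualCoannihilator _).1 ha _ (Submodule.mem_map_of_mem ?_)
      exact B.mul_mem (B.pow_mem (Algebra.subset_adjoin (by simp)) _)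
        (B.pow_mem (Algebra.subset_adjoin (by simp)) _)
    simp [h0]
  have hW' : W = ⊤ := by
    rw [← Subspace.dualCoannihilator_dualAnnihilator_eq (W := W), hW,
      Submodule.dualAnnihilator_bot]
  rw [eq_top_iff]
  intro f _
  have hf : DualCop.toDual k _ f ∈ W := hW' ▸ Submodule.mem_top
  obtain ⟨g, hg, hgf⟩ := hf
  rwa [← (DualCop.toDual k _).injective hgf]

end TaftDual

/-! ### Triangular factorisation and the dimension bound -/

section Triangular

open PairAlgebra

variable {k : Type*} [Field k] {m n : ℕ} {q qb : k} (hqb : qb ∈ primitiveRoots n k)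
  (hq : q ∈ primitiveRoots m k) (σ α : k)

/-- The Taft algebra generated by `H` and `X`. -/
def PairAlgebra.inclLeft : TaftAlgebra hqb →ₐ[k] PairAlgebra hqb hq σ α :=
  TaftAlgebra.lift hqb _ _ (isPair hqb hq σ α).H_pow (isPair hqb hq σ α).X_pow
    (isPair hqb hq σ α).X_H

/-- The Taft algebra generated by `h` and `x`. -/
def PairAlgebra.inclRight : TaftAlgebra hq →ₐ[k] PairAlgebra hqb hq σ α :=
  TaftAlgebra.lift hq _ _ (isPair hqb hq σ α).h_pow (isPair hqb hq σ α).x_pow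
    (isPair hqb hq σ α).x_h

/-- The multiplication map from the tensor product of the two Taft algebras. -/
def PairAlgebra.mulMap : TaftAlgebra hqb ⊗[k] TaftAlgebra hq →ₗ[k] PairAlgebra hqb hq σ α :=
  LinearMap.mul' k _ ∘ₗ
    TensorProduct.map (inclLeft hqb hq σ α).toLinearMap (inclRight hqb hq σ α).toLinearMap

@[simp]
theorem PairAlgebra.inclLeft_h :
    inclLeft hqb hq σ α (TaftAlgebra.h hqb) = gen hqb hq σ α .H :=
  TaftAlgebra.lift_h hqb _ _ _ _ _

@[simp]
theorem PairAlgebra.inclLeft_x :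
    inclLeft hqb hq σ α (TaftAlgebra.x hqb) = gen hqb hq σ α .X :=
  TaftAlgebra.lift_x hqb _ _ _ _ _

@[simp]
theorem PairAlgebra.inclRight_h :
    inclRight hqb hq σ α (TaftAlgebra.h hq) = gen hqb hq σ α .h :=
  TaftAlgebra.lift_h hq _ _ _ _ _

@[simp]
theorem PairAlgebra.inclRight_x :
    inclRight hqb hq σ α (TaftAlgebra.x hq) = gen hqb hq σ α .x :=
  TaftAlgebra.lift_x hq _ _ _ _ _

theorem PairAlgebra.mulMap_tmul (a : TaftAlgebra hqb) (b : TaftAlgebra hq) :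
    mulMap hqb hq σ α (a ⊗ₜ b) = inclLeft hqb hq σ α a * inclRight hqb hq σ α b := rfl

/-- The cross relations move `h` and `x` to the right of `H` and `X`, so the products of the two
Taft subalgebras are stable under left multiplication by all generators, and they contain 1. -/
theorem PairAlgebra.mulMap_surjective : Function.Surjective (mulMap hqb hq σ α) := by
  have r := isPair hqb hq σ α
  set W := LinearMap.range (mulMap hqb hq σ α) with hW
  have hL : ∀ c : TaftAlgebra hqb, ∀ w ∈ W, inclLeft hqb hq σ α c * w ∈ W := by
    rintro c _ ⟨t, rfl⟩
    induction t with
    | zero => simp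
    | add s t hs ht => rw [map_add, mul_add]; exact W.add_mem hs ht
    | tmul a b => exact ⟨(c * a) ⊗ₜ b, by simp [mulMap_tmul, mul_assoc]⟩
  have hH : ∀ w ∈ W, gen hqb hq σ α .H * w ∈ W := by
    simpa using hL (TaftAlgebra.h hqb)
  have hX : ∀ w ∈ W, gen hqb hq σ α .X * w ∈ W := by
    simpa using hL (TaftAlgebra.x hqb)
  have hR : ∀ b : TaftAlgebra hq, inclRight hqb hq σ α b ∈ W := fun b =>
    ⟨1 ⊗ₜ b, by simp [mulMap_tmul]⟩
  have key : ∀ (a : TaftAlgebra hqb) (b : TaftAlgebra hq),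
      gen hqb hq σ α .h * (inclLeft hqb hq σ α a * inclRight hqb hq σ α b) ∈ W ∧
      gen hqb hq σ α .x * (inclLeft hqb hq σ α a * inclRight hqb hq σ α b) ∈ W := by
    intro a b
    -- Stability under `h` and `x` has to be proved simultaneously with membership in `W`: the
    -- linking relation turns `x X w` into terms in `x w`, `w` and `h w`. This `V` is stable under
    -- `H` and `X` and contains the right-hand Taft subalgebra.
    let V : Submodule k (PairAlgebra hqb hq σ α) := W ⊓
      (W.comap (LinearMap.mulLeft k (gen hqb hq σ α .h)) ⊓
        W.comap (LinearMap.mulLeft k (gen hqb hq σ α .x)))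
    have ha : a ∈ Algebra.adjoin k {TaftAlgebra.h hqb, TaftAlgebra.x hqb} :=
      TaftAlgebra.adjoin_eq_top hqb ▸ Algebra.mem_top
    have hV : ∀ w ∈ V, inclLeft hqb hq σ α a * w ∈ V := by
      induction ha using Algebra.adjoin_induction with
      | mem y hy =>
        rintro w ⟨hw, hhw, hxw⟩
        change gen hqb hq σ α .h * w ∈ W at hhw
        change gen hqb hq σ α .x * w ∈ W at hxw
        rcases hy with rfl | rfl
        · rw [inclLeft_h]
          refine ⟨hH w hw, ?_, ?_⟩
          · change gen hqb hq σ α .h * (gen hqb hq σ α .H * w) ∈ W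
            rw [← mul_assoc, r.h_H, mul_assoc]
            exact hH _ hhw
          · change gen hqb hq σ α .x * (gen hqb hq σ α .H * w) ∈ W
            rw [← mul_assoc, r.x_H, smul_mul_assoc, mul_assoc]
            exact W.smul_mem _ (hH _ hxw)
        · rw [inclLeft_x]
          refine ⟨hX w hw, ?_, ?_⟩
          · change gen hqb hq σ α .h * (gen hqb hq σ α .X * w) ∈ W
            rw [← mul_assoc, r.h_X, smul_mul_assoc, mul_assoc]
            exact W.smul_mem _ (hX _ hhw)
          · change gen hqb hq σ α .x * (gen hqb hq σ α .X * w) ∈ W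
            rw [← mul_assoc, r.x_X, add_mul, smul_mul_assoc, smul_mul_assoc, sub_mul, one_mul,
              mul_assoc, mul_assoc]
            exact W.add_mem (W.smul_mem _ (hX _ hxw))
              (W.smul_mem _ (W.sub_mem hw (hH _ hhw)))
      | algebraMap c =>
        intro w hw
        rw [AlgHom.commutes, ← Algebra.smul_def]
        exact V.smul_mem c hw
      | add y z _ _ hy hz =>
        intro w hw
        rw [map_add, add_mul]
        exact V.add_mem (hy w hw) (hz w hw)
      | mul y z _ _ hy hz =>
        intro w hw
        rw [map_mul, mul_assoc]
        exact hy _ (hz w hw)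
    exact (hV (inclRight hqb hq σ α b) ⟨hR b, by
      change gen hqb hq σ α .h * _ ∈ W
      rw [← inclRight_h, ← map_mul]; exact hR _, by
      change gen hqb hq σ α .x * _ ∈ W
      rw [← inclRight_x, ← map_mul]; exact hR _⟩).2
  have hhx : ∀ w ∈ W, gen hqb hq σ α .h * w ∈ W ∧ gen hqb hq σ α .x * w ∈ W := by
    rintro _ ⟨t, rfl⟩
    induction t with
    | zero => simp
    | add s t hs ht =>
      rw [map_add, mul_add, mul_add]
      exact ⟨W.add_mem hs.1 ht.1, W.add_mem hs.2 ht.2⟩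
    | tmul a b => exact key a b
  have h1 : (1 : PairAlgebra hqb hq σ α) ∈ W := by simpa using hR 1
  rw [← LinearMap.range_eq_top, eq_top_iff]
  intro a _
  have ha : a ∈ Algebra.adjoin k (Set.range (gen hqb hq σ α)) :=
    adjoin_eq_top hqb hq σ α ▸ Algebra.mem_top
  have hmul : ∀ w ∈ W, a * w ∈ W := by
    induction ha using Algebra.adjoin_induction with
    | mem y hy =>
      obtain ⟨_ | _ | _ | _, rfl⟩ := hy
      exacts [fun w hw => (hhx w hw).1, fun w hw => (hhx w hw).2, hH, hX]
    | algebraMap c =>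
      intro w hw
      rw [← Algebra.smul_def]
      exact W.smul_mem c hw
    | add y z _ _ hy hz =>
      intro w hw
      rw [add_mul]
      exact W.add_mem (hy trivial w hw) (hz trivial w hw)
    | mul y z _ _ hy hz =>
      intro w hw
      rw [mul_assoc]
      exact hy trivial _ (hz trivial w hw)
  simpa only [mul_one] using hmul 1 h1

instance : Module.Finite k (PairAlgebra hqb hq σ α) :=
  Module.Finite.of_surjective _ (mulMap_surjective hqb hq σ α)

/-- Only the upper bound is needed; for `Q` with parameter 1 the lower bound comes from its
surjection onto the double. -/
theorem PairAlgebra.finrank_le : Module.finrank k (PairAlgebra hqb hq σ α) ≤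
    Module.finrank k (TaftAlgebra hqb) * Module.finrank k (TaftAlgebra hq) := by
  rw [← Module.finrank_tensorProduct]
  exact LinearMap.finrank_le_finrank_of_surjective (mulMap_surjective hqb hq σ α)

end Triangular

/-! ### The Drinfeld double of the Taft algebra -/

section Double

open Coalgebra TaftAlgebra DrinfeldDouble

variable {k : Type*} [Field k] {n : ℕ} {q : k} {hq : q ∈ primitiveRoots n k}

/-- The iterated coproduct is `h ⊗ h ⊗ h`, so the cross relation only conjugates the argument of the
form by `h`. -/
theorem DrinfeldDouble.incl_groupLike_mul {A : Type*} [Ring A] [HopfAlgebra k A]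
    [HasBijectiveAntipode k A] [Module.Finite k A] {h : A} (hh : comul (R := k) h = h ⊗ₜ h)
    (g : DualCop k A) : incl k A h * inclDual k A g =
      inclDual k A ((DualCop.toDual k A).symm ((DualCop.toDual k A g) ∘ₗ
        LinearMap.mulLeft k (antipodeInv k A h) ∘ₗ LinearMap.mulRight k h)) * incl k A h := by
  refine (tmul_mul_tmul 1 g h 1 {()} (fun _ => h) (fun _ => h) (fun _ => h)
    (by simp [hh])).trans ?_
  rw [Finset.sum_singleton, one_mul, mul_one, tmul_eq_mul]

/-- The three terms come from the iterated coproduct `x ⊗ h ⊗ h + 1 ⊗ x ⊗ h + 1 ⊗ 1 ⊗ x`. -/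
theorem DrinfeldDouble.incl_skew_mul {A : Type*} [Ring A] [HopfAlgebra k A]
    [HasBijectiveAntipode k A] [Module.Finite k A] {h x : A} (hh : comul (R := k) h = h ⊗ₜ h)
    (hx : comul (R := k) x = x ⊗ₜ h + 1 ⊗ₜ x) (g : DualCop k A) :
    incl k A x * inclDual k A g =
      inclDual k A ((DualCop.toDual k A).symm ((DualCop.toDual k A g) ∘ₗ
        LinearMap.mulLeft k (antipodeInv k A h) ∘ₗ LinearMap.mulRight k x)) * incl k A h +
      inclDual k A ((DualCop.toDual k A).symm ((DualCop.toDual k A g) ∘ₗ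
        LinearMap.mulLeft k (antipodeInv k A h))) * incl k A x +
      inclDual k A ((DualCop.toDual k A).symm ((DualCop.toDual k A g) ∘ₗ
        LinearMap.mulLeft k (antipodeInv k A x))) := by
  refine (tmul_mul_tmul 1 g x 1 Finset.univ ![x, 1, 1] ![h, x, 1] ![h, h, x] (by
    simp [Fin.sum_univ_three, hh, hx, TensorProduct.tmul_add, add_assoc])).trans ?_
  simp only [Fin.sum_univ_three, one_mul, mul_one, tmul_eq_mul]
  simp

theorem TaftAlgebra.antipodeInv_h :
    antipodeInv k (TaftAlgebra hq) (h hq) = h hq ^ (n - 1) := by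
  have := antipode_antipodeInv hq (h hq)
  rw [antipodeInvHom_h, MulOpposite.unop_op] at this
  conv_lhs => rw [← this, antipodeInv_antipode]

theorem TaftAlgebra.antipodeInv_x :
    antipodeInv k (TaftAlgebra hq) (x hq) = -(h hq ^ (n - 1) * x hq) := by
  have := antipode_antipodeInv hq (x hq)
  rw [antipodeInvHom_x, MulOpposite.unop_op] at this
  conv_lhs => rw [← this, antipodeInv_antipode]

theorem DualCop.comul_algHom {A : Type*} [Ring A] [Bialgebra k A] [Module.Finite k A]
    (γ : A →ₐ[k] k) : comul (R := k) ((DualCop.toDual k A).symm γ.toLinearMap) =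
      (DualCop.toDual k A).symm γ.toLinearMap ⊗ₜ (DualCop.toDual k A).symm γ.toLinearMap := by
  refine DualCop.pairing_ext fun a b => ?_
  rw [DualCop.pairing_comul, DualCop.pairing_tmul]
  simp [mul_comm]

/-- The co-opposite pairs `Δ D` with `a ⊗ b` as `D (b a)`, so the Leibniz rule reads `D(a) γ(b) +
ε(a) D(b)`: exactly the convention for `X` over `H`. -/
theorem DualCop.comul_skewDerivation {A : Type*} [Ring A] [Bialgebra k A] [Module.Finite k A]
    {γ : A →ₐ[k] k} {D : A →ₗ[k] k} (hD : IsSkewDerivation γ (Bialgebra.counitAlgHom k A) D) :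
    comul (R := k) ((DualCop.toDual k A).symm D) =
      (DualCop.toDual k A).symm D ⊗ₜ (DualCop.toDual k A).symm γ.toLinearMap +
        1 ⊗ₜ (DualCop.toDual k A).symm D := by
  refine DualCop.pairing_ext fun a b => ?_
  rw [DualCop.pairing_comul, map_add, LinearMap.add_apply, DualCop.pairing_tmul,
    DualCop.pairing_tmul]
  simp [hD.map_mul, mul_comm]

theorem TaftAlgebra.character_h_pow_pred : character hq (h hq ^ (n - 1)) = q := by
  have h1 := congrArg (character hq) (groupLike_inv (pos_of_mem_primitiveRoots hq) (h_pow hq)).1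
  rw [map_mul, character_h, map_one] at h1
  exact (eq_inv_of_mul_eq_one_right h1).trans (inv_inv q)

theorem DrinfeldDouble.h_mul_dualH : incl k _ (h hq) * inclDual k _ (dualH hq) =
    inclDual k _ (dualH hq) * incl k _ (h hq) := by
  rw [incl_groupLike_mul (comul_h hq), antipodeInv_h]
  congr 2
  ext w
  have h1 : character hq (h hq ^ (n - 1)) * character hq (h hq) = 1 := by
    rw [character_h_pow_pred, character_h,
      mul_inv_cancel₀ (ne_zero_of_mem_primitiveRoots hq)]
  simp only [LinearMap.comp_apply, LinearMap.mulLeft_apply,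
    LinearMap.mulRight_apply, dualH, LinearEquiv.apply_symm_apply, AlgHom.toLinearMap_apply,
    map_mul]
  linear_combination character hq w * h1

/-- The character is multiplicative and kills `x`, so of the three terms only the middle one
survives, with factor `γ(h⁻¹) = q`. -/
theorem DrinfeldDouble.x_mul_dualH : incl k _ (x hq) * inclDual k _ (dualH hq) =
    q • (inclDual k _ (dualH hq) * incl k _ (x hq)) := by
  have e1 : (DualCop.toDual k _).symm ((DualCop.toDual k _ (dualH hq)) ∘ₗ
      LinearMap.mulLeft k (h hq ^ (n - 1)) ∘ₗ LinearMap.mulRight k (x hq)) = 0 := by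
    ext w; simp [dualH]
  have e2 : (DualCop.toDual k _).symm ((DualCop.toDual k _ (dualH hq)) ∘ₗ
      LinearMap.mulLeft k (h hq ^ (n - 1))) = q • dualH hq := by
    ext w
    simp only [dualH, LinearMap.comp_apply, LinearMap.mulLeft_apply,
      LinearEquiv.apply_symm_apply, AlgHom.toLinearMap_apply, map_mul, character_h_pow_pred,
      map_smul, LinearMap.smul_apply, smul_eq_mul]
  have e3 : (DualCop.toDual k _).symm ((DualCop.toDual k _ (dualH hq)) ∘ₗ
      LinearMap.mulLeft k (-(h hq ^ (n - 1) * x hq))) = 0 := by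
    ext w; simp [dualH]
  rw [incl_skew_mul (comul_h hq) (comul_x hq), antipodeInv_h, antipodeInv_x, e1, e2, e3, map_zero,
    zero_mul, zero_add, add_zero, map_smul, smul_mul_assoc]

section SkewDerivation

variable {D : TaftAlgebra hq →ₗ[k] k}

theorem TaftAlgebra.skewDerivation_h_pow
    (hD : IsSkewDerivation (character hq) (Bialgebra.counitAlgHom k (TaftAlgebra hq)) D)
    (hDh : D (h hq) = 0) (i : ℕ) : D (h hq ^ i) = 0 := by
  induction i with
  | zero => rw [pow_zero, hD.map_one]
  | succ i ih => rw [pow_succ, hD.map_mul, hDh, ih, mul_zero, zero_mul, add_zero]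

theorem DrinfeldDouble.h_mul_dualX
    (hD : IsSkewDerivation (character hq) (Bialgebra.counitAlgHom k (TaftAlgebra hq)) D)
    (hDh : D (h hq) = 0) :
    incl k _ (h hq) * inclDual k _ ((DualCop.toDual k _).symm D) =
      q • (inclDual k _ ((DualCop.toDual k _).symm D) * incl k _ (h hq)) := by
  rw [incl_groupLike_mul (comul_h hq), antipodeInv_h, ← smul_mul_assoc, ← map_smul]
  congr 2
  ext w
  simp [hD.map_mul, skewDerivation_h_pow hD hDh, character_h_pow_pred, hDh]

/-- The Leibniz rule evaluates the three terms. The outer two, where `D` absorbs `x`, give a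
multiple of `H h` and a constant; together they form the linking term. The middle one gives the
`q`-commutation. -/
theorem DrinfeldDouble.x_mul_dualX
    (hD : IsSkewDerivation (character hq) (Bialgebra.counitAlgHom k (TaftAlgebra hq)) D)
    (hDh : D (h hq) = 0) (hDx : D (x hq) = 1) :
    incl k _ (x hq) * inclDual k _ ((DualCop.toDual k _).symm D) =
      q • (inclDual k _ ((DualCop.toDual k _).symm D) * incl k _ (x hq)) +
        (-q) • (1 - inclDual k _ (dualH hq) * incl k _ (h hq)) := by
  have e1 : (DualCop.toDual k _).symm ((DualCop.toDual k _ ((DualCop.toDual k _).symm D)) ∘ₗ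
      LinearMap.mulLeft k (h hq ^ (n - 1)) ∘ₗ LinearMap.mulRight k (x hq)) = q • dualH hq := by
    ext w
    simp [dualH, hD.map_mul, skewDerivation_h_pow hD hDh, character_h_pow_pred, hDx]
  have e2 : (DualCop.toDual k _).symm ((DualCop.toDual k _ ((DualCop.toDual k _).symm D)) ∘ₗ
      LinearMap.mulLeft k (h hq ^ (n - 1))) = q • (DualCop.toDual k _).symm D := by
    ext w
    simp [hD.map_mul, skewDerivation_h_pow hD hDh, character_h_pow_pred]
  have e3 : (DualCop.toDual k _).symm ((DualCop.toDual k _ ((DualCop.toDual k _).symm D)) ∘ₗ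
      LinearMap.mulLeft k (-(h hq ^ (n - 1) * x hq))) = (-q) • 1 := by
    ext w
    simp [hD.map_mul, skewDerivation_h_pow hD hDh, character_h_pow_pred, hDx]
  rw [incl_skew_mul (comul_h hq) (comul_x hq), antipodeInv_h, antipodeInv_x, e1, e2, e3, map_smul,
    map_smul, map_smul, map_one, smul_mul_assoc, smul_mul_assoc, smul_sub, neg_smul, neg_smul]
  abel

variable {c : k}

/-- The scalar `c = -q⁻¹` on the dual form cancels the parameter `-q` of the linking relation, while
the other relations are homogeneous in `X`. -/
theorem DrinfeldDouble.isPair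
    (hD : IsSkewDerivation (character hq) (Bialgebra.counitAlgHom k (TaftAlgebra hq)) D)
    (hDh : D (h hq) = 0) (hDx : D (x hq) = 1) (hc : c * -q = 1) :
    PairAlgebra.IsPair n n (q ^ (n - 1)) q q 1
    (incl k (TaftAlgebra hq) (h hq)) (incl k (TaftAlgebra hq) (x hq))
    (inclDual k (TaftAlgebra hq) (dualH hq))
    (c • inclDual k (TaftAlgebra hq) ((DualCop.toDual k _).symm D)) := by
  have hqi : q ^ (n - 1) = q⁻¹ := by
    refine eq_inv_of_mul_eq_one_left ?_
    rw [← pow_succ, Nat.sub_add_cancel (pos_of_mem_primitiveRoots hq)]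
    exact (isPrimitiveRoot_of_mem_primitiveRoots hq).pow_eq_one
  exact
  { h_pow := by rw [← map_pow, h_pow, map_one]
    x_pow := by rw [← map_pow, x_pow, map_zero]
    H_pow := by rw [← map_pow, dualH_pow, map_one]
    X_pow := by rw [smul_pow, ← map_pow, dualX_pow hD hDh hDx, map_zero, smul_zero]
    x_h := by rw [← map_mul, x_mul_h, map_smul, map_mul]
    X_H := by
      rw [smul_mul_assoc, ← map_mul, dualX_mul_dualH hD hDh hDx, map_smul, map_mul, mul_smul_comm,
        hqi, smul_comm]
    h_H := h_mul_dualH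
    x_H := x_mul_dualH
    h_X := by rw [mul_smul_comm, h_mul_dualX hD hDh, smul_mul_assoc, smul_comm]
    x_X := by
      rw [mul_smul_comm, x_mul_dualX hD hDh hDx, smul_mul_assoc, smul_add, smul_comm,
        smul_smul c (-q), hc] }

/-- The homomorphism to the Drinfeld double of the Taft algebra. -/
def DrinfeldDouble.fromQBicrossed
    (hD : IsSkewDerivation (character hq) (Bialgebra.counitAlgHom k (TaftAlgebra hq)) D)
    (hDh : D (h hq) = 0) (hDx : D (x hq) = 1) (hc : c * -q = 1) :
    QBicrossed hq 1 →ₐc[k] DrinfeldDouble k (TaftAlgebra hq) :=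
  .ofAlgHom (PairAlgebra.lift _ hq (DrinfeldDouble.isPair hD hDh hDx hc))
    (PairAlgebra.algHom_ext (by
      rintro (_ | _ | _ | _) <;> simp [PairAlgebra.genMap, counit_incl, counit_inclDual, dualH,
        hD.map_one]))
    (PairAlgebra.algHom_ext (by
      rintro (_ | _ | _ | _) <;> simp [PairAlgebra.genMap, comul_incl, comul_inclDual, dualH,
        DualCop.comul_algHom, DualCop.comul_skewDerivation hD, TensorProduct.smul_tmul',
        TensorProduct.tmul_smul]))

/-- The double is spanned by products of its two subalgebras, and each is generated by images of
generators: `h` and `x` for the Taft algebra, the character and `D` for its dual. -/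
theorem DrinfeldDouble.fromQBicrossed_surjective
    (hD : IsSkewDerivation (character hq) (Bialgebra.counitAlgHom k (TaftAlgebra hq)) D)
    (hDh : D (h hq) = 0) (hDx : D (x hq) = 1) (hc : c * -q = 1) :
    Function.Surjective (fromQBicrossed hD hDh hDx hc) := by
  let f := PairAlgebra.lift (pow_pred_mem_primitiveRoots hq) hq
    (DrinfeldDouble.isPair hD hDh hDx hc)
  have hf : ∀ i, PairAlgebra.genMap _ _ _ _ i ∈ f.range := fun i =>
    ⟨_, PairAlgebra.lift_gen _ hq (DrinfeldDouble.isPair hD hDh hDx hc) i⟩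
  have h1 : ∀ a, incl k (TaftAlgebra hq) a ∈ f.range := by
    intro a
    have ha : a ∈ Algebra.adjoin k {h hq, x hq} := adjoin_eq_top hq ▸ Algebra.mem_top
    refine (Algebra.adjoin_le (S := f.range.comap (incl k (TaftAlgebra hq))) ?_) ha
    rintro _ (rfl | rfl)
    exacts [hf .h, hf .x]
  have h2 : ∀ g, inclDual k (TaftAlgebra hq) g ∈ f.range := by
    intro g
    have hg : g ∈ Algebra.adjoin k {dualH hq, (DualCop.toDual k _).symm D} :=
      adjoin_dual hD hDh hDx ▸ Algebra.mem_top
    refine (Algebra.adjoin_le (S := f.range.comap (inclDual k (TaftAlgebra hq))) ?_) hg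
    rintro _ (rfl | rfl)
    · exact hf .H
    -- The image of `X` is `c D`; multiplying by `-q` undoes the normalisation.
    · have := f.range.smul_mem (hf .X) (-q)
      rw [PairAlgebra.genMap, smul_smul, mul_comm, hc, one_smul] at this
      exact this
  have h3 : LinearMap.range f.toLinearMap = ⊤ := by
    refine (Submodule.eq_top_iff').2 fun w => ?_
    refine TensorProduct.induction_on (R := k) (M := DualCop k (TaftAlgebra hq))
      (N := TaftAlgebra hq) (motive := fun w => w ∈ LinearMap.range f.toLinearMap) w
      (Submodule.zero_mem _) (fun g a => ?_) (fun _ _ => Submodule.add_mem _)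
    have : tmul g a ∈ f.range := by
      rw [tmul_eq_mul]
      exact f.range.mul_mem (h2 g) (h1 a)
    exact this
  exact LinearMap.range_eq_top.1 h3

/-- A dimension squeeze: the double has dimension `n⁴`, the source has dimension at most `n⁴`, and
the map is onto. -/
theorem DrinfeldDouble.fromQBicrossed_bijective
    (hD : IsSkewDerivation (character hq) (Bialgebra.counitAlgHom k (TaftAlgebra hq)) D)
    (hDh : D (h hq) = 0) (hDx : D (x hq) = 1) (hc : c * -q = 1) (hn : 2 ≤ n) :
    Function.Bijective (fromQBicrossed hD hDh hDx hc) := by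
  have hs := fromQBicrossed_surjective hD hDh hDx hc
  let f : QBicrossed hq 1 →ₗ[k] DrinfeldDouble k (TaftAlgebra hq) :=
    (PairAlgebra.lift _ hq (DrinfeldDouble.isPair hD hDh hDx hc)).toLinearMap
  have hfin : Module.Finite k (DrinfeldDouble k (TaftAlgebra hq)) :=
    Module.Finite.of_surjective f hs
  have h1 : Module.finrank k (DrinfeldDouble k (TaftAlgebra hq)) = n * n * (n * n) := by
    refine (Module.finrank_tensorProduct (R := k) (S := k) (M := DualCop k (TaftAlgebra hq))
      (M' := TaftAlgebra hq)).trans ?_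
    rw [LinearEquiv.finrank_eq (DualCop.toDual k _), Subspace.dual_finrank_eq, finrank_eq hn]
  have h2 := PairAlgebra.finrank_le (pow_pred_mem_primitiveRoots hq) hq q 1
  rw [finrank_eq hn, finrank_eq hn, ← h1] at h2
  have h3 := le_antisymm h2 (LinearMap.finrank_le_finrank_of_surjective (f := f) hs)
  exact ⟨(LinearMap.injective_iff_surjective_of_finrank_eq_finrank h3 (f := f)).2 hs, hs⟩

end SkewDerivation

theorem QBicrossed.nonempty_drinfeldDouble (hn : 2 ≤ n) (hq : q ∈ primitiveRoots n k) :
    Nonempty (QBicrossed hq 1 ≃ₐc[k] DrinfeldDouble k (TaftAlgebra hq)) := by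
  obtain ⟨D, hD, hDh, hDx⟩ := TaftAlgebra.exists_skewDerivation hq hn
  exact ⟨.ofBijective _ (fromQBicrossed_bijective hD hDh hDx
    (c := -q⁻¹) (by rw [neg_mul_neg, inv_mul_cancel₀ (ne_zero_of_mem_primitiveRoots hq)]) hn)⟩

end Double

end TaftDouble

end

/-! ### Assembly of the four statements -/

theorem mainTheorem3 {k : Type*} [Field k] [CharZero k] (m n : ℕ) (hm : 2 ≤ m) (hn : 2 ≤ n) :
    (∀ (q qb : k) (hq : q ∈ primitiveRoots m k) (hqb : qb ∈ primitiveRoots n k),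
      (n ≠ m ∨ (m = n ∧ qb ≠ q)) →
      ∀ σ σ' : k, σ ^ Nat.gcd m n = 1 → σ' ^ Nat.gcd m n = 1 →
        (Nonempty (TaftDouble.TBicrossed hqb hq σ ≃ₐc[k] TaftDouble.TBicrossed hqb hq σ') ↔
          σ = σ')) ∧
    (∀ (q : k) (hq : q ∈ primitiveRoots n k), ∀ σ σ' : k, σ ^ n = 1 → σ' ^ n = 1 →
        (Nonempty (TaftDouble.TBicrossed hq hq σ ≃ₐc[k] TaftDouble.TBicrossed hq hq σ') ↔
          (σ' = σ ∨ σ' = σ⁻¹))) ∧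
    (∀ (q : k) (hq : q ∈ primitiveRoots n k),
      (∀ α : k, α ≠ 0 →
        Nonempty (TaftDouble.QBicrossed hq α ≃ₐc[k] TaftDouble.QBicrossed hq 1)) ∧
      Nonempty (TaftDouble.QBicrossed hq 1 ≃ₐc[k]
        TaftDouble.DrinfeldDouble k (TaftDouble.TaftAlgebra hq))) ∧
    (∀ (q : k) (hq : q ∈ primitiveRoots n k), ∀ σ : k, σ ^ n = 1 →
      ¬ Nonempty (TaftDouble.QBicrossed hq 1 ≃ₐc[k]
        TaftDouble.TBicrossed (TaftDouble.pow_pred_mem_primitiveRoots hq) hq σ)) := by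
  refine ⟨?_, ?_, ?_, ?_⟩
  · intro q qb hq hqb hne σ σ' hσ hσ'
    refine ⟨fun ⟨φ⟩ => ?_, fun h => h ▸ ⟨BialgEquiv.refl k _⟩⟩
    refine (TaftDouble.TBicrossed.eq_or_of_bialgEquiv hm hn hσ hσ' φ).resolve_right ?_
    -- Equal roots have equal orders, so `qb = q` rules out `n ≠ m` as well as the alternative
    -- hypothesis.
    rintro ⟨rfl, -⟩
    rcases hne with h | h
    · exact h ((isPrimitiveRoot_of_mem_primitiveRoots hqb).unique
        (isPrimitiveRoot_of_mem_primitiveRoots hq))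
    · exact h.2 rfl
  · intro q hq σ σ' hσ hσ'
    have hσ0 : σ ≠ 0 := by
      rintro rfl
      rw [zero_pow (by omega)] at hσ
      exact zero_ne_one hσ
    constructor
    · rintro ⟨φ⟩
      -- The general lemma states the condition on the parameters with `gcd m n`, here `gcd n n`.
      rw [← Nat.gcd_self n] at hσ hσ'
      exact (TaftDouble.TBicrossed.eq_or_of_bialgEquiv hn hn hσ hσ' φ).imp Eq.symm And.right
    · rintro (rfl | rfl)
      · exact ⟨BialgEquiv.refl k _⟩
      · exact TaftDouble.TBicrossed.nonempty_swap hq (mul_inv_cancel₀ hσ0)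
  · exact fun q hq => ⟨fun α hα => TaftDouble.QBicrossed.nonempty_scale hq hα,
      TaftDouble.QBicrossed.nonempty_drinfeldDouble hn hq⟩
  · exact fun q hq σ _ => not_nonempty_iff.2
      (TaftDouble.QBicrossed.isEmpty_bialgEquiv hn hq one_ne_zero σ)
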